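/- Let $k$ be an algebraically closed field and let $X$ be either a scheme of finite type over $k$ or a complex space (in which case $k=\mathbb C$). Let $D$ be an effective Cartier divisor on $X$, let $\mathcal E$ be a vector bundle (a locally free sheaf of finite rank) on $X$, and let $\nabla:\mathcal E\to\mathcal E\otimes\Omega^1_X(D)$ be a $k$-linear connection, $\nabla(fs)=f\nabla s+s\otimes df$. Extend $\nabla$ to $\mathcal E\otimes\Omega^{\bullet}_X(*D)$ by $\nabla(s\otimes\omega)=\nabla s\wedge\omega+s\otimes d\omega$ and assume that $\nabla$ is integrable, $\nabla^2=0$. Let $\nabla_{\mathrm{End}}(\phi)=\nabla\circ\phi-\phi\circ\nabla$ be the induced integrable connection on $\mathcal End(\mathcal E)$, and put $$\mathcal R^\bullet=[\mathcal End(\mathcal E)\to\mathcal End(\mathcal E)\otimes\Omega^1_X(D)\to\mathcal End(\mathcal E)\otimes\Omega^2_X(*D)\to\mathcal End(\mathcal E)\otimes\Omega^3_X(*D)\to\cdots],$$ $$\mathcal F^\bullet=[\mathcal End(\mathcal E)\to\ker(\mathcal End(\mathcal E)\otimes\Omega^1_X(D)\to\mathcal End(\mathcal E)\otimes\Omega^2_X(*D))],$$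 with differentials given by $\nabla_{\mathrm{End}}$. The hypercohomology $\mathbb H^1(X,K^\bullet)$ of a complex of sheaves is the colimit over open covers $\mathfrak U=(U_i)$ of the first cohomology of the total complex of the Čech double complex: a $1$-cocycle is a pair $(a,A)$ in $\check C^1(\mathfrak U,K^0)\oplus\check C^0(\mathfrak U,K^1)$ with $a_{jl}-a_{il}+a_{ij}=0$, $A_j-A_i=d\,a_{ij}$ and $d A_i=0$, and a $1$-coboundary is a pair $(h_j-h_i,\;d h_i)$ with $h\in\check C^0(\mathfrak U,K^0)$. A first-order deformation of $(\mathcal E,\nabla)$ in the class of integrable connections with divisor of poles $D$ is a vector bundle $\tilde{\mathcal E}$ on $X\times\operatorname{Spec}k[\epsilon]$, $\epsilon^2=0$, with an integrable $k[\epsilon]$-linear connection $\tilde\nabla:\tilde{\mathcal E}\to\tilde{\mathcal E}\otimes_{\mathcal O_X}\Omega^1_X(D)$ and an isomorphism of the reduction of $(\tilde{\mathcal E},\tilde\nabla)$ modulo $\epsilon$ with $(\mathcal E,\nabla)$. An isomorphism of deformations is an isomorphism of bundles on $X\times\operatorname{Spec}k[\epsilon]$ that is compatible with the connections and induces the identity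 on $\mathcal E$. A cocycle $(a,A)$ of $\mathcal F^\bullet$ on $\mathfrak U$ describes $(\tilde{\mathcal E},\tilde\nabla)$ if there are $\mathcal O$-linear splittings $\sigma_i:\mathcal E|_{U_i}\to\tilde{\mathcal E}|_{U_i}$ of the projection $\tilde{\mathcal E}\to\mathcal E$ with $\sigma_j=\sigma_i\circ(1+\epsilon a_{ij})$ on $U_i\cap U_j$ and $\tilde\nabla\circ\sigma_i=\sigma_i\circ(\nabla+\epsilon A_i)$. Then: (1) every such deformation is described by some cocycle of $\mathcal F^\bullet$ on some open cover; (2) there is exactly one bijection from the set of isomorphism classes of such deformations to $\mathbb H^1(X,\mathcal F^\bullet)$ that maps the class of a deformation to the class of every cocycle that describes it; (3) the inclusion $\mathcal F^\bullet\subset\mathcal R^\bullet$ induces an isomorphism $\mathbb H^1(X,\mathcal F^\bullet)\cong\mathbb H^1(X,\mathcal R^\bullet)$. -/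

import Mathlib

universe u v

noncomputable section

open scoped TensorProduct
open AlgebraicGeometry CategoryTheory TopologicalSpace Opposite

/-! ### The de Rham algebra -/

namespace DeRham

variable (k B : Type*) [CommRing k] [CommRing B] [Algebra k B]

/-- The exterior algebra of the Kähler differentials of `B` over `k`. -/
abbrev Alg := ExteriorAlgebra B Ω[B⁄k]

namespace Alg

variable {B}
/-- The exact form `df`. -/
def diff (f : B) : Alg k B := ExteriorAlgebra.ι B (KaehlerDifferential.D k B f)

variable (B)
/-- The grade involution, `(-1) ^ p` on `p`-forms. -/
def invol : Alg k B →ₐ[B] Alg k B :=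
  CliffordAlgebra.involute (Q := (0 : QuadraticForm B Ω[B⁄k]))

variable {k B}
lemma invol_ι (v : Ω[B⁄k]) : invol k B (ExteriorAlgebra.ι B v) = -ExteriorAlgebra.ι B v :=
  CliffordAlgebra.involute_ι v

lemma invol_invol (w : Alg k B) : invol k B (invol k B w) = w :=
  CliffordAlgebra.involute_involute w

lemma ι_mul_comm (v w : Ω[B⁄k]) : ExteriorAlgebra.ι B v * ExteriorAlgebra.ι B w =
    -(ExteriorAlgebra.ι B w * ExteriorAlgebra.ι B v) :=
  eq_neg_of_add_eq_zero_left (ExteriorAlgebra.ι_add_mul_swap v w)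

lemma invol_mul_ι (w : Alg k B) (v : Ω[B⁄k]) :
    invol k B w * ExteriorAlgebra.ι B v = ExteriorAlgebra.ι B v * w := by
  induction w using ExteriorAlgebra.induction with
  | algebraMap r => rw [AlgHom.commutes]; exact Algebra.commutes _ _
  | ι x => rw [invol_ι, neg_mul, ← ι_mul_comm]
  | mul a b ha hb => rw [map_mul, mul_assoc, hb, ← mul_assoc, ha, mul_assoc]
  | add a b ha hb => rw [map_add, add_mul, ha, hb, mul_add]

/-- `b₀ db₁ ↦ db₀ ∧ db₁` on the free module on symbols `db`. -/
def dFree : (B →₀ B) →+ Alg k B :=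
  Finsupp.liftAddHom fun y =>
    { toFun := fun b => diff k b * diff k y
      map_zero' := by simp [diff]
      map_add' := fun a b => by simp [diff, add_mul] }

lemma dFree_single (a y : B) : dFree (k := k) (Finsupp.single y a) = diff k a * diff k y := by
  simp only [dFree, Finsupp.liftAddHom_apply_single]; rfl

lemma diff_mul (a b : B) : diff k (a * b) = a • diff k b + b • diff k a := by
  simp [diff]

lemma diff_sq (a : B) : diff k a * diff k a = 0 := ExteriorAlgebra.ι_sq_zero _

lemma diff_comm (a b : B) : diff k a * diff k b = - (diff k b * diff k a) := ι_mul_comm _ _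

lemma dFree_smul_mem (x : B →₀ B) (hx : x ∈ KaehlerDifferential.kerTotal k B) :
    dFree (k := k) x = 0 := by
  have key : ∀ s ∈ (Set.range fun x : B × B =>
      Finsupp.single x.1 (1:B) + Finsupp.single x.2 1 - Finsupp.single (x.1 + x.2) 1) ∪
      (Set.range fun x : B × B =>
      Finsupp.single x.2 x.1 + Finsupp.single x.1 x.2 - Finsupp.single (x.1 * x.2) 1) ∪
      Set.range fun x : k => Finsupp.single (algebraMap k B x) (1:B),
      ∀ b : B, dFree (k := k) (b • s) = 0 := by
    rintro s ((⟨⟨x, y⟩, rfl⟩ | ⟨⟨x, y⟩, rfl⟩) | ⟨x, rfl⟩) b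
    · simp only [smul_sub, smul_add, Finsupp.smul_single, map_sub, map_add, dFree_single]
      simp [diff, mul_add]
    · simp only [smul_sub, smul_add, Finsupp.smul_single, map_sub, map_add, dFree_single,
        smul_eq_mul, mul_one, diff_mul, mul_add, add_mul, smul_mul_assoc, mul_smul_comm]
      rw [diff_comm y x, smul_neg]
      abel
    · simp only [Finsupp.smul_single, dFree_single]
      simp [diff]
  rw [KaehlerDifferential.kerTotal] at hx
  refine Submodule.closure_induction (p := fun x _ => dFree (k := k) x = 0) (by simp)
    (fun x y _ _ hx hy => by simp [hx, hy]) (fun r x hx => key x hx r) hx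

/-- The descent of `dFree` to the Kähler differentials, in their presentation. -/
def dFreeQuot : ((B →₀ B) ⧸ KaehlerDifferential.kerTotal k B) →+ Alg k B :=
  QuotientAddGroup.lift (KaehlerDifferential.kerTotal k B).toAddSubgroup dFree
    (fun x hx => dFree_smul_mem x hx)

/-- The exterior derivative on one-forms, `b₀ db₁ ↦ db₀ ∧ db₁`. -/
def dOne : Ω[B⁄k] →+ Alg k B :=
  dFreeQuot.comp (KaehlerDifferential.quotKerTotalEquiv k B).symm.toAddEquiv.toAddMonoidHom

lemma dOne_smul_D (a b : B) :
    dOne (a • KaehlerDifferential.D k B b) = diff k a * diff k b := by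
  have h : (KaehlerDifferential.quotKerTotalEquiv k B).symm (a • KaehlerDifferential.D k B b) =
      (KaehlerDifferential.kerTotal k B).mkQ (Finsupp.single b a) := by
    rw [LinearEquiv.symm_apply_eq]
    simp [KaehlerDifferential.quotKerTotalEquiv]
  have h' : dOne (a • KaehlerDifferential.D k B b) = dFreeQuot
    ((KaehlerDifferential.quotKerTotalEquiv k B).symm (a • KaehlerDifferential.D k B b)) := rfl
  rw [h', h]
  exact dFree_single a b

lemma one_form_induction {p : Ω[B⁄k] → Prop} (h0 : p 0) (ha : ∀ x y, p x → p y → p (x + y))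
    (hs : ∀ a b : B, p (a • KaehlerDifferential.D k B b)) (x : Ω[B⁄k]) : p x := by
  have hx : x ∈ Submodule.span B (Set.range (KaehlerDifferential.D k B)) := by
    rw [KaehlerDifferential.span_range_derivation]; trivial
  refine Submodule.closure_induction (p := fun x _ => p x) h0 (fun x y _ _ => ha x y) ?_ hx
  rintro r _ ⟨b, rfl⟩
  exact hs r b

lemma dOne_smul (a : B) (v : Ω[B⁄k]) :
    dOne (a • v) = diff k a * ExteriorAlgebra.ι B v + a • dOne v := by
  induction v using one_form_induction with
  | h0 => simp
  | ha x y hx hy => simp only [smul_add, map_add, hx, hy, mul_add]; abel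
  | hs b c =>
    rw [smul_smul, dOne_smul_D, dOne_smul_D, diff_mul, add_mul, map_smul]
    simp only [smul_mul_assoc, mul_smul_comm, diff]
    abel

lemma invol_dOne (v : Ω[B⁄k]) : invol k B (dOne v) = dOne v := by
  induction v using one_form_induction with
  | h0 => simp
  | ha x y hx hy => simp [hx, hy]
  | hs b c => simp [dOne_smul_D, diff, invol_ι]

lemma ι_mul_dOne (v w : Ω[B⁄k]) :
    ExteriorAlgebra.ι B v * dOne w = dOne w * ExteriorAlgebra.ι B v := by
  rw [← invol_mul_ι, invol_dOne]

variable (k B)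
/-- Upper triangular matrices `[[w^, q], [0, w]]`, where `w^` is the grade involution: the second
column of a multiplicative map into this ring is an antiderivation. -/
def Twist : Subring (Matrix (Fin 2) (Fin 2) (Alg k B)) where
  carrier := {M | M 1 0 = 0 ∧ M 0 0 = invol k B (M 1 1)}
  mul_mem' := by
    rintro a b ⟨ha, ha'⟩ ⟨hb, hb'⟩
    simp [Matrix.mul_apply, Fin.sum_univ_two, ha, ha', hb, hb']
  one_mem' := by simp
  add_mem' := by
    rintro a b ⟨ha, ha'⟩ ⟨hb, hb'⟩
    simp [ha, ha', hb, hb']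
  zero_mem' := by simp
  neg_mem' := by
    rintro a ⟨ha, ha'⟩
    simp [ha, ha']

variable {k B}
/-- The matrix `[[w^, q], [0, w]]`. -/
def Twist.mk (w q : Alg k B) : Twist k B :=
  ⟨!![invol k B w, q; 0, w], by simp [Twist]⟩

@[ext] lemma Twist.ext {a b : Twist k B} (h : a.1 1 1 = b.1 1 1) (h' : a.1 0 1 = b.1 0 1) :
    a = b := by
  apply Subtype.ext
  ext i j
  have ha := a.2; have hb := b.2
  simp only [Twist] at ha hb
  change _ ∧ _ at ha
  change _ ∧ _ at hb
  fin_cases i <;> fin_cases j <;> simp [ha.1, hb.1, ha.2, hb.2, h, h']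

lemma Twist.mul_fst (a b : Twist k B) : (a * b).1 1 1 = a.1 1 1 * b.1 1 1 := by
  have ha : a.1 1 0 = 0 := a.2.1
  simp [Matrix.mul_apply, Fin.sum_univ_two, ha]

lemma Twist.mul_snd (a b : Twist k B) :
    (a * b).1 0 1 = invol k B (a.1 1 1) * b.1 0 1 + a.1 0 1 * b.1 1 1 := by
  have ha : a.1 0 0 = _ := a.2.2
  simp [Matrix.mul_apply, Fin.sum_univ_two, ha]

@[simp] lemma Twist.mk_fst (w q : Alg k B) : (Twist.mk w q).1 1 1 = w := rfl
@[simp] lemma Twist.mk_snd (w q : Alg k B) : (Twist.mk w q).1 0 1 = q := rfl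

variable (k B)
/-- The homomorphism `b ↦ [[b, db], [0, b]]`. -/
def Twist.ofBase : B →+* Twist k B where
  toFun b := Twist.mk (algebraMap B _ b) (diff k b)
  map_zero' := by ext <;> simp [diff]
  map_one' := by ext <;> simp [diff]
  map_add' a b := by ext <;> simp [diff]
  map_mul' a b := by
    ext
    · simp [Twist.mul_fst]
    · rw [Twist.mul_snd]
      simp only [Twist.mk_fst, Twist.mk_snd, AlgHom.commutes, diff_mul]
      rw [← Algebra.commutes b, ← Algebra.smul_def, ← Algebra.smul_def]

instance : Algebra B (Twist k B) :=
  (Twist.ofBase k B).toAlgebra' fun b x => by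
    ext
    · simp only [Twist.mul_fst]
      exact Algebra.commutes (A := Alg k B) b _
    · simp only [Twist.mul_snd]
      change invol k B (algebraMap B _ b) * _ + diff k b * _ =
        _ * diff k b + _ * algebraMap B _ b
      rw [AlgHom.commutes, Algebra.commutes, diff, invol_mul_ι, add_comm]

lemma Twist.smul_fst (b : B) (x : Twist k B) : (b • x).1 1 1 = b • x.1 1 1 := by
  rw [Algebra.smul_def, Twist.mul_fst, Algebra.smul_def]; rfl

lemma Twist.smul_snd (b : B) (x : Twist k B) :
    (b • x).1 0 1 = b • x.1 0 1 + diff k b * x.1 1 1 := by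
  rw [Algebra.smul_def, Twist.mul_snd]
  change invol k B (algebraMap B _ b) * _ + diff k b * _ = _
  rw [AlgHom.commutes, Algebra.smul_def]

/-- The homomorphism `w ↦ [[w^, dw], [0, w]]`. -/
def toTwist : Alg k B →ₐ[B] Twist k B :=
  ExteriorAlgebra.lift B ⟨
    { toFun := fun v => Twist.mk (ExteriorAlgebra.ι B v) (dOne v)
      map_add' := fun v w => by ext <;> simp
      map_smul' := fun b v => by
        ext
        · simp [Twist.smul_fst]
        · simp [Twist.smul_snd, dOne_smul, add_comm] },
    fun v => by
      ext
      · simp [Twist.mul_fst]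
      · rw [Twist.mul_snd]
        simp [invol_ι, ι_mul_dOne]⟩

lemma toTwist_fst (w : Alg k B) : (toTwist k B w).1 1 1 = w := by
  induction w using ExteriorAlgebra.induction with
  | algebraMap r => rw [AlgHom.commutes]; rfl
  | ι x => simp [toTwist]
  | mul a b ha hb => rw [map_mul, Twist.mul_fst, ha, hb]
  | add a b ha hb =>
    rw [map_add]
    change (toTwist k B a).1 1 1 + (toTwist k B b).1 1 1 = _
    rw [ha, hb]

/-- The exterior derivative `d` of the algebraic de Rham algebra. -/
def d : Alg k B →+ Alg k B where
  toFun w := (toTwist k B w).1 0 1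
  map_zero' := by simp
  map_add' a b := by simp

variable {k B}

lemma d_mul (v w : Alg k B) : d k B (v * w) = d k B v * w + invol k B v * d k B w := by
  change (toTwist k B (v * w)).1 0 1 = _
  rw [map_mul, Twist.mul_snd, toTwist_fst, toTwist_fst, add_comm]; rfl

lemma d_algebraMap (b : B) : d k B (algebraMap B _ b) = diff k b := by
  change (toTwist k B _).1 0 1 = _
  rw [AlgHom.commutes]; rfl

lemma d_ι (v : Ω[B⁄k]) : d k B (ExteriorAlgebra.ι B v) = dOne v := by
  change (toTwist k B _).1 0 1 = _
  simp [toTwist]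

lemma d_smul (b : B) (w : Alg k B) : d k B (b • w) = diff k b * w + b • d k B w := by
  rw [Algebra.smul_def, d_mul, d_algebraMap, AlgHom.commutes, ← Algebra.smul_def]

lemma d_diff (b : B) : d k B (diff k b) = 0 := by
  have := dOne_smul_D (k := k) 1 b
  rw [one_smul] at this
  rw [diff, d_ι, this]; simp [diff]

lemma d_invol (w : Alg k B) : d k B (invol k B w) = -invol k B (d k B w) := by
  induction w using ExteriorAlgebra.induction with
  | algebraMap r => simp [d_algebraMap, diff, invol_ι]
  | ι x => rw [invol_ι, map_neg, d_ι, invol_dOne]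
  | mul a b ha hb => simp only [map_mul, d_mul, ha, hb, map_add, invol_invol]; noncomm_ring
  | add a b ha hb => simp only [map_add, ha, hb, neg_add]

lemma d_d (w : Alg k B) : d k B (d k B w) = 0 := by
  induction w using ExteriorAlgebra.induction with
  | algebraMap r => rw [d_algebraMap, d_diff]
  | ι x =>
    rw [d_ι]
    induction x using one_form_induction with
    | h0 => simp
    | ha x y hx hy => simp [hx, hy]
    | hs b c => rw [dOne_smul_D, d_mul, d_diff, d_diff]; simp
  | mul a b ha hb => simp only [d_mul, map_add, ha, hb, d_invol, invol_invol]; noncomm_ring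
  | add a b ha hb => simp [ha, hb]

end Alg

variable {k B}

/-- The differential ideal generated by a set `G` of one-forms. -/
def diffIdeal (G : Set Ω[B⁄k]) : Ideal (Alg k B) :=
  (TwoSidedIdeal.span
    {w | ∃ v ∈ G, w = ExteriorAlgebra.ι B v ∨ w = Alg.d k B (ExteriorAlgebra.ι B v)}).asIdeal

instance (G : Set Ω[B⁄k]) : (diffIdeal G).IsTwoSided := by
  unfold diffIdeal; infer_instance

open Alg in
lemma mem_diffIdeal (G : Set Ω[B⁄k]) (w : Alg k B) (hw : w ∈ diffIdeal G) :
    Alg.d k B w ∈ diffIdeal G ∧ Alg.invol k B w ∈ diffIdeal G := by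
  have hgen : ∀ w, (∃ v ∈ G, w = ExteriorAlgebra.ι B v ∨ w = Alg.d k B (ExteriorAlgebra.ι B v)) →
      w ∈ diffIdeal G := fun w hw => TwoSidedIdeal.mem_asIdeal.2 (TwoSidedIdeal.subset_span hw)
  have hw' := TwoSidedIdeal.mem_span_iff_mem_addSubgroup_closure.1 (TwoSidedIdeal.mem_asIdeal.1 hw)
  induction hw' using AddSubgroup.closure_induction with
  | zero => simp
  | add x y hx hy h1 h2 =>
    have h1 := h1 (TwoSidedIdeal.mem_asIdeal.2
      (TwoSidedIdeal.mem_span_iff_mem_addSubgroup_closure.2 hx))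
    have h2 := h2 (TwoSidedIdeal.mem_asIdeal.2
      (TwoSidedIdeal.mem_span_iff_mem_addSubgroup_closure.2 hy))
    rw [map_add, map_add]
    exact ⟨add_mem h1.1 h2.1, add_mem h1.2 h2.2⟩
  | neg x hx h1 =>
    have h1 := h1 (TwoSidedIdeal.mem_asIdeal.2
      (TwoSidedIdeal.mem_span_iff_mem_addSubgroup_closure.2 hx))
    rw [map_neg, map_neg]
    exact ⟨neg_mem h1.1, neg_mem h1.2⟩
  | mem x hx =>
    obtain ⟨_, ⟨a, -, s, hs, rfl⟩, b, -, rfl⟩ := hx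
    have hs1 : s ∈ diffIdeal G := hgen s hs
    have hs2 : Alg.d k B s ∈ diffIdeal G := by
      obtain ⟨v, hv, rfl | rfl⟩ := hs
      · exact hgen _ ⟨v, hv, Or.inr rfl⟩
      · rw [Alg.d_d]; exact zero_mem _
    have hs3 : invol k B s ∈ diffIdeal G := by
      obtain ⟨v, hv, rfl | rfl⟩ := hs
      · rw [invol_ι]; exact neg_mem hs1
      · rw [d_ι, invol_dOne, ← d_ι]; exact hs1
    have e : Alg.d k B (a * s * b) = Alg.d k B a * (s * b) +
        (invol k B a * (Alg.d k B s * b) + invol k B a * (invol k B s * Alg.d k B b)) := by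
      simp only [d_mul, map_mul]; noncomm_ring
    change Alg.d k B (a * s * b) ∈ _ ∧ invol k B (a * s * b) ∈ _
    rw [e, map_mul, map_mul]
    exact ⟨add_mem (Ideal.mul_mem_left _ _ (Ideal.mul_mem_right _ _ hs1))
      (add_mem (Ideal.mul_mem_left _ _ (Ideal.mul_mem_right _ _ hs2))
        (Ideal.mul_mem_left _ _ (Ideal.mul_mem_right _ _ hs3))),
      Ideal.mul_mem_right _ _ (Ideal.mul_mem_left _ _ hs3)⟩

/-- The quotient of the de Rham algebra by the differential ideal generated by `G`. -/
abbrev Forms (G : Set Ω[B⁄k]) : Type _ := Alg k B ⧸ diffIdeal G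

variable (G : Set Ω[B⁄k])

/-- The exterior derivative on the quotient. -/
def Forms.d : Forms G →+ Forms G :=
  QuotientAddGroup.map (diffIdeal G).toAddSubgroup (diffIdeal G).toAddSubgroup (Alg.d k B)
    (fun w hw => (mem_diffIdeal G w hw).1)

/-- The grade involution on the quotient, multiplication by `(-1) ^ p` on `p`-forms. -/
def Forms.invol : Forms G →ₐ[B] Forms G :=
  Ideal.quotientMapₐ (diffIdeal G) (Alg.invol k B) (fun w hw => (mem_diffIdeal G w hw).2)

/-- A one-form, as an element of the algebra of forms. -/
def Forms.ofOne : Ω[B⁄k] →ₗ[B] Forms G :=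
  (Ideal.Quotient.mkₐ B (diffIdeal G)).toLinearMap ∘ₗ ExteriorAlgebra.ι B

variable {G}

lemma Forms.d_mul (v w : Forms G) :
    Forms.d G (v * w) = Forms.d G v * w + Forms.invol G v * Forms.d G w := by
  obtain ⟨v, rfl⟩ := Ideal.Quotient.mk_surjective v
  obtain ⟨w, rfl⟩ := Ideal.Quotient.mk_surjective w
  exact congrArg (Ideal.Quotient.mk (diffIdeal G)) (Alg.d_mul v w)

lemma Forms.d_d (w : Forms G) : Forms.d G (Forms.d G w) = 0 := by
  obtain ⟨w, rfl⟩ := Ideal.Quotient.mk_surjective w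
  exact congrArg (Ideal.Quotient.mk (diffIdeal G)) (Alg.d_d w)

lemma Forms.d_invol (w : Forms G) :
    Forms.d G (Forms.invol G w) = -Forms.invol G (Forms.d G w) := by
  obtain ⟨w, rfl⟩ := Ideal.Quotient.mk_surjective w
  exact congrArg (Ideal.Quotient.mk (diffIdeal G)) (Alg.d_invol w)

lemma Forms.invol_invol (w : Forms G) : Forms.invol G (Forms.invol G w) = w := by
  obtain ⟨w, rfl⟩ := Ideal.Quotient.mk_surjective w
  exact congrArg (Ideal.Quotient.mk (diffIdeal G)) (Alg.invol_invol w)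

lemma Forms.d_smul (b : B) (w : Forms G) :
    Forms.d G (b • w) = Forms.ofOne G (KaehlerDifferential.D k B b) * w + b • Forms.d G w := by
  obtain ⟨w, rfl⟩ := Ideal.Quotient.mk_surjective w
  exact congrArg (Ideal.Quotient.mk (diffIdeal G)) (Alg.d_smul b w)

lemma Forms.d_ofOne_D (b : B) : Forms.d G (Forms.ofOne G (KaehlerDifferential.D k B b)) = 0 :=
  congrArg (Ideal.Quotient.mk (diffIdeal G)) (Alg.d_diff b)

lemma Forms.invol_ofOne (v : Ω[B⁄k]) : Forms.invol G (Forms.ofOne G v) = -Forms.ofOne G v :=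
  congrArg (Ideal.Quotient.mk (diffIdeal G)) (Alg.invol_ι v)

lemma Forms.invol_mul_ofOne (w : Forms G) (v : Ω[B⁄k]) :
    Forms.invol G w * Forms.ofOne G v = Forms.ofOne G v * w := by
  obtain ⟨w, rfl⟩ := Ideal.Quotient.mk_surjective w
  exact congrArg (Ideal.Quotient.mk (diffIdeal G)) (Alg.invol_mul_ι w v)

lemma Forms.ofOne_eq_zero {v : Ω[B⁄k]} (hv : v ∈ G) : Forms.ofOne G v = 0 :=
  Ideal.Quotient.eq_zero_iff_mem.2 (TwoSidedIdeal.mem_asIdeal.2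
    (TwoSidedIdeal.subset_span ⟨v, hv, Or.inl rfl⟩))

end DeRham

/-! ### Forms with poles along a principal ideal -/

namespace LocalForms

section
variable {A : Type*} [CommRing A] (I : Ideal A)

/-- The elements dividing a power of the equation of the divisor. -/
def poleSubmonoid : Submonoid A where
  carrier := {g | ∃ n : ℕ, I ^ n ≤ Ideal.span {g}}
  one_mem' := ⟨0, by simp⟩
  mul_mem' := by
    rintro a b ⟨n, hn⟩ ⟨m, hm⟩
    exact ⟨n + m, by
      rw [pow_add, ← Ideal.span_singleton_mul_span_singleton]; exact Ideal.mul_mono hn hm⟩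

/-- The stalk `𝒪(*D)`. -/
abbrev PoleRing : Type _ := Localization (poleSubmonoid I)

/-- The stalk `𝒪(D) ⊆ 𝒪(*D)`, the elements `g` with `I g ⊆ 𝒪`. -/
def InvMod : Submodule A (PoleRing I) where
  carrier := {g | ∀ i ∈ I, ∃ a : A, algebraMap A (PoleRing I) i * g = algebraMap A (PoleRing I) a}
  zero_mem' := fun i _ => ⟨0, by simp⟩
  add_mem' := by
    intro g h hg hh i hi
    obtain ⟨a, ha⟩ := hg i hi
    obtain ⟨b, hb⟩ := hh i hi
    exact ⟨a + b, by rw [mul_add, ha, hb, map_add]⟩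
  smul_mem' := by
    intro c g hg i hi
    obtain ⟨a, ha⟩ := hg i hi
    exact ⟨c * a, by rw [Algebra.smul_def, mul_left_comm, ha, map_mul]⟩

lemma one_mem_invMod : (1 : PoleRing I) ∈ InvMod I := fun i _ => ⟨i, by simp⟩

end

variable (k : Type*) {A : Type*} [CommRing k] [CommRing A] [Algebra k A]
variable (I : Ideal A) (N : Submodule A Ω[A⁄k])

/-- The stalk of `Ω¹(D) = 𝒪(D) ⊗ Ω¹`, where `Ω¹` is the quotient of the Kähler differentials
by `N`. -/
abbrev PoleOne : Type _ := InvMod I ⊗[A] (Ω[A⁄k] ⧸ N)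

/-- The stalk of the de Rham algebra `Ω^•(*D)`. -/
def PoleForms : Type _ :=
  DeRham.Forms (k := k) (B := PoleRing I) (KaehlerDifferential.map k k A (PoleRing I) '' N)

instance : Ring (PoleForms k I N) := inferInstanceAs (Ring (DeRham.Forms _))
instance : Algebra (PoleRing I) (PoleForms k I N) :=
  inferInstanceAs (Algebra (PoleRing I) (DeRham.Forms _))
instance : Algebra A (PoleForms k I N) := Algebra.compHom _ (algebraMap A (PoleRing I))
instance : IsScalarTower A (PoleRing I) (PoleForms k I N) :=
  IsScalarTower.of_algebraMap_eq fun _ => rfl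

variable {k}

/-- The differential of a function as a one-form. -/
def dOne (f : A) : Ω[A⁄k] ⧸ N := N.mkQ (KaehlerDifferential.D k A f)

/-- The differential of a function as a section of `Ω¹(D)`. -/
def dPoleOne (f : A) : PoleOne k I N := ⟨1, one_mem_invMod I⟩ ⊗ₜ dOne N f

variable (k)

/-- The exterior derivative on `Ω^•(*D)`. -/
def d : PoleForms k I N →+ PoleForms k I N := DeRham.Forms.d _

/-- The grade involution of `Ω^•(*D)`, which is `(-1) ^ p` on `p`-forms. -/
def invol : PoleForms k I N →ₐ[A] PoleForms k I N :=
  (DeRham.Forms.invol (k := k) (B := PoleRing I) _).restrictScalars A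

/-- A Kähler differential of `𝒪(*D)` as an element of `Ω^•(*D)`. -/
def ofKaehler : Ω[PoleRing I⁄k] →ₗ[PoleRing I] PoleForms k I N :=
  DeRham.Forms.ofOne (k := k) (B := PoleRing I) _

variable {k} in
/-- The one-form `df` as an element of `Ω^•(*D)`. -/
def dForm (f : A) : PoleForms k I N :=
  ofKaehler k I N (KaehlerDifferential.D k (PoleRing I) (algebraMap A (PoleRing I) f))

/-- The natural map `Ω¹ → Ω^•(*D)`. -/
def ofOne : (Ω[A⁄k] ⧸ N) →ₗ[A] PoleForms k I N :=
  N.liftQ ((ofKaehler k I N).restrictScalars A ∘ₗ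
    KaehlerDifferential.map k k A (PoleRing I))
    (fun v hv => DeRham.Forms.ofOne_eq_zero ⟨v, hv, rfl⟩)

/-- The natural map `Ω¹(D) → Ω^•(*D)`. -/
def ofPoleOne : PoleOne k I N →ₗ[A] PoleForms k I N :=
  TensorProduct.lift
    (LinearMap.mk₂ A (fun (g : InvMod I) w => (g : PoleRing I) • ofOne k I N w)
      (fun g h w => by simp [add_smul]) (fun a g w => by simp [smul_assoc])
      (fun g v w => by simp)
      (fun a g w => by rw [map_smul]; exact smul_algebra_smul_comm a (g : PoleRing I) (ofOne k I N w)))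

section lemmas
variable {k I N}

lemma ofPoleOne_tmul (g : InvMod I) (w : Ω[A⁄k] ⧸ N) :
    ofPoleOne k I N (g ⊗ₜ w) = (g : PoleRing I) • ofOne k I N w := by
  simp [ofPoleOne]

lemma ofOne_dOne (f : A) : ofOne k I N (dOne N f) = dForm I N f :=
  congrArg (ofKaehler k I N) (KaehlerDifferential.map_D k k A (PoleRing I) f)

lemma ofPoleOne_dPoleOne (f : A) : ofPoleOne k I N (dPoleOne I N f) = dForm I N f := by
  rw [dPoleOne, ofPoleOne_tmul, one_smul, ofOne_dOne]

lemma d_mul (v w : PoleForms k I N) :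
    d k I N (v * w) = d k I N v * w + invol k I N v * d k I N w := DeRham.Forms.d_mul _ _

lemma d_d (w : PoleForms k I N) : d k I N (d k I N w) = 0 := DeRham.Forms.d_d _

lemma d_invol (w : PoleForms k I N) : d k I N (invol k I N w) = -invol k I N (d k I N w) :=
  DeRham.Forms.d_invol _

lemma invol_invol (w : PoleForms k I N) : invol k I N (invol k I N w) = w :=
  DeRham.Forms.invol_invol _

lemma d_pole_smul (b : PoleRing I) (w : PoleForms k I N) : d k I N (b • w) =
    ofKaehler k I N (KaehlerDifferential.D k (PoleRing I) b) * w + b • d k I N w :=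
  DeRham.Forms.d_smul _ _

lemma d_smul (a : A) (w : PoleForms k I N) :
    d k I N (a • w) = dForm I N a * w + a • d k I N w := by
  rw [← IsScalarTower.algebraMap_smul (PoleRing I) a w, d_pole_smul,
    IsScalarTower.algebraMap_smul]
  rfl

lemma d_dForm (f : A) : d k I N (dForm I N f) = 0 := DeRham.Forms.d_ofOne_D _

lemma invol_pole_smul (b : PoleRing I) (w : PoleForms k I N) :
    invol k I N (b • w) = b • invol k I N w :=
  map_smul (DeRham.Forms.invol (k := k) (B := PoleRing I) _) b w

lemma invol_dForm (f : A) : invol k I N (dForm I N f) = -dForm I N f :=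
  DeRham.Forms.invol_ofOne _

lemma invol_ofOne (v : Ω[A⁄k] ⧸ N) : invol k I N (ofOne k I N v) = -ofOne k I N v := by
  obtain ⟨v, rfl⟩ := N.mkQ_surjective v
  exact DeRham.Forms.invol_ofOne _

lemma invol_ofPoleOne (v : PoleOne k I N) :
    invol k I N (ofPoleOne k I N v) = -ofPoleOne k I N v := by
  induction v using TensorProduct.induction_on with
  | zero => simp
  | add v w hv hw => rw [map_add, map_add, hv, hw, neg_add]
  | tmul g w => rw [ofPoleOne_tmul, invol_pole_smul, invol_ofOne, smul_neg]

lemma invol_mul_dForm (w : PoleForms k I N) (f : A) :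
    invol k I N w * dForm I N f = dForm I N f * w := DeRham.Forms.invol_mul_ofOne _ _

end lemmas

section Conn
variable (M : Type*) [AddCommGroup M] [Module A M]

variable {k} in
/-- A connection on the `A`-module `M` with values in `M ⊗ Ω¹(D)`. -/
structure Conn where
  toFun : M →+ M ⊗[A] PoleOne k I N
  leibniz : ∀ (f : A) (s : M), toFun (f • s) = f • toFun s + s ⊗ₜ dPoleOne I N f

variable {k I N M}

/-- `M ⊗ Ω¹(D) → M ⊗ Ω^•(*D)`. -/
def toPole : M ⊗[A] PoleOne k I N →ₗ[A] M ⊗[A] PoleForms k I N :=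
  LinearMap.lTensor M (ofPoleOne k I N)

/-- Right exterior multiplication on `M ⊗ Ω^•(*D)`, `(s ⊗ η) ∧ ω = s ⊗ (η ∧ ω)`. -/
def wedge : M ⊗[A] PoleForms k I N →ₗ[A] PoleForms k I N →ₗ[A] M ⊗[A] PoleForms k I N :=
  LinearMap.flip ((LinearMap.lTensorHom M) ∘ₗ (LinearMap.mul A (PoleForms k I N)).flip)

@[simp] lemma wedge_tmul (s : M) (v w : PoleForms k I N) :
    wedge (s ⊗ₜ[A] v) w = s ⊗ₜ[A] (v * w) := rfl

/-- The grade involution on `M ⊗ Ω^•(*D)`. -/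
def involM : M ⊗[A] PoleForms k I N →ₗ[A] M ⊗[A] PoleForms k I N :=
  LinearMap.lTensor M (invol k I N).toLinearMap

@[simp] lemma involM_tmul (s : M) (v : PoleForms k I N) :
    involM (s ⊗ₜ[A] v) = s ⊗ₜ[A] invol k I N v := rfl

/-- The extension of a connection to `M ⊗ Ω^•(*D)`, `∇(s ⊗ ω) = ∇s ∧ ω + s ⊗ dω`. -/
def Conn.ext (c : Conn I N M) : M ⊗[A] PoleForms k I N →+ M ⊗[A] PoleForms k I N :=
  TensorProduct.liftAddHom
    { toFun := fun s => (wedge (toPole (c.toFun s))).toAddMonoidHom +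
        ((TensorProduct.mk A M (PoleForms k I N) s).toAddMonoidHom.comp (d k I N))
      map_zero' := by ext; simp
      map_add' := fun s t => by
        ext w
        simp only [map_add, AddMonoidHom.add_apply, LinearMap.toAddMonoidHom_coe,
          LinearMap.add_apply, AddMonoidHom.comp_apply, TensorProduct.mk_apply]
        abel }
    (fun a s w => by
      change wedge (toPole (c.toFun (a • s))) w + (a • s) ⊗ₜ[A] d k I N w =
        wedge (toPole (c.toFun s)) (a • w) + s ⊗ₜ[A] d k I N (a • w)
      rw [c.leibniz, d_smul, TensorProduct.tmul_add, map_add, map_add, LinearMap.add_apply]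
      have : toPole (s ⊗ₜ[A] dPoleOne I N a) = s ⊗ₜ[A] dForm I N a := by
        simp [toPole, ofPoleOne_dPoleOne]
      rw [this, wedge_tmul, map_smul, map_smul, map_smul, LinearMap.smul_apply,
        TensorProduct.smul_tmul]
      abel)

lemma Conn.ext_tmul (c : Conn I N M) (s : M) (w : PoleForms k I N) :
    c.ext (s ⊗ₜ w) = wedge (toPole (c.toFun s)) w + s ⊗ₜ[A] d k I N w := rfl

/-- `∇² = 0`. -/
def Conn.IsIntegrable (c : Conn I N M) : Prop := ∀ s : M, c.ext (toPole (c.toFun s)) = 0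

lemma wedge_wedge (z : M ⊗[A] PoleForms k I N) (v w : PoleForms k I N) :
    wedge (wedge z v) w = wedge z (v * w) := by
  induction z with
  | zero => simp
  | add x y hx hy => simp only [map_add, LinearMap.add_apply, hx, hy]
  | tmul s u => simp [mul_assoc]

lemma involM_wedge (z : M ⊗[A] PoleForms k I N) (v : PoleForms k I N) :
    involM (wedge z v) = wedge (involM z) (invol k I N v) := by
  induction z with
  | zero => simp
  | add x y hx hy => simp only [map_add, LinearMap.add_apply, hx, hy]
  | tmul s u => simp

lemma involM_toPole (z : M ⊗[A] PoleOne k I N) : involM (toPole z) = -toPole z := by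
  induction z with
  | zero => simp
  | add x y hx hy => rw [map_add, map_add, hx, hy, neg_add]
  | tmul s u => simp [toPole, invol_ofPoleOne, TensorProduct.tmul_neg]

lemma involM_involM (z : M ⊗[A] PoleForms k I N) : involM (involM z) = z := by
  induction z with
  | zero => simp
  | add x y hx hy => rw [map_add, map_add, hx, hy]
  | tmul s u => simp [invol_invol]

lemma Conn.ext_wedge (c : Conn I N M) (z : M ⊗[A] PoleForms k I N) (v : PoleForms k I N) :
    c.ext (wedge z v) = wedge (c.ext z) v + wedge (involM z) (d k I N v) := by
  induction z with
  | zero => simp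
  | add x y hx hy => simp only [map_add, LinearMap.add_apply, hx, hy]; abel
  | tmul s u =>
    simp only [wedge_tmul, c.ext_tmul, d_mul, map_add, LinearMap.add_apply, wedge_wedge,
      involM_tmul, TensorProduct.tmul_add]
    abel

lemma Conn.ext_smul (c : Conn I N M) (a : A) (z : M ⊗[A] PoleForms k I N) :
    c.ext (a • z) = a • c.ext z + wedge (involM z) (dForm I N a) := by
  induction z with
  | zero => simp
  | add x y hx hy => simp only [smul_add, map_add, LinearMap.add_apply, hx, hy]; abel
  | tmul s u =>
    rw [TensorProduct.smul_tmul', TensorProduct.smul_tmul, c.ext_tmul, c.ext_tmul, d_smul,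
      involM_tmul, wedge_tmul, invol_mul_dForm, map_smul, TensorProduct.tmul_add, smul_add,
      TensorProduct.tmul_smul]
    abel

lemma Conn.ext_ext (c : Conn I N M) (hc : c.IsIntegrable) (z : M ⊗[A] PoleForms k I N) :
    c.ext (c.ext z) = 0 := by
  induction z with
  | zero => simp
  | add x y hx hy => rw [map_add, map_add, hx, hy, add_zero]
  | tmul s u =>
    rw [c.ext_tmul, map_add, c.ext_wedge, hc, c.ext_tmul, d_d, involM_toPole]
    simp

/-- The wedge `Φ ∧ ω` of `Φ : M → M ⊗ Ω^•(*D)` with forms, as an endomorphism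
`s ⊗ ω ↦ Φ(s) ∧ ω` of `M ⊗ Ω^•(*D)`. -/
def wedgeHom (Φ : M →ₗ[A] M ⊗[A] PoleForms k I N) :
    M ⊗[A] PoleForms k I N →ₗ[A] M ⊗[A] PoleForms k I N :=
  TensorProduct.lift (wedge ∘ₗ Φ)

@[simp] lemma wedgeHom_tmul (Φ : M →ₗ[A] M ⊗[A] PoleForms k I N) (s : M) (w : PoleForms k I N) :
    wedgeHom Φ (s ⊗ₜ w) = wedge (Φ s) w := rfl

lemma wedgeHom_neg (Φ : M →ₗ[A] M ⊗[A] PoleForms k I N) (z : M ⊗[A] PoleForms k I N) :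
    wedgeHom (-Φ) z = -wedgeHom Φ z := by
  induction z with
  | zero => simp
  | add x y hx hy => rw [map_add, map_add, hx, hy, neg_add]
  | tmul s u => simp

/-- The induced connection on endomorphisms, `φ ↦ ∇ ∘ φ - φ ∘ ∇`. -/
def Conn.dEnd (c : Conn I N M) (φ : M →ₗ[A] M) : M →ₗ[A] M ⊗[A] PoleOne k I N where
  toFun s := c.toFun (φ s) - LinearMap.rTensor _ φ (c.toFun s)
  map_add' s t := by simp only [map_add]; abel
  map_smul' a s := by
    simp only [map_smul, c.leibniz, map_add, LinearMap.rTensor_tmul, RingHom.id_apply, smul_sub]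
    abel

/-- The extension of the induced connection to `M → M ⊗ Ω^p(*D)`,
`Φ ↦ ∇ ∘ Φ - (-1) ^ p Φ ∧ ∇`. -/
def Conn.dHom (c : Conn I N M) (Φ : M →ₗ[A] M ⊗[A] PoleForms k I N) :
    M →ₗ[A] M ⊗[A] PoleForms k I N where
  toFun s := c.ext (Φ s) - wedgeHom (involM ∘ₗ Φ) (toPole (c.toFun s))
  map_add' s t := by simp only [map_add]; abel
  map_smul' a s := by
    have : toPole (s ⊗ₜ[A] dPoleOne I N a) = s ⊗ₜ[A] dForm I N a := by
      simp [toPole, ofPoleOne_dPoleOne]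
    simp only [map_smul, c.leibniz, map_add, c.ext_smul, this, wedgeHom_tmul,
      LinearMap.comp_apply, RingHom.id_apply, smul_sub]
    abel

lemma wedgeHom_wedge (Φ : M →ₗ[A] M ⊗[A] PoleForms k I N) (z : M ⊗[A] PoleForms k I N)
    (w : PoleForms k I N) : wedgeHom Φ (wedge z w) = wedge (wedgeHom Φ z) w := by
  induction z with
  | zero => simp
  | add x y hx hy => simp only [map_add, LinearMap.add_apply, hx, hy]
  | tmul s u => simp [wedge_wedge]

lemma involM_wedgeHom (Φ : M →ₗ[A] M ⊗[A] PoleForms k I N) (z : M ⊗[A] PoleForms k I N) :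
    involM (wedgeHom Φ z) = wedgeHom (involM ∘ₗ Φ) (involM z) := by
  induction z with
  | zero => simp
  | add x y hx hy => simp only [map_add, hx, hy]
  | tmul s u => simp [involM_wedge]

/-- The graded Leibniz rule `∇(Φ ∧ z) = (∇Φ) ∧ z + (-1) ^ p Φ ∧ ∇z`. -/
lemma Conn.ext_wedgeHom (c : Conn I N M) (Φ : M →ₗ[A] M ⊗[A] PoleForms k I N)
    (z : M ⊗[A] PoleForms k I N) :
    c.ext (wedgeHom Φ z) = wedgeHom (c.dHom Φ) z + wedgeHom (involM ∘ₗ Φ) (c.ext z) := by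
  induction z with
  | zero => simp
  | add x y hx hy => simp only [map_add, hx, hy]; abel
  | tmul s u =>
    simp only [wedgeHom_tmul, c.ext_wedge, c.ext_tmul, map_add, wedgeHom_wedge, Conn.dHom,
      LinearMap.coe_mk, AddHom.coe_mk, map_sub, LinearMap.sub_apply, LinearMap.comp_apply]
    abel

lemma Conn.ext_involM (c : Conn I N M) (z : M ⊗[A] PoleForms k I N) :
    c.ext (involM z) = -involM (c.ext z) := by
  induction z with
  | zero => simp
  | add x y hx hy => simp only [map_add, hx, hy]; abel
  | tmul s u =>
    simp only [involM_tmul, c.ext_tmul, d_invol, map_add, involM_wedge, involM_toPole,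
      TensorProduct.tmul_neg, map_neg, LinearMap.neg_apply, neg_add, neg_neg]

lemma Conn.dHom_dHom (c : Conn I N M) (hc : c.IsIntegrable)
    (Φ : M →ₗ[A] M ⊗[A] PoleForms k I N) : c.dHom (c.dHom Φ) = 0 := by
  ext s
  have h1 : involM ∘ₗ c.dHom Φ = -c.dHom (involM ∘ₗ Φ) := by
    ext t
    simp only [Conn.dHom, LinearMap.comp_apply, LinearMap.coe_mk, AddHom.coe_mk, map_sub,
      LinearMap.neg_apply, c.ext_involM, involM_wedgeHom, involM_toPole, map_neg]
    abel
  have h2 : wedgeHom (involM ∘ₗ c.dHom Φ) (toPole (c.toFun s)) =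
      -wedgeHom (c.dHom (involM ∘ₗ Φ)) (toPole (c.toFun s)) := by
    rw [h1, wedgeHom_neg]
  change c.ext (c.ext (Φ s) - wedgeHom (involM ∘ₗ Φ) (toPole (c.toFun s))) -
    wedgeHom (involM ∘ₗ c.dHom Φ) (toPole (c.toFun s)) = 0
  rw [map_sub, c.ext_ext hc, c.ext_wedgeHom, h2, hc, map_zero]
  abel

lemma rTensor_wedge (φ : M →ₗ[A] M) (z : M ⊗[A] PoleForms k I N) (w : PoleForms k I N) :
    LinearMap.rTensor _ φ (wedge z w) = wedge (LinearMap.rTensor _ φ z) w := by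
  induction z with
  | zero => simp
  | add x y hx hy => simp only [map_add, LinearMap.add_apply, hx, hy]
  | tmul s u => simp

lemma rTensor_toPole (φ : M →ₗ[A] M) (z : M ⊗[A] PoleOne k I N) :
    toPole (LinearMap.rTensor _ φ z) = LinearMap.rTensor _ φ (toPole z) := by
  induction z with
  | zero => simp
  | add x y hx hy => simp only [map_add, hx, hy]
  | tmul s u => simp [toPole]

lemma Conn.ext_rTensor (c : Conn I N M) (φ : M →ₗ[A] M) (z : M ⊗[A] PoleForms k I N) :
    c.ext (LinearMap.rTensor _ φ z) =
      wedgeHom (toPole ∘ₗ c.dEnd φ) z + LinearMap.rTensor _ φ (c.ext z) := by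
  induction z with
  | zero => simp
  | add x y hx hy => simp only [map_add, hx, hy]; abel
  | tmul s u =>
    simp only [LinearMap.rTensor_tmul, c.ext_tmul, wedgeHom_tmul, map_add, LinearMap.comp_apply,
      Conn.dEnd, LinearMap.coe_mk, AddHom.coe_mk, map_sub, LinearMap.sub_apply, rTensor_wedge,
      rTensor_toPole]
    abel

lemma Conn.dHom_dEnd (c : Conn I N M) (hc : c.IsIntegrable) (φ : M →ₗ[A] M) :
    c.dHom (toPole ∘ₗ c.dEnd φ) = 0 := by
  ext s
  have h1 : wedgeHom (involM ∘ₗ toPole ∘ₗ c.dEnd φ) (toPole (c.toFun s)) =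
      -wedgeHom (toPole ∘ₗ c.dEnd φ) (toPole (c.toFun s)) := by
    have : involM ∘ₗ toPole ∘ₗ c.dEnd φ = -(toPole ∘ₗ c.dEnd φ) := by
      ext t; simp [involM_toPole]
    rw [this, wedgeHom_neg]
  change c.ext (toPole (c.toFun (φ s) - LinearMap.rTensor _ φ (c.toFun s))) -
    wedgeHom (involM ∘ₗ toPole ∘ₗ c.dEnd φ) (toPole (c.toFun s)) = 0
  rw [h1, map_sub, map_sub, hc, rTensor_toPole, c.ext_rTensor, hc, map_zero]
  abel

end Conn

end LocalForms

/-- The two flavours of differential forms: Kähler forms, and analytic forms. -/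
inductive FormKind
  | algebraic
  | analytic

/-- A locally ringed space over the field `k` (`str` is the inclusion of the constant functions),
together with the flavour of its differential forms. -/
structure KSpace (k : Type v) [Field k] where
  space : LocallyRingedSpace.{u}
  str : k →+* space.presheaf.obj (op ⊤)
  kind : FormKind

namespace KSpace

variable {k : Type v} [Field k] (S : KSpace.{u} k)

/-- The points of `S`. -/
abbrev Pt : Type u := S.space.toTopCat

/-- The open subsets of `S`. -/
abbrev Op : Type u := Opens S.space.toTopCat

/-- The ring `𝒪(U)`. -/
def O (U : S.Op) : Type u := S.space.presheaf.obj (op U)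

instance (U : S.Op) : CommRing (S.O U) := inferInstanceAs (CommRing (S.space.presheaf.obj (op U)))

/-- The stalk `𝒪_x`. -/
def st (x : S.Pt) : Type u := S.space.presheaf.stalk x

instance (x : S.Pt) : CommRing (S.st x) := inferInstanceAs (CommRing (S.space.presheaf.stalk x))

instance (x : S.Pt) : IsLocalRing (S.st x) :=
  inferInstanceAs (IsLocalRing (S.space.presheaf.stalk x))

/-- Restriction of functions. -/
def res {U V : S.Op} (h : U ≤ V) : S.O V →+* S.O U := (S.space.presheaf.map (homOfLE h).op).hom

/-- The germ of a function at a point. -/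
def germ {U : S.Op} (x : S.Pt) (hx : x ∈ U) : S.O U →+* S.st x :=
  (S.space.presheaf.germ U x hx).hom

lemma germ_res {U V : S.Op} (h : U ≤ V) (x : S.Pt) (hx : x ∈ U) (f : S.O V) :
    S.germ x hx (S.res h f) = S.germ x (h hx) f :=
  TopCat.Presheaf.germ_res_apply S.space.presheaf (homOfLE h) x hx f

lemma exists_germ (x : S.Pt) (r : S.st x) : ∃ (U : S.Op) (hx : x ∈ U) (f : S.O U),
    S.germ x hx f = r :=
  TopCat.Presheaf.exists_germ_eq S.space.presheaf r

/-- The constant functions on `U`. -/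
def const (U : S.Op) : k →+* S.O U := (S.res le_top).comp S.str

instance (x : S.Pt) : Algebra k (S.st x) := ((S.germ (U := ⊤) x trivial).comp S.str).toAlgebra

lemma germ_const (U : S.Op) (x : S.Pt) (hx : x ∈ U) (c : k) :
    S.germ x hx (S.const U c) = algebraMap k (S.st x) c := S.germ_res _ _ _ _

/-- Sheaves of `𝒪`-modules. -/
abbrev OMod : Type (u + 1) :=
  SheafOfModules.{u}
    ((sheafCompose (Opens.grothendieckTopology S.space.toTopCat)
      (forget₂ CommRingCat.{u} RingCat.{u})).obj S.space.sheaf)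

namespace OMod
variable {S} (M N : S.OMod)

/-- Sections of a sheaf of modules. -/
def sec (U : S.Op) : Type u := M.val.obj (op U)

instance (U : S.Op) : AddCommGroup (M.sec U) := inferInstanceAs (AddCommGroup (M.val.obj (op U)))
instance (U : S.Op) : Module (S.O U) (M.sec U) := (M.val.obj (op U)).isModule

/-- The underlying presheaf of abelian groups. -/
abbrev ab : TopCat.Presheaf Ab.{u} S.space.toTopCat := M.val.presheaf

/-- The stalk of a sheaf of modules. -/
def st (x : S.Pt) : Type u := (TopCat.Presheaf.stalk M.ab x : Ab)

instance (x : S.Pt) : AddCommGroup (M.st x) :=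
  inferInstanceAs (AddCommGroup ((TopCat.Presheaf.stalk M.ab x : Ab)))
instance (x : S.Pt) : Module (S.st x) (M.st x) :=
  PresheafOfModules.instModuleCarrierStalkCommRingCatCarrierAbPresheafOpensCarrier
    (R := S.space.presheaf) M.val x

variable {M}

/-- Restriction of sections. -/
def res {U V : S.Op} (h : U ≤ V) : M.sec V →+ M.sec U := (M.val.presheaf.map (homOfLE h).op).hom

/-- The germ of a section. -/
def germ {U : S.Op} (x : S.Pt) (hx : x ∈ U) : M.sec U →+ M.st x :=
  (TopCat.Presheaf.germ M.ab U x hx).hom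

lemma germ_res {U V : S.Op} (h : U ≤ V) (x : S.Pt) (hx : x ∈ U) (s : M.sec V) :
    germ x hx (res h s) = germ x (h hx) s :=
  TopCat.Presheaf.germ_res_apply M.ab (homOfLE h) x hx s

lemma germ_smul {U : S.Op} (x : S.Pt) (hx : x ∈ U) (f : S.O U) (s : M.sec U) :
    germ x hx (f • s) = S.germ x hx f • germ x hx s :=
  PresheafOfModules.germ_smul (R := S.space.presheaf) M.val x U hx f s

lemma exists_germ (x : S.Pt) (t : M.st x) : ∃ (U : S.Op) (hx : x ∈ U) (s : M.sec U),
    germ x hx s = t :=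
  TopCat.Presheaf.exists_germ_eq M.ab t

variable {N}

/-- The action of a morphism of sheaves of modules on sections. -/
def app (f : M ⟶ N) (U : S.Op) : M.sec U →ₗ[S.O U] N.sec U := (f.val.app (op U)).hom

lemma exists_germ₂ (x : S.Pt) (r : S.st x) (t : M.st x) : ∃ (U : S.Op) (hx : x ∈ U)
    (f : S.O U) (s : M.sec U), S.germ x hx f = r ∧ germ x hx s = t := by
  obtain ⟨U, hxU, s, rfl⟩ := exists_germ x t
  obtain ⟨V, hxV, f, rfl⟩ := S.exists_germ x r
  exact ⟨U ⊓ V, ⟨hxU, hxV⟩, S.res inf_le_right f, res inf_le_left s, S.germ_res _ _ _ _,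
    germ_res _ _ _ _⟩

/-- The map on stalks induced by a morphism of sheaves of modules, as an additive map. -/
def stMapAdd (f : M ⟶ N) (x : S.Pt) : M.st x →+ N.st x :=
  ((TopCat.Presheaf.stalkFunctor Ab x).map ((PresheafOfModules.toPresheaf _).map f.val)).hom

lemma stMapAdd_germ (f : M ⟶ N) {U : S.Op} (x : S.Pt) (hx : x ∈ U) (s : M.sec U) :
    stMapAdd f x (germ x hx s) = germ x hx (app f U s) :=
  TopCat.Presheaf.stalkFunctor_map_germ_apply U x hx ((PresheafOfModules.toPresheaf _).map f.val) s

/-- The map on stalks induced by a morphism of sheaves of modules. -/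
def stMap (f : M ⟶ N) (x : S.Pt) : M.st x →ₗ[S.st x] N.st x where
  toFun := stMapAdd f x
  map_add' := map_add _
  map_smul' r m := by
    obtain ⟨U, hx, r, m, rfl, rfl⟩ := exists_germ₂ x r m
    rw [← germ_smul, stMapAdd_germ, stMapAdd_germ, map_smul, germ_smul, RingHom.id_apply]

lemma stMap_germ (f : M ⟶ N) {U : S.Op} (x : S.Pt) (hx : x ∈ U) (s : M.sec U) :
    stMap f x (germ x hx s) = germ x hx (app f U s) := stMapAdd_germ f x hx s

end OMod
end KSpace

namespace KSpace
variable {k : Type v} [Field k] (S : KSpace.{u} k)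

/-! ### Sheaves of functions with values in the stalks -/

/-- Restriction of a dependent function. -/
def restr {S : KSpace.{u} k} {F : S.Pt → Type*} {U V : S.Op} (h : V ≤ U) (f : ∀ y : U, F y) (y : V) :
    F y := f ⟨y, h y.2⟩

/-- A sheaf of `𝒪`-modules, given by a family of stalks `F` and, for each open set `U`, the
functions `y ↦ f y ∈ F y` on `U` that are sections. -/
structure FnSheaf (F : S.Pt → Type*) [∀ x, AddCommGroup (F x)] [∀ x, Module (S.st x) (F x)] where
  sec : ∀ U : S.Op, AddSubgroup (∀ y : U, F y)
  res : ∀ {U V : S.Op} (h : V ≤ U) (f : ∀ y : U, F y), f ∈ sec U → restr h f ∈ sec V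
  glue : ∀ (U : S.Op) (f : ∀ y : U, F y),
    (∀ x : U, ∃ (V : S.Op) (h : V ≤ U), (x : S.Pt) ∈ V ∧ restr h f ∈ sec V) → f ∈ sec U
  smul : ∀ (U : S.Op) (r : S.O U) (f : ∀ y : U, F y), f ∈ sec U →
    (fun y : U => S.germ (y : S.Pt) y.2 r • f y) ∈ sec U

variable {S}
variable {F F' : S.Pt → Type*} [∀ x, AddCommGroup (F x)] [∀ x, Module (S.st x) (F x)]
  [∀ x, AddCommGroup (F' x)] [∀ x, Module (S.st x) (F' x)]

/-- The sheaf whose sections are locally finite sums of elements of the sets `G V`. -/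
def FnSheaf.gen (G : ∀ V : S.Op, Set (∀ y : V, F y))
    (hres : ∀ {U V : S.Op} (h : V ≤ U) (f : ∀ y : U, F y), f ∈ G U → restr h f ∈ G V)
    (hsmul : ∀ (U : S.Op) (r : S.O U) (f : ∀ y : U, F y), f ∈ G U →
      (fun y : U => S.germ (y : S.Pt) y.2 r • f y) ∈ G U) : S.FnSheaf F :=
  have hres' : ∀ {U V : S.Op} (h : V ≤ U) (f : ∀ y : U, F y), f ∈ AddSubgroup.closure (G U) →
      restr h f ∈ AddSubgroup.closure (G V) := by
    intro U V h f hf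
    induction hf using AddSubgroup.closure_induction with
    | zero => exact zero_mem _
    | add x y _ _ h1 h2 => exact add_mem h1 h2
    | neg x _ h1 => exact neg_mem h1
    | mem x hx => exact AddSubgroup.subset_closure (hres h x hx)
  { sec := fun U =>
      { carrier := {f | ∀ x : U, ∃ (V : S.Op) (h : V ≤ U), (x : S.Pt) ∈ V ∧
          restr h f ∈ AddSubgroup.closure (G V)}
        zero_mem' := fun x => ⟨U, le_rfl, x.2, zero_mem _⟩
        add_mem' := by
          intro f g hf hg x
          obtain ⟨V, hV, hx, h1⟩ := hf x
          obtain ⟨V', hV', hx', h2⟩ := hg x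
          exact ⟨V ⊓ V', inf_le_left.trans hV, ⟨hx, hx'⟩,
            add_mem (hres' (inf_le_left : V ⊓ V' ≤ V) _ h1)
              (hres' (inf_le_right : V ⊓ V' ≤ V') _ h2)⟩
        neg_mem' := by
          intro f hf x
          obtain ⟨V, hV, hx, h1⟩ := hf x
          exact ⟨V, hV, hx, neg_mem h1⟩ }
    res := by
      intro U V h f hf x
      obtain ⟨W, hW, hx, h1⟩ := hf ⟨x, h x.2⟩
      exact ⟨W ⊓ V, inf_le_right, ⟨hx, x.2⟩, hres' (inf_le_left : W ⊓ V ≤ W) _ h1⟩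
    glue := by
      intro U f hf x
      obtain ⟨V, hV, hx, h1⟩ := hf x
      obtain ⟨W, hW, hx', h2⟩ := h1 ⟨x, hx⟩
      exact ⟨W, hW.trans hV, hx', h2⟩
    smul := by
      intro U r f hf x
      obtain ⟨V, hV, hx, h1⟩ := hf x
      refine ⟨V, hV, hx, ?_⟩
      have key : ∀ g : (∀ y : V, F y), g ∈ AddSubgroup.closure (G V) →
          (fun y : V => S.germ (y : S.Pt) y.2 (S.res hV r) • g y) ∈
            AddSubgroup.closure (G V) := by
        intro g hg
        induction hg using AddSubgroup.closure_induction with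
        | zero => convert zero_mem (AddSubgroup.closure (G V)) using 1; ext; simp
        | add x y _ _ h1 h2 => convert add_mem h1 h2 using 1; ext; simp
        | neg x _ h1 => convert neg_mem h1 using 1; ext; simp
        | mem x hx => exact AddSubgroup.subset_closure (hsmul _ _ x hx)
      have := key _ h1
      simp only [S.germ_res] at this
      exact this }

lemma FnSheaf.gen_mem {G : ∀ V : S.Op, Set (∀ y : V, F y)} {hres hsmul} {U : S.Op}
    {f : ∀ y : U, F y} (hf : f ∈ G U) : f ∈ (FnSheaf.gen G hres hsmul).sec U :=
  fun x => ⟨U, le_rfl, x.2, AddSubgroup.subset_closure hf⟩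

/-- An additive family of maps that sends generators to sections sends sections to sections. -/
lemma FnSheaf.gen_map {G : ∀ V : S.Op, Set (∀ y : V, F y)} {hres hsmul} (T : S.FnSheaf F')
    {U : S.Op} (φ : ∀ y : U, F y →+ F' y)
    (hφ : ∀ (V : S.Op) (h : V ≤ U) (g : ∀ y : V, F y), g ∈ G V →
      (fun y : V => φ ⟨y, h y.2⟩ (g y)) ∈ T.sec V)
    (f : ∀ y : U, F y) (hf : f ∈ (FnSheaf.gen G hres hsmul).sec U) :
    (fun y : U => φ y (f y)) ∈ T.sec U := by
  refine T.glue U _ fun x => ?_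
  obtain ⟨V, hV, hx, h1⟩ := hf x
  refine ⟨V, hV, hx, ?_⟩
  have key : ∀ g : (∀ y : V, F y), g ∈ AddSubgroup.closure (G V) →
      (fun y : V => φ ⟨y, hV y.2⟩ (g y)) ∈ T.sec V := by
    intro g hg
    induction hg using AddSubgroup.closure_induction with
    | zero => convert zero_mem (T.sec V) using 1; ext; simp
    | add x y _ _ h1 h2 => convert add_mem h1 h2 using 1; ext; simp
    | neg x _ h1 => convert neg_mem h1 using 1; ext; simp
    | mem x hx => exact hφ V hV x hx
  exact key _ h1

namespace OMod

/-- The sections of a sheaf of modules `M`, viewed as functions to the stalks. -/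
def sheaf (M : S.OMod) : S.FnSheaf M.st :=
  FnSheaf.gen (fun V => {f | ∃ s : M.sec V, ∀ y : V, f y = germ (y : S.Pt) y.2 s})
    (by
      rintro U V h f ⟨s, hs⟩
      exact ⟨res h s, fun y => by rw [germ_res]; exact hs _⟩)
    (by
      rintro U r f ⟨s, hs⟩
      exact ⟨r • s, fun y => by change _ • f y = _; rw [germ_smul, hs]⟩)

lemma germ_mem (M : S.OMod) (U : S.Op) (s : M.sec U) :
    (fun y : U => germ (y : S.Pt) y.2 s) ∈ M.sheaf.sec U :=
  FnSheaf.gen_mem ⟨s, fun _ => rfl⟩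

/-- The sheaf of homomorphisms from `M` to `T`. -/
def homSheaf (M : S.OMod) (T : S.FnSheaf F) :
    S.FnSheaf (fun x => M.st x →ₗ[S.st x] F x) where
  sec U :=
    { carrier := {Φ | ∀ (V : S.Op) (h : V ≤ U) (s : M.sec V),
        (fun y : V => Φ ⟨y, h y.2⟩ (germ (y : S.Pt) y.2 s)) ∈ T.sec V}
      zero_mem' := fun V h s => zero_mem (T.sec V)
      add_mem' := fun hf hg V h s => add_mem (hf V h s) (hg V h s)
      neg_mem' := fun hf V h s => neg_mem (hf V h s) }
  res h Φ hΦ V' h' s := hΦ V' (h'.trans h) s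
  glue U Φ hΦ V h s := by
    refine T.glue V _ fun x => ?_
    obtain ⟨W, hW, hx, h1⟩ := hΦ ⟨x, h x.2⟩
    refine ⟨W ⊓ V, inf_le_right, ⟨hx, x.2⟩, ?_⟩
    have := h1 (W ⊓ V) inf_le_left (res inf_le_right s)
    simp only [germ_res] at this
    exact this
  smul U r Φ hΦ V h s := by
    have := T.smul V (S.res h r) _ (hΦ V h s)
    simp only [S.germ_res] at this
    exact this

/-- A homomorphism over `U` maps sections to sections. -/
lemma homSheaf_apply (M : S.OMod) (T : S.FnSheaf F) {U : S.Op}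
    (Φ : ∀ y : U, M.st y →ₗ[S.st y] F y) (hΦ : Φ ∈ (M.homSheaf T).sec U)
    (f : ∀ y : U, M.st y) (hf : f ∈ M.sheaf.sec U) :
    (fun y : U => Φ y (f y)) ∈ T.sec U := by
  refine FnSheaf.gen_map T (fun y => (Φ y).toAddMonoidHom) ?_ f hf
  rintro V h g ⟨s, hs⟩
  have := hΦ V h s
  simp only [← hs] at this
  exact this

end OMod

end KSpace

namespace LocalForms
section
variable {k : Type*} {A : Type*} [CommRing k] [CommRing A] [Algebra k A]
variable {I : Ideal A} {N : Submodule A Ω[A⁄k]} {M : Type*} [AddCommGroup M] [Module A M]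

/-- Multiplication by an element of `𝒪(*D)` on `M ⊗ Ω^•(*D)`. -/
def poleMul (b : PoleRing I) : M ⊗[A] PoleForms k I N →ₗ[A] M ⊗[A] PoleForms k I N :=
  LinearMap.lTensor M
    { toFun := fun w => b • w
      map_add' := smul_add b
      map_smul' := fun a w => smul_algebra_smul_comm a b w }

lemma poleMul_tmul (b : PoleRing I) (s : M) (w : PoleForms k I N) :
    poleMul b (s ⊗ₜ[A] w) = s ⊗ₜ[A] (b • w) := rfl

lemma poleMul_cancel {b : PoleRing I} {a : A} (h : algebraMap A (PoleRing I) a * b = 1)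
    (z : M ⊗[A] PoleForms k I N) : poleMul b (a • z) = z := by
  induction z with
  | zero => simp
  | add x y hx hy => rw [smul_add, map_add, hx, hy]
  | tmul s w =>
    rw [← TensorProduct.tmul_smul, poleMul_tmul, ← IsScalarTower.algebraMap_smul (PoleRing I) a w,
      smul_smul, mul_comm, h, one_smul]

lemma smul_poleMul {b : PoleRing I} {a : A} (h : algebraMap A (PoleRing I) a * b = 1)
    (z : M ⊗[A] PoleForms k I N) : a • poleMul b z = z := by
  rw [← map_smul, poleMul_cancel h]

lemma exists_pole_inv {a : A} (ha : a ∈ poleSubmonoid I) :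
    ∃ b : PoleRing I, algebraMap A (PoleRing I) a * b = 1 :=
  ⟨IsLocalization.mk' _ 1 ⟨a, ha⟩, by
    rw [IsLocalization.mul_mk'_eq_mk'_of_mul, mul_one]
    exact IsLocalization.mk'_self _ ha⟩

lemma smul_injective {a : A} (ha : a ∈ poleSubmonoid I) {z w : M ⊗[A] PoleForms k I N}
    (h : a • z = a • w) : z = w := by
  obtain ⟨b, hb⟩ := exists_pole_inv ha
  rw [← poleMul_cancel hb z, h, poleMul_cancel hb]

lemma mem_poleSubmonoid {a : A} (h : I = Ideal.span {a}) : a ∈ poleSubmonoid I :=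
  ⟨1, by rw [pow_one, h]⟩

lemma d_prod_dForm (l : List A) :
    d k I N (l.map (dForm (k := k) I N)).prod = 0 := by
  induction l with
  | nil =>
    have h := d_mul (k := k) (I := I) (N := N) 1 1
    simpa using h
  | cons a l ih => rw [List.map_cons, List.prod_cons, d_mul, ih, d_dForm]; simp

end
end LocalForms

namespace KSpace
open LocalForms
variable {k : Type v} [Field k] (S : KSpace.{u} k)

/-- An effective Cartier divisor, as an invertible sheaf of ideals: the ideals of the stalks are
locally generated by a function `h` that is a nonzerodivisor. -/
structure Divisor where
  ideal : ∀ x : S.Pt, Ideal (S.st x)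
  exists_eq : ∀ x : S.Pt, ∃ (U : S.Op) (_ : x ∈ U) (h : S.O U), ∀ y : U,
    S.germ (y : S.Pt) y.2 h ∈ nonZeroDivisors (S.st y) ∧
      ideal y = Ideal.span {S.germ (y : S.Pt) y.2 h}

/-- The differentials which vanish as differential forms: none in the algebraic case, and those
that are in the kernel of the projection to the finite differential module in the analytic case,
where the stalk of the sheaf `Ω¹` is the largest quotient of the module of Kähler differentials that
is separated for the topology of the maximal ideal. -/
def nullForms (x : S.Pt) : Submodule (S.st x) Ω[S.st x⁄k] :=
  match S.kind with
  | .algebraic => ⊥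
  | .analytic => ⨅ n : ℕ, (IsLocalRing.maximalIdeal (S.st x)) ^ n • ⊤

variable {S} (D : S.Divisor)

/-- The stalk of `Ω¹(D)`. -/
abbrev FormsOne (x : S.Pt) : Type u := PoleOne k (D.ideal x) (S.nullForms x)

/-- The stalk of `Ω^•(*D)`. -/
abbrev FormsAll (x : S.Pt) : Type u := PoleForms k (D.ideal x) (S.nullForms x)

/-- The sheaf `M ⊗ Ω¹(D)`; its sections are locally sums of the `s ⊗ h⁻¹ df`, where `h` is an
equation of `D`. -/
def tensorOne (M : S.OMod) : S.FnSheaf (fun x => M.st x ⊗[S.st x] FormsOne D x) :=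
  FnSheaf.gen (fun V => {g | ∃ (s : M.sec V) (h f : S.O V), ∀ y : V,
      D.ideal y = Ideal.span {S.germ (y : S.Pt) y.2 h} ∧
      ∃ b : InvMod (D.ideal y), S.germ (y : S.Pt) y.2 h • (b : PoleRing (D.ideal y)) = 1 ∧
        g y = OMod.germ (y : S.Pt) y.2 s ⊗ₜ (b ⊗ₜ dOne _ (S.germ (y : S.Pt) y.2 f))})
    (by
      rintro U V hVU g ⟨s, h, f, H⟩
      refine ⟨OMod.res hVU s, S.res hVU h, S.res hVU f, fun y => ?_⟩
      rw [S.germ_res, S.germ_res, OMod.germ_res]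
      exact H ⟨y, hVU y.2⟩)
    (by
      rintro U r g ⟨s, h, f, H⟩
      refine ⟨r • s, h, f, fun y => ?_⟩
      obtain ⟨h1, b, hb, h2⟩ := H y
      refine ⟨h1, b, hb, ?_⟩
      change _ • g y = _
      rw [OMod.germ_smul, h2, TensorProduct.smul_tmul'])

/-- The exact form `df` at the point `x`. -/
abbrev dGerm {V : S.Op} (x : S.Pt) (hx : x ∈ V) (f : S.O V) : FormsAll D x :=
  dForm (k := k) (D.ideal x) (S.nullForms x) (S.germ x hx f)

/-- The sheaf `M ⊗ Ω^p(*D)`; its sections are locally sums of the `s ⊗ h⁻¹ df₁ ∧ ⋯ ∧ df_p`, where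
`h` divides a power of the equation of `D`. -/
def tensorForms (M : S.OMod) (p : ℕ) : S.FnSheaf (fun x => M.st x ⊗[S.st x] FormsAll D x) :=
  FnSheaf.gen (fun V => {g | ∃ (s : M.sec V) (h : S.O V) (f : Fin p → S.O V), ∀ y : V,
      S.germ (y : S.Pt) y.2 h ∈ poleSubmonoid (D.ideal y) ∧
      S.germ (y : S.Pt) y.2 h • g y = OMod.germ (y : S.Pt) y.2 s ⊗ₜ[S.st y]
        (List.ofFn fun j => dGerm D (y : S.Pt) y.2 (f j)).prod})
    (by
      rintro U V hVU g ⟨s, h, f, H⟩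
      refine ⟨OMod.res hVU s, S.res hVU h, fun j => S.res hVU (f j), fun y => ?_⟩
      simp only [dGerm, S.germ_res, OMod.germ_res]
      exact H ⟨y, hVU y.2⟩)
    (by
      rintro U r g ⟨s, h, f, H⟩
      refine ⟨r • s, h, f, fun y => ?_⟩
      obtain ⟨h1, h2⟩ := H y
      refine ⟨h1, ?_⟩
      change _ • _ • g y = _
      rw [OMod.germ_smul, smul_comm, h2, TensorProduct.smul_tmul'])

section
variable {D} {M : S.OMod} {p : ℕ} {U : S.Op}
variable {F : S.Pt → Type*} [∀ x, AddCommGroup (F x)] [∀ x, Module (S.st x) (F x)]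
  (T : S.FnSheaf F)

lemma tensorOne_map (φ : ∀ y : U, M.st y ⊗[S.st y] FormsOne D y →+ F y)
    (hφ : ∀ (V : S.Op) (hV : V ≤ U) (s : M.sec V) (h f : S.O V) (b : ∀ y : V, InvMod (D.ideal y)),
      (∀ y : V, D.ideal y = Ideal.span {S.germ (y : S.Pt) y.2 h}) →
      (∀ y : V, S.germ (y : S.Pt) y.2 h • (b y : PoleRing (D.ideal y)) = 1) →
      (fun y : V => φ ⟨y, hV y.2⟩ (OMod.germ (y : S.Pt) y.2 s ⊗ₜ (b y ⊗ₜ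
        dOne _ (S.germ (y : S.Pt) y.2 f)))) ∈ T.sec V)
    {z : ∀ y : U, M.st y ⊗[S.st y] FormsOne D y} (hz : z ∈ (tensorOne D M).sec U) :
    (fun y : U => φ y (z y)) ∈ T.sec U := by
  refine FnSheaf.gen_map (F := fun x => M.st x ⊗[S.st x] FormsOne D x) T φ ?_ z hz
  rintro V hV g ⟨s, h, f, H⟩
  choose e b hb H using H
  simp only [H]
  exact hφ V hV s h f b e hb

lemma tensorForms_map (φ : ∀ y : U, M.st y ⊗[S.st y] FormsAll D y →+ F y)
    (hφ : ∀ (V : S.Op) (hV : V ≤ U) (g : ∀ y : V, M.st y ⊗[S.st y] FormsAll D y) (s : M.sec V)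
      (h : S.O V) (f : Fin p → S.O V),
      (∀ y : V, S.germ (y : S.Pt) y.2 h ∈ poleSubmonoid (D.ideal y)) →
      (∀ y : V, S.germ (y : S.Pt) y.2 h • g y = OMod.germ (y : S.Pt) y.2 s ⊗ₜ[S.st y]
        (List.ofFn fun j => dGerm D (y : S.Pt) y.2 (f j)).prod) →
      (fun y : V => φ ⟨y, hV y.2⟩ (g y)) ∈ T.sec V)
    {z : ∀ y : U, M.st y ⊗[S.st y] FormsAll D y} (hz : z ∈ (tensorForms D M p).sec U) :
    (fun y : U => φ y (z y)) ∈ T.sec U := by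
  refine FnSheaf.gen_map (F := fun x => M.st x ⊗[S.st x] FormsAll D x) T φ ?_ z hz
  rintro V hV g ⟨s, h, f, H⟩
  exact hφ V hV g s h f (fun y => (H y).1) (fun y => (H y).2)

lemma tensorForms_mem (g : ∀ y : U, M.st y ⊗[S.st y] FormsAll D y) (s : M.sec U)
    (h : S.O U) (f : Fin p → S.O U)
    (h1 : ∀ y : U, S.germ (y : S.Pt) y.2 h ∈ poleSubmonoid (D.ideal y))
    (h2 : ∀ y : U, S.germ (y : S.Pt) y.2 h • g y = OMod.germ (y : S.Pt) y.2 s ⊗ₜ[S.st y]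
        (List.ofFn fun j => dGerm D (y : S.Pt) y.2 (f j)).prod) :
    g ∈ (tensorForms D M p).sec U :=
  FnSheaf.gen_mem ⟨s, h, f, fun y => ⟨h1 y, h2 y⟩⟩

lemma tensorOne_mem (s : M.sec U) (h f : S.O U) (b : ∀ y : U, InvMod (D.ideal y))
    (h1 : ∀ y : U, D.ideal y = Ideal.span {S.germ (y : S.Pt) y.2 h})
    (h2 : ∀ y : U, S.germ (y : S.Pt) y.2 h • (b y : PoleRing (D.ideal y)) = 1) :
    (fun y : U => (OMod.germ (y : S.Pt) y.2 s ⊗ₜ[S.st y] (b y ⊗ₜ[S.st y]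
        dOne _ (S.germ (y : S.Pt) y.2 f) : FormsOne D y))) ∈ (tensorOne D M).sec U :=
  FnSheaf.gen_mem ⟨s, h, f, fun y => ⟨h1 y, b y, h2 y, rfl⟩⟩

lemma toPole_mem {z : ∀ y : U, M.st y ⊗[S.st y] FormsOne D y} (hz : z ∈ (tensorOne D M).sec U) :
    (fun y : U => toPole (z y)) ∈ (tensorForms D M 1).sec U := by
  refine tensorOne_map (tensorForms D M 1) (fun y => (toPole (M := M.st y)).toAddMonoidHom) ?_ hz
  intro V hV s h f b h1 hb
  refine tensorForms_mem _ s h (fun _ => f) (fun y => mem_poleSubmonoid (h1 y)) fun y => ?_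
  simp only [LinearMap.toAddMonoidHom_coe]
  rw [toPole, LinearMap.lTensor_tmul, ofPoleOne_tmul, ofOne_dOne, ← TensorProduct.tmul_smul,
    ← smul_assoc, hb, one_smul]
  simp

lemma poleMul_mem {z : ∀ y : U, M.st y ⊗[S.st y] FormsAll D y}
    (hz : z ∈ (tensorForms D M p).sec U) (h : S.O U) (b : ∀ y : U, PoleRing (D.ideal y))
    (hh : ∀ y : U, S.germ (y : S.Pt) y.2 h ∈ poleSubmonoid (D.ideal y))
    (hb : ∀ y : U, algebraMap _ (PoleRing (D.ideal y)) (S.germ (y : S.Pt) y.2 h) * b y = 1) :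
    (fun y : U => poleMul (b y) (z y)) ∈ (tensorForms D M p).sec U := by
  refine tensorForms_map (tensorForms D M p)
    (fun y => (poleMul (M := M.st y) (b y)).toAddMonoidHom) ?_ hz
  intro V hV g s h' f h1 h2
  refine tensorForms_mem _ s (h' * S.res hV h) f (fun y => ?_) fun y => ?_
  · rw [map_mul, S.germ_res]
    exact mul_mem (h1 y) (hh ⟨y, hV y.2⟩)
  · rw [map_mul, S.germ_res, mul_smul]
    exact (congrArg _ (smul_poleMul (hb ⟨y, hV y.2⟩) (g y))).trans (h2 y)

lemma div_mem {z w : ∀ y : U, M.st y ⊗[S.st y] FormsAll D y}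
    (hz : z ∈ (tensorForms D M p).sec U) (h : S.O U)
    (hh : ∀ y : U, S.germ (y : S.Pt) y.2 h ∈ poleSubmonoid (D.ideal y))
    (hw : ∀ y : U, S.germ (y : S.Pt) y.2 h • w y = z y) : w ∈ (tensorForms D M p).sec U := by
  choose b hb using fun y : U => exists_pole_inv (hh y)
  convert poleMul_mem hz h b hh hb using 2 with y
  rw [← hw y, poleMul_cancel (hb y)]

lemma wedge_dForm_mem {z : ∀ y : U, M.st y ⊗[S.st y] FormsAll D y}
    (hz : z ∈ (tensorForms D M p).sec U) (f : S.O U) :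
    (fun y : U => wedge (involM (z y)) (dGerm D (y : S.Pt) y.2 f)) ∈
      (tensorForms D M (p + 1)).sec U := by
  refine tensorForms_map (tensorForms D M (p + 1)) (fun y => ((wedge (M := M.st y)).flip
    (dGerm D (y : S.Pt) y.2 f) ∘ₗ involM).toAddMonoidHom) ?_ hz
  intro V hV g s h f' h1 h2
  refine tensorForms_mem _ s h (Fin.cons (S.res hV f) f') h1 fun y => ?_
  change _ • wedge (involM (g y)) (dGerm D (y : S.Pt) _ f) = _
  rw [← LinearMap.smul_apply, ← map_smul, ← map_smul, h2, involM_tmul, wedge_tmul,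
    invol_mul_dForm]
  simp [List.ofFn_succ, dGerm, S.germ_res]

end

/-- A connection with poles along `D`, `∇ : M → M ⊗ Ω¹(D)`, given by its action on the stalks.
The Leibniz rule on the stalks is a field of `LocalForms.Conn`; as `dc = 0` for `c` in `k`, it
implies that `∇` is `k`-linear. -/
structure Connection (M : S.OMod) where
  conn : ∀ x : S.Pt, Conn (D.ideal x) (S.nullForms x) (M.st x)
  sec : ∀ (U : S.Op) (s : M.sec U),
    (fun y : U => (conn y).toFun (OMod.germ (y : S.Pt) y.2 s)) ∈ (tensorOne D M).sec U

/-- `∇² = 0`. -/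
def Connection.IsIntegrable {D : S.Divisor} {M : S.OMod} (c : Connection D M) : Prop :=
  ∀ x : S.Pt, (c.conn x).IsIntegrable

section
variable {D} {M : S.OMod} {p : ℕ} {U : S.Op} (c : Connection D M)

lemma Connection.mem {z : ∀ y : U, M.st y} (hz : z ∈ M.sheaf.sec U) :
    (fun y : U => (c.conn y).toFun (z y)) ∈ (tensorOne D M).sec U := by
  refine FnSheaf.gen_map (F := M.st) (tensorOne D M) (fun y => (c.conn y).toFun) ?_ z hz
  rintro V hV g ⟨s, hs⟩
  simp only [hs]
  exact c.sec V s

lemma wedge_prod_mem {z : ∀ y : U, M.st y ⊗[S.st y] FormsOne D y}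
    (hz : z ∈ (tensorOne D M).sec U) (f : Fin p → S.O U) :
    (fun y : U => wedge (toPole (z y)) (List.ofFn fun j => dGerm D (y : S.Pt) y.2 (f j)).prod) ∈
      (tensorForms D M (p + 1)).sec U := by
  refine tensorOne_map (tensorForms D M (p + 1)) (fun y => ((wedge (M := M.st y)).flip
    (List.ofFn fun j => dGerm D (y : S.Pt) y.2 (f j)).prod ∘ₗ toPole).toAddMonoidHom) ?_ hz
  intro V hV s h f' b h1 hb
  refine tensorForms_mem _ s h (Fin.cons f' (fun j => S.res hV (f j)))
    (fun y => mem_poleSubmonoid (h1 y)) fun y => ?_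
  simp only [LinearMap.toAddMonoidHom_coe, LinearMap.comp_apply, LinearMap.flip_apply]
  rw [toPole, LinearMap.lTensor_tmul, ofPoleOne_tmul, ofOne_dOne, wedge_tmul,
    ← TensorProduct.tmul_smul, ← smul_mul_assoc, ← smul_assoc, hb, one_smul]
  simp [List.ofFn_succ, dGerm, S.germ_res]

lemma Connection.ext_mem {z : ∀ y : U, M.st y ⊗[S.st y] FormsAll D y}
    (hz : z ∈ (tensorForms D M p).sec U) :
    (fun y : U => (c.conn y).ext (z y)) ∈ (tensorForms D M (p + 1)).sec U := by
  refine tensorForms_map (tensorForms D M (p + 1)) (fun y => (c.conn y).ext) ?_ hz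
  intro V hV g s h f hh H
  have hg : g ∈ (tensorForms D M p).sec V := tensorForms_mem g s h f hh H
  refine div_mem (sub_mem (wedge_prod_mem (c.sec V s) f) (wedge_dForm_mem hg h)) h hh fun y => ?_
  have h3 := (c.conn y).ext_smul (S.germ (y : S.Pt) y.2 h) (g y)
  rw [H y, (c.conn y).ext_tmul] at h3
  have h4 : d k (D.ideal y) (S.nullForms y)
      (List.ofFn fun j => dGerm D (y : S.Pt) y.2 (f j)).prod = 0 := by
    have := d_prod_dForm (k := k) (I := D.ideal y) (N := S.nullForms y)
      (List.ofFn fun j => S.germ (y : S.Pt) y.2 (f j))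
    rwa [List.map_ofFn] at this
  rw [h4, TensorProduct.tmul_zero, add_zero] at h3
  exact (sub_eq_of_eq_add h3).symm

lemma Connection.dEnd_mem {φ : ∀ y : U, M.st y →ₗ[S.st y] M.st y}
    (hφ : φ ∈ (M.homSheaf M.sheaf).sec U) :
    (fun y : U => (c.conn y).dEnd (φ y)) ∈ (M.homSheaf (tensorOne D M)).sec U := by
  intro V hV s
  have key := tensorOne_map (tensorOne D M) (fun y : V =>
    (LinearMap.rTensor (FormsOne D y) (φ ⟨y, hV y.2⟩)).toAddMonoidHom) (by
      intro W hW t h f b e hb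
      have h2 := hφ W (hW.trans hV) t
      refine FnSheaf.gen_map (F := M.st) (tensorOne D M) (fun y : W =>
        ((TensorProduct.mk (S.st y) (M.st y) (FormsOne D y)).flip ((b y) ⊗ₜ[S.st y]
          (dOne (S.nullForms y) (S.germ (y : S.Pt) y.2 f)))).toAddMonoidHom) ?_ _ h2
      rintro W' hW' g' ⟨t', ht'⟩
      have := tensorOne_mem t' (S.res hW' h) (S.res hW' f) (fun y => b ⟨y, hW' y.2⟩)
        (fun y => by rw [S.germ_res]; exact e ⟨y, hW' y.2⟩)
        (fun y => by rw [S.germ_res]; exact hb ⟨y, hW' y.2⟩)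
      simp only [S.germ_res] at this
      simp only [ht']
      exact this) (c.sec V s)
  exact sub_mem (c.mem (hφ V hV s)) key

lemma toPole_hom_mem {Φ : ∀ y : U, M.st y →ₗ[S.st y] M.st y ⊗[S.st y] FormsOne D y}
    (hΦ : Φ ∈ (M.homSheaf (tensorOne D M)).sec U) :
    (fun y : U => toPole ∘ₗ Φ y) ∈ (M.homSheaf (tensorForms D M 1)).sec U :=
  fun V hV s => toPole_mem (hΦ V hV s)

lemma Connection.dHom_mem {Φ : ∀ y : U, M.st y →ₗ[S.st y] M.st y ⊗[S.st y] FormsAll D y}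
    (hΦ : Φ ∈ (M.homSheaf (tensorForms D M p)).sec U) :
    (fun y : U => (c.conn y).dHom (Φ y)) ∈ (M.homSheaf (tensorForms D M (p + 1))).sec U := by
  intro V hV s
  have key := tensorOne_map (tensorForms D M (p + 1)) (fun y : V =>
    (wedgeHom (involM ∘ₗ Φ ⟨y, hV y.2⟩) ∘ₗ toPole).toAddMonoidHom) (by
      intro W hW t h f b e hb
      refine div_mem (wedge_dForm_mem (hΦ W (hW.trans hV) t) f) h
        (fun y => mem_poleSubmonoid (e y)) fun y => ?_
      simp only [LinearMap.toAddMonoidHom_coe, LinearMap.comp_apply]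
      rw [toPole, LinearMap.lTensor_tmul, ofPoleOne_tmul, ofOne_dOne, wedgeHom_tmul, ← map_smul,
        ← smul_assoc, hb, one_smul]
      rfl) (c.sec V s)
  exact sub_mem (c.ext_mem (hΦ V hV s)) key

end

end KSpace

namespace LocalForms
section
variable {k : Type*} {A : Type*} [CommRing k] [CommRing A] [Algebra k A]
variable {I : Ideal A} {N : Submodule A Ω[A⁄k]} {M : Type*} [AddCommGroup M] [Module A M]

lemma Conn.map_const_smul (c : Conn I N M) (a : k) (s : M) :
    c.toFun (algebraMap k A a • s) = algebraMap k A a • c.toFun s := by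
  rw [c.leibniz]; simp [dPoleOne, dOne]

lemma dForm_const (a : k) : dForm I N (algebraMap k A a) = 0 := by
  rw [dForm, ← IsScalarTower.algebraMap_apply]; simp

lemma Conn.dEnd_add (c : Conn I N M) (φ ψ : M →ₗ[A] M) :
    c.dEnd (φ + ψ) = c.dEnd φ + c.dEnd ψ := by
  ext s
  simp only [Conn.dEnd, LinearMap.coe_mk, AddHom.coe_mk, LinearMap.add_apply, map_add,
    LinearMap.rTensor_add]
  abel

lemma Conn.dEnd_const_smul (c : Conn I N M) (a : k) (φ : M →ₗ[A] M) :
    c.dEnd (algebraMap k A a • φ) = algebraMap k A a • c.dEnd φ := by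
  ext s
  simp only [Conn.dEnd, LinearMap.coe_mk, AddHom.coe_mk, LinearMap.smul_apply, c.map_const_smul,
    LinearMap.rTensor_smul, smul_sub]

lemma wedgeHom_add (Φ Ψ : M →ₗ[A] M ⊗[A] PoleForms k I N) (z : M ⊗[A] PoleForms k I N) :
    wedgeHom (Φ + Ψ) z = wedgeHom Φ z + wedgeHom Ψ z := by
  induction z with
  | zero => simp
  | add x y hx hy => simp only [map_add, hx, hy]; abel
  | tmul s u => simp

lemma wedgeHom_smul (a : A) (Φ : M →ₗ[A] M ⊗[A] PoleForms k I N) (z : M ⊗[A] PoleForms k I N) :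
    wedgeHom (a • Φ) z = a • wedgeHom Φ z := by
  induction z with
  | zero => simp
  | add x y hx hy => simp only [map_add, hx, hy, smul_add]
  | tmul s u => simp

lemma Conn.dHom_add (c : Conn I N M) (Φ Ψ : M →ₗ[A] M ⊗[A] PoleForms k I N) :
    c.dHom (Φ + Ψ) = c.dHom Φ + c.dHom Ψ := by
  ext s
  simp only [Conn.dHom, LinearMap.coe_mk, AddHom.coe_mk, LinearMap.add_apply, map_add,
    LinearMap.comp_add, wedgeHom_add]
  abel

lemma Conn.dHom_const_smul (c : Conn I N M) (a : k) (Φ : M →ₗ[A] M ⊗[A] PoleForms k I N) :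
    c.dHom (algebraMap k A a • Φ) = algebraMap k A a • c.dHom Φ := by
  ext s
  simp only [Conn.dHom, LinearMap.coe_mk, AddHom.coe_mk, LinearMap.smul_apply, c.ext_smul,
    dForm_const, map_zero, add_zero, LinearMap.comp_smul, wedgeHom_smul, smul_sub]

end
end LocalForms

namespace KSpace
open LocalForms
variable {k : Type v} [Field k]

/-! ### Complexes of sheaves of `k`-vector spaces and hypercohomology -/

variable (S : KSpace.{u} k) in
/-- A complex `K⁰ → K¹ → ⋯` of sheaves of `k`-vector spaces. The sections of `K^p` over `U` are
certain functions with values in the spaces `fib p y` for `y` in `U`. -/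
structure SheafComplex where
  fib : ℕ → S.Pt → Type u
  ab : ∀ p x, AddCommGroup (fib p x)
  mod : ∀ p x, Module k (fib p x)
  sec : ∀ (p : ℕ) (U : S.Op), Submodule k (∀ y : U, fib p y)
  res : ∀ (p : ℕ) {U V : S.Op} (h : V ≤ U) (f : ∀ y : U, fib p y), f ∈ sec p U →
    restr h f ∈ sec p V
  glue : ∀ (p : ℕ) (U : S.Op) (f : ∀ y : U, fib p y),
    (∀ x : U, ∃ (V : S.Op) (h : V ≤ U), (x : S.Pt) ∈ V ∧ restr h f ∈ sec p V) → f ∈ sec p U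
  d : ∀ (p : ℕ) (x : S.Pt), fib p x →ₗ[k] fib (p + 1) x
  d_sec : ∀ (p : ℕ) (U : S.Op) (f : ∀ y : U, fib p y), f ∈ sec p U →
    (fun y : U => d p y (f y)) ∈ sec (p + 1) U
  d_d : ∀ (p : ℕ) (x : S.Pt) (f : fib p x), d (p + 1) x (d p x f) = 0

variable {S : KSpace.{u} k}

namespace SheafComplex

attribute [instance] SheafComplex.ab SheafComplex.mod

/-- A morphism of complexes of sheaves. -/
structure Hom (K L : S.SheafComplex) where
  map : ∀ (p : ℕ) (x : S.Pt), K.fib p x →ₗ[k] L.fib p x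
  map_sec : ∀ (p : ℕ) (U : S.Op) (f : ∀ y : U, K.fib p y), f ∈ K.sec p U →
    (fun y : U => map p y (f y)) ∈ L.sec p U
  comm : ∀ (p : ℕ) (x : S.Pt) (f : K.fib p x), map (p + 1) x (K.d p x f) = L.d p x (map p x f)

/-- The sheaves `K⁰`, `ker (K¹ → K²)` and `0` of the two-term complex below. -/
def twoTermSec (K : S.SheafComplex) : ∀ (p : ℕ) (U : S.Op), Submodule k (∀ y : U, K.fib p y)
  | 0, U => K.sec 0 U
  | 1, U => K.sec 1 U ⊓
      { carrier := {f | ∀ y : U, K.d 1 y (f y) = 0}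
        zero_mem' := fun y => map_zero (K.d 1 y)
        add_mem' := fun hf hg y => by
          rw [Pi.add_apply, map_add, hf y, hg y, add_zero]
        smul_mem' := fun c f hf y => by rw [Pi.smul_apply, map_smul, hf y, smul_zero] }
  | _ + 2, _ => ⊥

/-- The two-term complex `K⁰ → ker (K¹ → K²)`. -/
def twoTerm (K : S.SheafComplex) : S.SheafComplex where
  fib := K.fib
  ab := K.ab
  mod := K.mod
  sec := K.twoTermSec
  res
    | 0, h, f, hf => K.res 0 h f hf
    | 1, h, f, hf => ⟨K.res 1 h f hf.1, fun y => hf.2 ⟨y, h y.2⟩⟩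
    | _ + 2, h, f, hf => by
        have hf : f = 0 := hf
        subst hf
        exact zero_mem _
  glue
    | 0, U, f, hf => K.glue 0 U f hf
    | 1, U, f, hf => ⟨K.glue 1 U f fun x => by
        obtain ⟨V, h, hx, h1, -⟩ := hf x
        exact ⟨V, h, hx, h1⟩, fun x => by
        obtain ⟨V, h, hx, -, h1⟩ := hf x
        exact h1 ⟨x, hx⟩⟩
    | p + 2, U, f, hf => by
        change f = 0
        ext x
        obtain ⟨V, h, hx, h1⟩ := hf x
        exact congrFun (show restr h f = 0 from h1) ⟨x, hx⟩
  d := K.d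
  d_sec
    | 0, U, f, hf => ⟨K.d_sec 0 U f hf, fun y => K.d_d 0 y (f y)⟩
    | 1, U, f, hf => funext fun y => hf.2 y
    | p + 2, U, f, hf => by
        have hf : f = 0 := hf
        subst hf
        exact funext fun y => map_zero (K.d (p + 2) y)
  d_d := K.d_d

/-- The inclusion of the two-term complex. -/
def twoTermIncl (K : S.SheafComplex) : Hom K.twoTerm K where
  map p x := (LinearMap.id : K.fib p x →ₗ[k] K.fib p x)
  map_sec
    | 0, _, _, hf => hf
    | 1, _, _, hf => hf.1
    | p + 2, U, f, hf => by
        have hf : f = 0 := hf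
        subst hf
        exact zero_mem (K.sec (p + 2) U)
  comm p x f := rfl

end SheafComplex

variable (S) in
/-- An open cover of `S`, indexed by the points, with a chosen neighbourhood for each point.
(Every open cover is refined by one of these.) -/
structure PointCover where
  U : S.Pt → S.Op
  mem : ∀ x, x ∈ U x

namespace PointCover

/-- Covers are ordered by refinement. -/
instance : Preorder (PointCover S) where
  le 𝔘 𝔙 := ∀ x, 𝔙.U x ≤ 𝔘.U x
  le_refl 𝔘 x := le_rfl
  le_trans 𝔘 𝔙 𝔚 h h' x := (h' x).trans (h x)

/-- The intersection of two members of a cover. -/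
abbrev inter (𝔘 : PointCover S) (i j : S.Pt) : S.Op := 𝔘.U i ⊓ 𝔘.U j

lemma inter_le {𝔘 𝔙 : PointCover S} (h : 𝔘 ≤ 𝔙) (i j : S.Pt) : 𝔙.inter i j ≤ 𝔘.inter i j :=
  inf_le_inf (h i) (h j)

end PointCover

namespace SheafComplex
variable (K : S.SheafComplex) (𝔘 𝔙 : PointCover S)

/-- Pairs of families `(a_ij)` and `(A_i)` of functions with values in `K⁰` and `K¹`. -/
abbrev Pairs : Type u :=
  (∀ i j : S.Pt, ∀ y : 𝔘.inter i j, K.fib 0 y) × (∀ i : S.Pt, ∀ y : 𝔘.U i, K.fib 1 y)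

/-- The 1-cocycles of the total complex of the Čech double complex: pairs `(a, A)` in
`C¹(𝔘, K⁰) ⊕ C⁰(𝔘, K¹)` with `δ a = 0`, `δ A = d a` and `d A = 0`. -/
def Z1 : Submodule k (K.Pairs 𝔘) where
  carrier := {z | (∀ i j, z.1 i j ∈ K.sec 0 (𝔘.inter i j)) ∧ (∀ i, z.2 i ∈ K.sec 1 (𝔘.U i)) ∧
    (∀ (i j l y : S.Pt) (hi : y ∈ 𝔘.U i) (hj : y ∈ 𝔘.U j) (hl : y ∈ 𝔘.U l),
      z.1 j l ⟨y, hj, hl⟩ - z.1 i l ⟨y, hi, hl⟩ + z.1 i j ⟨y, hi, hj⟩ = 0) ∧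
    (∀ (i j y : S.Pt) (hi : y ∈ 𝔘.U i) (hj : y ∈ 𝔘.U j),
      z.2 j ⟨y, hj⟩ - z.2 i ⟨y, hi⟩ = K.d 0 y (z.1 i j ⟨y, hi, hj⟩)) ∧
    (∀ (i y : S.Pt) (hi : y ∈ 𝔘.U i), K.d 1 y (z.2 i ⟨y, hi⟩) = 0)}
  zero_mem' := by
    refine ⟨fun i j => zero_mem _, fun i => zero_mem _, ?_, ?_, ?_⟩ <;> intros <;> simp
  add_mem' := by
    rintro z w ⟨h1, h2, h3, h4, h5⟩ ⟨h1', h2', h3', h4', h5'⟩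
    refine ⟨fun i j => add_mem (h1 i j) (h1' i j), fun i => add_mem (h2 i) (h2' i),
      fun i j l y hi hj hl => ?_, fun i j y hi hj => ?_, fun i y hi => ?_⟩
    · have e := congrArg₂ (· + ·) (h3 i j l y hi hj hl) (h3' i j l y hi hj hl)
      simp only [Prod.fst_add, Pi.add_apply, add_zero] at e ⊢
      rw [← e]; abel
    · simp only [Prod.fst_add, Prod.snd_add, Pi.add_apply, map_add, ← h4 i j y hi hj,
        ← h4' i j y hi hj]
      abel
    · simp only [Prod.snd_add, Pi.add_apply, map_add, h5 i y hi, h5' i y hi, add_zero]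
  smul_mem' := by
    rintro c z ⟨h1, h2, h3, h4, h5⟩
    refine ⟨fun i j => Submodule.smul_mem _ c (h1 i j), fun i => Submodule.smul_mem _ c (h2 i),
      fun i j l y hi hj hl => ?_, fun i j y hi hj => ?_, fun i y hi => ?_⟩
    · simp only [Prod.smul_fst, Pi.smul_apply, ← smul_sub, ← smul_add, h3 i j l y hi hj hl,
        smul_zero]
    · simp only [Prod.smul_fst, Prod.smul_snd, Pi.smul_apply, ← smul_sub, map_smul,
        h4 i j y hi hj]
    · simp only [Prod.smul_snd, Pi.smul_apply, map_smul, h5 i y hi, smul_zero]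

/-- The 1-coboundaries `(δ h, d h)` with `h` in `C⁰(𝔘, K⁰)`. -/
def B1 : Submodule k (K.Pairs 𝔘) where
  carrier := {z | ∃ h : ∀ i : S.Pt, ∀ y : 𝔘.U i, K.fib 0 y, (∀ i, h i ∈ K.sec 0 (𝔘.U i)) ∧
    (∀ (i j y : S.Pt) (hi : y ∈ 𝔘.U i) (hj : y ∈ 𝔘.U j),
      z.1 i j ⟨y, hi, hj⟩ = h j ⟨y, hj⟩ - h i ⟨y, hi⟩) ∧
    (∀ (i y : S.Pt) (hi : y ∈ 𝔘.U i), z.2 i ⟨y, hi⟩ = K.d 0 y (h i ⟨y, hi⟩))}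
  zero_mem' := ⟨0, fun i => zero_mem _, by intros; simp, by intros; simp⟩
  add_mem' := by
    rintro z w ⟨h, h1, h2, h3⟩ ⟨h', h1', h2', h3'⟩
    refine ⟨h + h', fun i => add_mem (h1 i) (h1' i), fun i j y hi hj => ?_, fun i y hi => ?_⟩
    · simp only [Prod.fst_add, Pi.add_apply, h2 i j y hi hj, h2' i j y hi hj]
      abel
    · simp only [Prod.snd_add, Pi.add_apply, h3 i y hi, h3' i y hi, map_add]
  smul_mem' := by
    rintro c z ⟨h, h1, h2, h3⟩
    refine ⟨c • h, fun i => Submodule.smul_mem _ c (h1 i), fun i j y hi hj => ?_, fun i y hi => ?_⟩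
    · simp only [Prod.smul_fst, Pi.smul_apply, h2 i j y hi hj, smul_sub]
    · simp only [Prod.smul_snd, Pi.smul_apply, h3 i y hi, map_smul]

/-- The first hypercohomology of the Čech total complex of the cover `𝔘`. -/
def H1At : Type u := K.Z1 𝔘 ⧸ (K.B1 𝔘).comap (K.Z1 𝔘).subtype

instance : AddCommGroup (K.H1At 𝔘) :=
  inferInstanceAs (AddCommGroup (K.Z1 𝔘 ⧸ (K.B1 𝔘).comap (K.Z1 𝔘).subtype))
instance : Module k (K.H1At 𝔘) :=
  inferInstanceAs (Module k (K.Z1 𝔘 ⧸ (K.B1 𝔘).comap (K.Z1 𝔘).subtype))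

/-- The class of a cocycle. -/
def mkH1 : K.Z1 𝔘 →ₗ[k] K.H1At 𝔘 := Submodule.mkQ _

variable {𝔘 𝔙}

/-- Restriction of families to a refinement. -/
def refinePairs (h : 𝔘 ≤ 𝔙) : K.Pairs 𝔘 →ₗ[k] K.Pairs 𝔙 where
  toFun z := (fun i j => restr (PointCover.inter_le h i j) (z.1 i j), fun i => restr (h i) (z.2 i))
  map_add' _ _ := rfl
  map_smul' _ _ := rfl

lemma refine_Z1 (h : 𝔘 ≤ 𝔙) (z : K.Pairs 𝔘) (hz : z ∈ K.Z1 𝔘) :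
    K.refinePairs h z ∈ K.Z1 𝔙 := by
  obtain ⟨h1, h2, h3, h4, h5⟩ := hz
  exact ⟨fun i j => K.res 0 (PointCover.inter_le h i j) _ (h1 i j),
    fun i => K.res 1 (h i) _ (h2 i),
    fun i j l y hi hj hl => h3 i j l y (h i hi) (h j hj) (h l hl),
    fun i j y hi hj => h4 i j y (h i hi) (h j hj), fun i y hi => h5 i y (h i hi)⟩

lemma refine_B1 (h : 𝔘 ≤ 𝔙) (z : K.Pairs 𝔘) (hz : z ∈ K.B1 𝔘) :
    K.refinePairs h z ∈ K.B1 𝔙 := by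
  obtain ⟨b, h1, h2, h3⟩ := hz
  exact ⟨fun i => restr (h i) (b i), fun i => K.res 0 _ _ (h1 i),
    fun i j y hi hj => h2 i j y (h i hi) (h j hj), fun i y hi => h3 i y (h i hi)⟩

variable (𝔘 𝔙) in
/-- Restriction to a refinement on the hypercohomology of covers. -/
def refineH1 (h : 𝔘 ≤ 𝔙) : K.H1At 𝔘 →ₗ[k] K.H1At 𝔙 :=
  Submodule.mapQ _ _ ((K.refinePairs h).restrict (K.refine_Z1 h))
    (fun z hz => K.refine_B1 h z.1 hz)

open scoped Classical in
/-- The hypercohomology `ℍ¹(X, K^•)`: the colimit of the hypercohomology of the Čech total complexes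
over all open covers. -/
def H1 : Type u := Module.DirectLimit K.H1At K.refineH1

open scoped Classical in
instance : AddCommGroup K.H1 :=
  inferInstanceAs (AddCommGroup (Module.DirectLimit K.H1At K.refineH1))
open scoped Classical in
instance : Module k K.H1 :=
  inferInstanceAs (Module k (Module.DirectLimit K.H1At K.refineH1))

open scoped Classical in
/-- The natural map from the hypercohomology of a cover. -/
def ofCover (𝔘 : PointCover S) : K.H1At 𝔘 →ₗ[k] K.H1 :=
  Module.DirectLimit.of k (PointCover S) K.H1At K.refineH1 𝔘

/-- The class of a cocycle in `ℍ¹`. -/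
def cls (𝔘 : PointCover S) : K.Z1 𝔘 →ₗ[k] K.H1 := K.ofCover 𝔘 ∘ₗ K.mkH1 𝔘

variable {K} {L : S.SheafComplex} (φ : Hom K L)

/-- The map induced by a morphism of complexes on families. -/
def Hom.pairs (𝔘 : PointCover S) : K.Pairs 𝔘 →ₗ[k] L.Pairs 𝔘 where
  toFun z := (fun i j y => φ.map 0 y (z.1 i j y), fun i y => φ.map 1 y (z.2 i y))
  map_add' z w := by ext <;> simp
  map_smul' c z := by ext <;> simp

lemma Hom.pairs_Z1 (z : K.Pairs 𝔘) (hz : z ∈ K.Z1 𝔘) : φ.pairs 𝔘 z ∈ L.Z1 𝔘 := by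
  obtain ⟨h1, h2, h3, h4, h5⟩ := hz
  refine ⟨fun i j => φ.map_sec 0 _ _ (h1 i j), fun i => φ.map_sec 1 _ _ (h2 i),
    fun i j l y hi hj hl => ?_, fun i j y hi hj => ?_, fun i y hi => ?_⟩
  · have := congrArg (φ.map 0 y) (h3 i j l y hi hj hl)
    rwa [map_add, map_sub, map_zero] at this
  · have := congrArg (φ.map 1 y) (h4 i j y hi hj)
    rwa [map_sub, φ.comm 0] at this
  · have := congrArg (φ.map 2 y) (h5 i y hi)
    rwa [map_zero, φ.comm 1] at this

lemma Hom.pairs_B1 (z : K.Pairs 𝔘) (hz : z ∈ K.B1 𝔘) : φ.pairs 𝔘 z ∈ L.B1 𝔘 := by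
  obtain ⟨h, h1, h2, h3⟩ := hz
  refine ⟨fun i y => φ.map 0 y (h i y), fun i => φ.map_sec 0 _ _ (h1 i),
    fun i j y hi hj => ?_, fun i y hi => ?_⟩
  · exact (congrArg (φ.map 0 y) (h2 i j y hi hj)).trans (map_sub _ _ _)
  · exact (congrArg (φ.map 1 y) (h3 i y hi)).trans (φ.comm 0 _ _)

/-- The map induced by a morphism of complexes on the hypercohomology of a cover. -/
def Hom.H1At (𝔘 : PointCover S) : K.H1At 𝔘 →ₗ[k] L.H1At 𝔘 :=
  Submodule.mapQ _ _ ((φ.pairs 𝔘).restrict φ.pairs_Z1) (fun z hz => φ.pairs_B1 z.1 hz)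

open scoped Classical in
/-- The map induced by a morphism of complexes on hypercohomology. -/
def Hom.H1 : K.H1 →ₗ[k] L.H1 :=
  Module.DirectLimit.lift k (PointCover S) K.H1At K.refineH1
    (fun 𝔘 => L.ofCover 𝔘 ∘ₗ φ.H1At 𝔘) (by
      intro 𝔘 𝔙 h z
      obtain ⟨z, rfl⟩ := Submodule.mkQ_surjective _ z
      exact Module.DirectLimit.of_f (f := L.refineH1) (hij := h) (x := φ.H1At 𝔘 (K.mkH1 𝔘 z)))

end SheafComplex

/-! ### The de Rham complex of endomorphisms -/

variable {D : S.Divisor} {M : S.OMod}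

/-- The stalks of `End M` in degree `0`, of `End M ⊗ Ω¹(D)` in degree `1` and of `End M ⊗ Ω^•(*D)`
in degree at least `2`. For locally free `M` of finite rank, `End M ⊗ F` is the sheaf of homomorphisms
from `M` to `M ⊗ F`. -/
def EndFib (D : S.Divisor) (M : S.OMod) : ℕ → S.Pt → Type u
  | 0, x => M.st x →ₗ[S.st x] M.st x
  | 1, x => M.st x →ₗ[S.st x] M.st x ⊗[S.st x] FormsOne D x
  | _ + 2, x => M.st x →ₗ[S.st x] M.st x ⊗[S.st x] FormsAll D x

instance : ∀ (p : ℕ) (x : S.Pt), AddCommGroup (EndFib D M p x)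
  | 0, x => inferInstanceAs (AddCommGroup (M.st x →ₗ[S.st x] M.st x))
  | 1, x => inferInstanceAs (AddCommGroup (M.st x →ₗ[S.st x] M.st x ⊗[S.st x] FormsOne D x))
  | _ + 2, x => inferInstanceAs (AddCommGroup (M.st x →ₗ[S.st x] M.st x ⊗[S.st x] FormsAll D x))

instance : ∀ (p : ℕ) (x : S.Pt), Module (S.st x) (EndFib D M p x)
  | 0, x => inferInstanceAs (Module (S.st x) (M.st x →ₗ[S.st x] M.st x))
  | 1, x => inferInstanceAs (Module (S.st x) (M.st x →ₗ[S.st x] M.st x ⊗[S.st x] FormsOne D x))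
  | _ + 2, x =>
    inferInstanceAs (Module (S.st x) (M.st x →ₗ[S.st x] M.st x ⊗[S.st x] FormsAll D x))

instance (p : ℕ) (x : S.Pt) : Module k (EndFib D M p x) :=
  Module.compHom _ (algebraMap k (S.st x))

/-- The sheaves `End M`, `End M ⊗ Ω¹(D)` and `End M ⊗ Ω^p(*D)` for `p` at least `2`. -/
def endSheaf (D : S.Divisor) (M : S.OMod) : ∀ p : ℕ, S.FnSheaf (EndFib D M p)
  | 0 => M.homSheaf M.sheaf
  | 1 => M.homSheaf (tensorOne D M)
  | p + 2 => M.homSheaf (tensorForms D M (p + 2))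

/-- The differential `∇_End` on stalks. -/
def Connection.endD (c : Connection D M) : ∀ (p : ℕ) (x : S.Pt),
    EndFib D M p x →ₗ[k] EndFib D M (p + 1) x
  | 0, x =>
    { toFun := fun φ => (c.conn x).dEnd φ
      map_add' := (c.conn x).dEnd_add
      map_smul' := (c.conn x).dEnd_const_smul }
  | 1, x =>
    { toFun := fun Φ => (c.conn x).dHom (toPole ∘ₗ Φ)
      map_add' := fun _ _ => (congrArg (c.conn x).dHom (LinearMap.comp_add _ _ _)).trans
        ((c.conn x).dHom_add _ _)
      map_smul' := fun a _ => (congrArg (c.conn x).dHom (LinearMap.comp_smul _ _ _)).trans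
        ((c.conn x).dHom_const_smul a _) }
  | _ + 2, x =>
    { toFun := fun Φ => (c.conn x).dHom Φ
      map_add' := (c.conn x).dHom_add
      map_smul' := (c.conn x).dHom_const_smul }

/-- The de Rham complex `End M → End M ⊗ Ω¹(D) → End M ⊗ Ω²(*D) → ⋯` of an integrable connection. -/
def Connection.deRham (c : Connection D M) (hc : c.IsIntegrable) : S.SheafComplex where
  fib := EndFib D M
  ab := inferInstance
  mod := inferInstance
  sec p U :=
    { (endSheaf D M p).sec U with
      smul_mem' := fun a f hf => by
        have := (endSheaf D M p).smul U (S.const U a) f hf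
        simp only [S.germ_const] at this
        exact this }
  res p _ _ h f hf := (endSheaf D M p).res h f hf
  glue p U f hf := (endSheaf D M p).glue U f hf
  d := c.endD
  d_sec
    | 0, _, _, hf => c.dEnd_mem hf
    | 1, _, _, hf => c.dHom_mem (toPole_hom_mem hf)
    | _ + 2, _, _, hf => c.dHom_mem hf
  d_d
    | 0, x, φ => (c.conn x).dHom_dEnd (hc x) φ
    | 1, x, Φ => (c.conn x).dHom_dHom (hc x) (toPole ∘ₗ Φ)
    | _ + 2, x, Φ => (c.conn x).dHom_dHom (hc x) Φ

end KSpace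

namespace KSpace
open LocalForms
variable {k : Type v} [Field k]

/-! ### Schemes and complex spaces -/

/-- A scheme over `k`. -/
def ofScheme {k : Type u} [Field k] (X : Scheme.{u}) (f : X ⟶ Spec (CommRingCat.of k)) :
    KSpace.{u} k where
  space := X.toLocallyRingedSpace
  str := ((Scheme.ΓSpecIso (CommRingCat.of k)).inv ≫ f.appTop).hom
  kind := .algebraic

/-- Schemes of finite type over `k`. -/
def IsSchemeOfFiniteType {k : Type u} [Field k] (S : KSpace.{u} k) : Prop :=
  ∃ (X : Scheme.{u}) (f : X ⟶ Spec (CommRingCat.of k)),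
    LocallyOfFiniteType f ∧ QuasiCompact f ∧ S = ofScheme X f

/-- The ring of holomorphic functions on an open subset of `ℂⁿ`. -/
def Hol {n : ℕ} (V : Opens (Fin n → ℂ)) : Subring (V → ℂ) where
  carrier := {g | ∃ G : (Fin n → ℂ) → ℂ, DifferentiableOn ℂ G V ∧ ∀ z : V, g z = G z}
  mul_mem' := by
    rintro _ _ ⟨G, hG, h⟩ ⟨G', hG', h'⟩
    exact ⟨G * G', hG.mul hG', fun z => by simp [h, h']⟩
  one_mem' := ⟨1, differentiableOn_const 1, fun _ => rfl⟩
  add_mem' := by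
    rintro _ _ ⟨G, hG, h⟩ ⟨G', hG', h'⟩
    exact ⟨G + G', hG.add hG', fun z => by simp [h, h']⟩
  zero_mem' := ⟨0, differentiableOn_const 0, fun _ => rfl⟩
  neg_mem' := by
    rintro _ ⟨G, hG, h⟩
    exact ⟨-G, hG.neg, fun z => by simp [h]⟩

/-- Restriction of holomorphic functions. -/
def Hol.res {n : ℕ} {V V' : Opens (Fin n → ℂ)} (h : V' ≤ V) (g : Hol V) : Hol V' :=
  ⟨fun z => g.1 ⟨z, h z.2⟩, by
    obtain ⟨G, hG, hg⟩ := g.2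
    exact ⟨G, hG.mono h, fun z => hg _⟩⟩

/-- A constant holomorphic function. -/
def Hol.const {n : ℕ} (V : Opens (Fin n → ℂ)) (c : ℂ) : Hol V :=
  ⟨fun _ => c, fun _ => c, differentiableOn_const c, fun _ => rfl⟩

/-- The preimage of an open set under a continuous map defined on an open subset of `S`. -/
def preim {S : KSpace.{u} k} {U : S.Op} {n : ℕ} (φ : C(U, Fin n → ℂ)) (V : Opens (Fin n → ℂ)) :
    S.Op :=
  ⟨Subtype.val '' (φ ⁻¹' V), U.isOpen.isOpenMap_subtype_val _ (V.isOpen.preimage φ.continuous)⟩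

lemma preim_mono {S : KSpace.{u} k} {U : S.Op} {n : ℕ} (φ : C(U, Fin n → ℂ))
    {V V' : Opens (Fin n → ℂ)} (h : V' ≤ V) : preim φ V' ≤ preim φ V :=
  Set.image_mono (Set.preimage_mono h)

lemma mem_preim {S : KSpace.{u} k} {U : S.Op} {n : ℕ} (φ : C(U, Fin n → ℂ))
    {V : Opens (Fin n → ℂ)} (y : U) (h : φ y ∈ V) : (y : S.Pt) ∈ preim φ V := ⟨y, h, rfl⟩

/-- An isomorphism of an open subspace `U` of `S` with the subspace of an open subset `W` of `ℂⁿ`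
defined by the ideal generated by finitely many holomorphic functions `f₁, …, f_m` on `W`. It
consists of a homeomorphism `emb` onto the zero set, and of the compatible homomorphisms `pull` that
pull holomorphic functions back and induce isomorphisms of stalks modulo the `f_j`. -/
structure Chart (S : KSpace.{u} k) (e : ℂ ≃+* k) (U : S.Op) where
  n : ℕ
  m : ℕ
  W : Opens (Fin n → ℂ)
  f : Fin m → Hol W
  emb : C(U, Fin n → ℂ)
  isEmbedding : Topology.IsEmbedding emb
  range_emb : Set.range emb = {z | ∃ hz : z ∈ W, ∀ j, (f j).1 ⟨z, hz⟩ = 0}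
  pull : ∀ V : Opens (Fin n → ℂ), Hol V →+* S.O (preim emb V)
  pull_res : ∀ {V V' : Opens (Fin n → ℂ)} (h : V' ≤ V) (g : Hol V),
    S.res (preim_mono emb h) (pull V g) = pull V' (Hol.res h g)
  pull_const : ∀ (V : Opens (Fin n → ℂ)) (c : ℂ), pull V (Hol.const V c) = S.const _ (e c)
  surjective : ∀ (y : U) (r : S.st y), ∃ (V : Opens (Fin n → ℂ)) (hy : emb y ∈ V) (g : Hol V),
    S.germ (y : S.Pt) (mem_preim emb y hy) (pull V g) = r
  kernel : ∀ (y : U) (V : Opens (Fin n → ℂ)) (hy : emb y ∈ V) (g : Hol V),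
    S.germ (y : S.Pt) (mem_preim emb y hy) (pull V g) = 0 ↔
      ∃ (V' : Opens (Fin n → ℂ)) (h : V' ≤ V) (h' : V' ≤ W) (_ : emb y ∈ V') (c : Fin m → Hol V'),
        Hol.res h g = ∑ j, c j * Hol.res h' (f j)

/-- Complex spaces (the field `k` being the field of complex numbers). -/
def IsComplexSpace (S : KSpace.{u} k) : Prop :=
  S.kind = .analytic ∧ ∃ e : ℂ ≃+* k, ∀ x : S.Pt, ∃ U : S.Op, x ∈ U ∧ Nonempty (Chart S e U)

/-! ### Vector bundles and deformations of connections -/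

variable {S : KSpace.{u} k} {D : S.Divisor}

/-- Locally free sheaves of finite rank. -/
def IsVectorBundle (E : S.OMod) : Prop :=
  ∀ x : S.Pt, ∃ (U : S.Op) (_ : x ∈ U) (n : ℕ) (e : Fin n → E.sec U),
    ∀ (V : S.Op) (h : V ≤ U) (s : E.sec V),
      ∃! a : Fin n → S.O V, s = ∑ i, a i • OMod.res h (e i)

/-- A homomorphism of modules is horizontal if it commutes with the connections. -/
def Connection.IsHorizontal {M N : S.OMod} (c : Connection D M) (c' : Connection D N)
    (f : M ⟶ N) : Prop :=
  ∀ (x : S.Pt) (s : M.st x), (c'.conn x).toFun (OMod.stMap f x s) =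
    LinearMap.rTensor (FormsOne D x) (OMod.stMap f x) ((c.conn x).toFun s)

lemma OMod.stMap_id (M : S.OMod) (x : S.Pt) : OMod.stMap (𝟙 M) x = LinearMap.id := by
  ext s
  obtain ⟨U, hx, s, rfl⟩ := OMod.exists_germ x s
  exact OMod.stMap_germ _ _ _ _

lemma OMod.stMap_comp {M N P : S.OMod} (f : M ⟶ N) (g : N ⟶ P) (x : S.Pt) :
    OMod.stMap (f ≫ g) x = OMod.stMap g x ∘ₗ OMod.stMap f x := by
  ext s
  obtain ⟨U, hx, s, rfl⟩ := OMod.exists_germ x s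
  rw [LinearMap.comp_apply, OMod.stMap_germ, OMod.stMap_germ, OMod.stMap_germ]
  rfl

namespace Connection.IsHorizontal
variable {M N P : S.OMod} {c : Connection D M} {c' : Connection D N} {c'' : Connection D P}

lemma id (c : Connection D M) : c.IsHorizontal c (𝟙 M) := fun x s => by
  simp [OMod.stMap_id]

lemma comp {f : M ⟶ N} {g : N ⟶ P} (hf : c.IsHorizontal c' f) (hg : c'.IsHorizontal c'' g) :
    c.IsHorizontal c'' (f ≫ g) := fun x s => by
  rw [OMod.stMap_comp, LinearMap.comp_apply, hg, hf, LinearMap.rTensor_comp,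
    LinearMap.comp_apply]

lemma symm {f : M ≅ N} (hf : c.IsHorizontal c' f.hom) : c'.IsHorizontal c f.inv := fun x s => by
  have h1 : OMod.stMap f.hom x ∘ₗ OMod.stMap f.inv x = LinearMap.id := by
    rw [← OMod.stMap_comp, f.inv_hom_id, OMod.stMap_id]
  have h2 : OMod.stMap f.inv x ∘ₗ OMod.stMap f.hom x = LinearMap.id := by
    rw [← OMod.stMap_comp, f.hom_inv_id, OMod.stMap_id]
  have h3 := congrArg (LinearMap.rTensor (FormsOne D x) (OMod.stMap f.inv x))
    (hf x (OMod.stMap f.inv x s))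
  rw [← LinearMap.comp_apply, ← LinearMap.comp_apply, ← LinearMap.rTensor_comp, h1, h2] at h3
  simpa using h3.symm

end Connection.IsHorizontal

variable {E : S.OMod}

/-- A first-order deformation of a vector bundle `E` with an integrable connection with poles
along `D`: a vector bundle on `X × Spec k[ε]`, that is, a sheaf of `𝒪`-modules `tot` with an
endomorphism `eps` of square zero which is locally free of finite rank over `𝒪[ε] = 𝒪 ⊕ 𝒪 ε`, with an
integrable connection with poles along `D` relative to `Spec k[ε]`, that is, one which commutes with
`ε`, together with an isomorphism of its reduction modulo `ε` with `E`, which is given by a horizontal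
surjection `proj` with kernel `ε tot`. -/
structure Deformation (c : Connection D E) where
  tot : S.OMod
  eps : tot ⟶ tot
  eps_eps : eps ≫ eps = 0
  locallyFree : ∀ x : S.Pt, ∃ (U : S.Op) (_ : x ∈ U) (n : ℕ) (e : Fin n → tot.sec U),
    ∀ (V : S.Op) (h : V ≤ U) (s : tot.sec V),
      ∃! p : (Fin n → S.O V) × (Fin n → S.O V),
        s = ∑ i, (p.1 i • OMod.res h (e i) + p.2 i • OMod.app eps V (OMod.res h (e i)))
  conn : Connection D tot
  integrable : conn.IsIntegrable
  eps_horizontal : conn.IsHorizontal conn eps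
  proj : tot ⟶ E
  proj_surjective : ∀ x : S.Pt, Function.Surjective (OMod.stMap proj x)
  proj_ker : ∀ x : S.Pt, LinearMap.ker (OMod.stMap proj x) = LinearMap.range (OMod.stMap eps x)
  proj_horizontal : conn.IsHorizontal c proj

namespace Deformation
variable {c : Connection D E}

/-- Two deformations are isomorphic if there is an isomorphism of the bundles on `X × Spec k[ε]` that
is compatible with the connections and induces the identity on `E`. -/
def Isom (P Q : Deformation c) : Prop :=
  ∃ φ : P.tot ≅ Q.tot, P.eps ≫ φ.hom = φ.hom ≫ Q.eps ∧ φ.hom ≫ Q.proj = P.proj ∧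
    P.conn.IsHorizontal Q.conn φ.hom

/-- Isomorphism of deformations. -/
instance setoid (c : Connection D E) : Setoid (Deformation c) where
  r := Isom
  iseqv :=
    { refl := fun P => ⟨Iso.refl _, by simp, by simp, Connection.IsHorizontal.id _⟩
      symm := by
        rintro P Q ⟨φ, h1, h2, h3⟩
        refine ⟨φ.symm, ?_, ?_, h3.symm⟩
        · rw [Iso.symm_hom, Iso.eq_inv_comp, ← Category.assoc, ← h1, Category.assoc,
            φ.hom_inv_id, Category.comp_id]
        · rw [Iso.symm_hom, Iso.inv_comp_eq, h2]
      trans := by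
        rintro P Q R ⟨φ, h1, h2, h3⟩ ⟨ψ, h1', h2', h3'⟩
        refine ⟨φ ≪≫ ψ, ?_, ?_, h3.comp h3'⟩
        · rw [Iso.trans_hom, ← Category.assoc, h1, Category.assoc, h1', Category.assoc]
        · rw [Iso.trans_hom, Category.assoc, h2', h2] }

/-- The set of isomorphism classes of first-order deformations. -/
def Classes (c : Connection D E) : Type (u + 1) := Quotient (setoid c)

end Deformation

/-- The two-term complex `F^•`, from `End E` to the closed forms in `End E ⊗ Ω¹(D)`. -/
abbrev Connection.closedForms (c : Connection D E) (hc : c.IsIntegrable) : S.SheafComplex :=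
  (c.deRham hc).twoTerm

/-- The cocycle `z = (a, A)` describes the deformation `P`: there are local splittings `σ_i` of the
projection `P.tot → E`, defined on the members of the cover, with `σ_j = σ_i ∘ (1 + ε a_ij)`
on the intersections, and the connection of `P` is `∇ + ε A_i` in terms of `σ_i`. -/
def Deformation.Represents {c : Connection D E} {hc : c.IsIntegrable} (P : Deformation c)
    (𝔘 : PointCover S) (z : (c.closedForms hc).Z1 𝔘) : Prop :=
  ∃ σ : ∀ i : S.Pt, ∀ y : 𝔘.U i, E.st y →ₗ[S.st y] P.tot.st y,
    (∀ i, σ i ∈ (E.homSheaf P.tot.sheaf).sec (𝔘.U i)) ∧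
    (∀ (i : S.Pt) (y : 𝔘.U i) (s : E.st y), OMod.stMap P.proj y (σ i y s) = s) ∧
    (∀ (i j y : S.Pt) (hi : y ∈ 𝔘.U i) (hj : y ∈ 𝔘.U j) (s : E.st y),
      let a : E.st y →ₗ[S.st y] E.st y := z.1.1 i j ⟨y, hi, hj⟩
      σ j ⟨y, hj⟩ s = σ i ⟨y, hi⟩ s + OMod.stMap P.eps y (σ i ⟨y, hi⟩ (a s))) ∧
    (∀ (i : S.Pt) (y : 𝔘.U i) (s : E.st y),
      let A : E.st y →ₗ[S.st y] E.st y ⊗[S.st y] FormsOne D y := z.1.2 i y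
      (P.conn.conn y).toFun (σ i y s) =
        LinearMap.rTensor (FormsOne D y) (σ i y) ((c.conn y).toFun s) +
        LinearMap.rTensor (FormsOne D y) (OMod.stMap P.eps y ∘ₗ σ i y) (A s))

end KSpace

end

/-!
Every first-order deformation of `(E, ∇)` is an extension of `E` by itself. Multiplication by `ε`
on `tot` factors through the projection `π : tot → E` and induces an inclusion `ι : E → tot`
(`Deformation.incl`). As `tot` is locally free over `𝒪[ε]`, the kernel of `ε` is its image, so that
`0 → E → tot → E → 0` is exact. As `E` is locally free, `π` has splittings `σ_i` over the members of
a cover (`exists_local_section`), and they have corresponding retractions `ρ_i : tot → E` of `ι`.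
The components of the cocycle are then `a_ij = ρ_i ∘ σ_j` and the second fundamental forms
`A_i = ρ_i ∘ ∇ ∘ σ_i`, which are `𝒪`-linear because `ρ_i ∘ σ_i = 0`. The curvature of the connection
on `tot` maps `σ_i s` to `ι` of `(∇_End A_i) s` (`Conn.ext_toPole_eq`), so that the `A_i` are closed
exactly when it is integrable; and `A_j - A_i = ∇_End a_ij` (`IsSplit.secondForm_sub`). This is
`Deformation.exists_isDescribedBy`.

Another choice of splittings, `σ_i + ι ∘ h_i`, changes the cocycle by the coboundary of `h`, and
every coboundary arises in this way (`IsDescribedBy.sub_mem`, `IsDescribedBy.exists_of_sub_mem`). If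
two deformations are described by the same cocycle, the isomorphisms `σ_i ↦ τ_i`, `ι ↦ ι` do not
depend on `i`, glue, and are horizontal (`Deformation.isom_of_isDescribedBy`). Conversely, given a
cocycle, two copies of `E` are glued by `1 + ε a_ij` (`twist`), and the connections `∇ + ε A_i`
agree on the intersections (`SplitExtension.deformation`).

The complexes `F^•` and `R^•` have the same `ℍ¹` because a 1-cocycle of a Čech total complex
consists of closed `A_i`, so that both have the same 1-cocycles and 1-coboundaries on every cover
(`SheafComplex.bijective_H1_twoTermIncl`).

All sheaves are handled through families of maps of stalks that map sections to sections, so that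
the algebra takes place in the stalks.
-/

noncomputable section
open scoped TensorProduct
open AlgebraicGeometry CategoryTheory TopologicalSpace Opposite

/-! ### Connections on split extensions of modules -/

namespace LocalForms

variable {k A : Type*} [CommRing k] [CommRing A] [Algebra k A]
variable {I : Ideal A} {N : Submodule A Ω[A⁄k]}
variable {M M' : Type*} [AddCommGroup M] [Module A M] [AddCommGroup M'] [Module A M']

lemma rTensor_wedge_of_linearMap (f : M →ₗ[A] M') (z : M ⊗[A] PoleForms k I N)
    (w : PoleForms k I N) :
    LinearMap.rTensor _ f (wedge z w) = wedge (LinearMap.rTensor _ f z) w := by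
  induction z with
  | zero => simp
  | add x y hx hy => simp only [map_add, LinearMap.add_apply, hx, hy]
  | tmul s u => simp

lemma toPole_rTensor (f : M →ₗ[A] M') (z : M ⊗[A] PoleOne k I N) :
    toPole (LinearMap.rTensor _ f z) = LinearMap.rTensor _ f (toPole z) := by
  induction z with
  | zero => simp
  | add x y hx hy => simp only [map_add, hx, hy]
  | tmul s u => simp [toPole]

/-- If `∇ ∘ f = f ∘ ∇ + g ∘ B` on `M`, the same holds on `M ⊗ Ω^•(*D)`. -/
lemma Conn.ext_rTensor_add (c : Conn I N M) (c' : Conn I N M') {f g : M →ₗ[A] M'}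
    {B : M →ₗ[A] M ⊗[A] PoleOne k I N}
    (h : ∀ s, c'.toFun (f s) = LinearMap.rTensor _ f (c.toFun s) + LinearMap.rTensor _ g (B s))
    (z : M ⊗[A] PoleForms k I N) :
    c'.ext (LinearMap.rTensor _ f z) = LinearMap.rTensor _ f (c.ext z) +
      LinearMap.rTensor _ g (wedgeHom (toPole ∘ₗ B) z) := by
  induction z with
  | zero => simp
  | add x y hx hy => simp only [map_add, hx, hy]; abel
  | tmul s u =>
    simp only [LinearMap.rTensor_tmul, c.ext_tmul, c'.ext_tmul, h, wedgeHom_tmul, map_add,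
      LinearMap.add_apply, LinearMap.comp_apply, rTensor_wedge_of_linearMap, toPole_rTensor]
    abel

lemma Conn.ext_rTensor_of_horizontal (c : Conn I N M) (c' : Conn I N M') {f : M →ₗ[A] M'}
    (h : ∀ s, c'.toFun (f s) = LinearMap.rTensor _ f (c.toFun s)) (z : M ⊗[A] PoleForms k I N) :
    c'.ext (LinearMap.rTensor _ f z) = LinearMap.rTensor _ f (c.ext z) := by
  have e : wedgeHom (toPole ∘ₗ (0 : M →ₗ[A] M ⊗[A] PoleOne k I N)) z = 0 := by
    induction z with
    | zero => simp
    | add x y hx hy => rw [map_add, hx, hy, add_zero]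
    | tmul s u => simp
  have := c.ext_rTensor_add c' (f := f) (g := f) (B := 0) (fun s => by simp [h]) z
  rwa [e, map_zero, add_zero] at this

lemma Conn.dHom_toPole (c : Conn I N M) (B : M →ₗ[A] M ⊗[A] PoleOne k I N) (s : M) :
    c.dHom (toPole ∘ₗ B) s =
      c.ext (toPole (B s)) + wedgeHom (toPole ∘ₗ B) (toPole (c.toFun s)) := by
  have : involM ∘ₗ toPole ∘ₗ B = -(toPole ∘ₗ B) := by
    ext t; simp [involM_toPole]
  change c.ext (toPole (B s)) - wedgeHom (involM ∘ₗ toPole ∘ₗ B) (toPole (c.toFun s)) = _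
  rw [this, wedgeHom_neg, sub_neg_eq_add]

/-- The curvature of `∇ + ε B`: its value on `f s` is `g` applied to `(∇_End B) s`, if `g` is
horizontal and `∇ ∘ f = f ∘ ∇ + g ∘ B`. -/
lemma Conn.ext_toPole_eq (c : Conn I N M) (c' : Conn I N M') (hc : c.IsIntegrable)
    {f g : M →ₗ[A] M'} {B : M →ₗ[A] M ⊗[A] PoleOne k I N}
    (h : ∀ s, c'.toFun (f s) = LinearMap.rTensor _ f (c.toFun s) + LinearMap.rTensor _ g (B s))
    (hg : ∀ s, c'.toFun (g s) = LinearMap.rTensor _ g (c.toFun s)) (s : M) :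
    c'.ext (toPole (c'.toFun (f s))) = LinearMap.rTensor _ g (c.dHom (toPole ∘ₗ B) s) := by
  rw [h, map_add, map_add, toPole_rTensor, toPole_rTensor, c.ext_rTensor_add c' h,
    c.ext_rTensor_of_horizontal c' hg, hc, c.dHom_toPole, map_add, map_zero, zero_add, add_comm]

/-- The maps `ι : M → T`, `π : T → M`, `σ : M → T` and `ρ : T → M` present `T` as the direct sum
`σ M ⊕ ι M` of two copies of `M`, with projections `π` and `ρ`. -/
structure IsSplit {T : Type*} [AddCommGroup T] [Module A T] (ι : M →ₗ[A] T) (π : T →ₗ[A] M)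
    (σ : M →ₗ[A] T) (ρ : T →ₗ[A] M) : Prop where
  proj_incl : ∀ s, π (ι s) = 0
  proj_sect : ∀ s, π (σ s) = s
  retr_incl : ∀ s, ρ (ι s) = s
  retr_sect : ∀ s, ρ (σ s) = 0
  sum : ∀ t, σ (π t) + ι (ρ t) = t

namespace IsSplit
variable {T : Type*} [AddCommGroup T] [Module A T] {ι : M →ₗ[A] T} {π : T →ₗ[A] M}
  {σ σ' : M →ₗ[A] T} {ρ ρ' : T →ₗ[A] M}

section
variable (h : IsSplit ι π σ ρ) {P : Type*} [AddCommMonoid P] [Module A P]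
include h

lemma rTensor_proj_sect (z : M ⊗[A] P) : LinearMap.rTensor P π (LinearMap.rTensor P σ z) = z := by
  have : π ∘ₗ σ = LinearMap.id := by ext s; simp [h.proj_sect]
  rw [← LinearMap.comp_apply, ← LinearMap.rTensor_comp, this]; simp

lemma rTensor_proj_incl (z : M ⊗[A] P) : LinearMap.rTensor P π (LinearMap.rTensor P ι z) = 0 := by
  have : π ∘ₗ ι = 0 := by ext s; simp [h.proj_incl]
  rw [← LinearMap.comp_apply, ← LinearMap.rTensor_comp, this]; simp

lemma rTensor_retr_incl (z : M ⊗[A] P) : LinearMap.rTensor P ρ (LinearMap.rTensor P ι z) = z := by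
  have : ρ ∘ₗ ι = LinearMap.id := by ext s; simp [h.retr_incl]
  rw [← LinearMap.comp_apply, ← LinearMap.rTensor_comp, this]; simp

lemma rTensor_sum (z : T ⊗[A] P) : LinearMap.rTensor P σ (LinearMap.rTensor P π z) +
    LinearMap.rTensor P ι (LinearMap.rTensor P ρ z) = z := by
  have : σ ∘ₗ π + ι ∘ₗ ρ = LinearMap.id := by ext t; simp [h.sum]
  rw [← LinearMap.comp_apply, ← LinearMap.comp_apply, ← LinearMap.rTensor_comp,
    ← LinearMap.rTensor_comp, ← LinearMap.add_apply, ← LinearMap.rTensor_add, this]; simp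

lemma rTensor_incl_injective : Function.Injective (LinearMap.rTensor P ι) :=
  Function.LeftInverse.injective h.rTensor_retr_incl

/-- Two sections differ by `ι ∘ (ρ ∘ σ')`. -/
lemma sect_eq_add (hσ' : ∀ s, π (σ' s) = s) (s : M) : σ' s = σ s + ι (ρ (σ' s)) := by
  have := h.sum (σ' s)
  rwa [hσ', eq_comm] at this

end

/-- The second fundamental form of `σ`, the map `B = ρ ∘ ∇ ∘ σ` with `∇ ∘ σ = σ ∘ ∇ + ι ∘ B` if `π`
is horizontal. It is linear as `ρ ∘ σ = 0`. -/
def secondForm (h : IsSplit ι π σ ρ) (c : Conn I N T) : M →ₗ[A] M ⊗[A] PoleOne k I N where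
  toFun s := LinearMap.rTensor _ ρ (c.toFun (σ s))
  map_add' s t := by simp only [map_add]
  map_smul' a s := by simp [c.leibniz, h.retr_sect]

lemma apply_sect (h : IsSplit ι π σ ρ) {c : Conn I N M} {c' : Conn I N T}
    (hπ : ∀ t, c.toFun (π t) = LinearMap.rTensor _ π (c'.toFun t)) (s : M) :
    c'.toFun (σ s) = LinearMap.rTensor _ σ (c.toFun s) +
      LinearMap.rTensor _ ι (h.secondForm c' s) := by
  have := h.rTensor_sum (c'.toFun (σ s))
  rw [← hπ, h.proj_sect] at this
  exact this.symm

/-- The second fundamental forms of two sections which differ by `a` differ by `∇_End a`. -/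
lemma secondForm_sub (h : IsSplit ι π σ ρ) {c : Conn I N M} {c' : Conn I N T} {a : M →ₗ[A] M}
    {B B' : M →ₗ[A] M ⊗[A] PoleOne k I N}
    (hι : ∀ s, c'.toFun (ι s) = LinearMap.rTensor _ ι (c.toFun s))
    (ha : ∀ s, σ' s = σ s + ι (a s))
    (hB : ∀ s, c'.toFun (σ s) = LinearMap.rTensor _ σ (c.toFun s) + LinearMap.rTensor _ ι (B s))
    (hB' : ∀ s, c'.toFun (σ' s) =
      LinearMap.rTensor _ σ' (c.toFun s) + LinearMap.rTensor _ ι (B' s)) :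
    B' - B = c.dEnd a := by
  ext s
  apply h.rTensor_incl_injective
  have e : σ' = σ + ι ∘ₗ a := by ext s; simp [ha]
  have h1 := hB' s
  rw [ha, map_add, hB, hι, e, LinearMap.rTensor_add, LinearMap.add_apply, LinearMap.rTensor_comp,
    LinearMap.comp_apply] at h1
  simp only [LinearMap.sub_apply, map_sub, Conn.dEnd, LinearMap.coe_mk, AddHom.coe_mk]
  rw [sub_eq_sub_iff_add_eq_add]
  rw [← sub_eq_zero] at h1 ⊢
  rw [← neg_eq_zero, ← h1]; abel

/-- The connection on `T` for which `ι` and `π` are horizontal and `σ` has the second fundamental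
form `B`. -/
def conn (h : IsSplit ι π σ ρ) (c : Conn I N M) (B : M →ₗ[A] M ⊗[A] PoleOne k I N) :
    Conn I N T where
  toFun :=
    { toFun := fun t => LinearMap.rTensor _ σ (c.toFun (π t)) +
        LinearMap.rTensor _ ι (B (π t) + c.toFun (ρ t))
      map_zero' := by simp
      map_add' := fun s t => by simp only [map_add]; abel }
  leibniz a t := by
    simp only [AddMonoidHom.coe_mk, ZeroHom.coe_mk, map_smul, c.leibniz, map_add,
      LinearMap.rTensor_tmul, smul_add]
    have e : t ⊗ₜ[A] dPoleOne I N a = σ (π t) ⊗ₜ dPoleOne I N a + ι (ρ t) ⊗ₜ dPoleOne I N a := by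
      rw [← TensorProduct.add_tmul, h.sum]
    rw [e]
    abel

lemma conn_apply (h : IsSplit ι π σ ρ) (c : Conn I N M) (B : M →ₗ[A] M ⊗[A] PoleOne k I N)
    (t : T) : (h.conn c B).toFun t = LinearMap.rTensor _ σ (c.toFun (π t)) +
      LinearMap.rTensor _ ι (B (π t) + c.toFun (ρ t)) := rfl

lemma conn_incl (h : IsSplit ι π σ ρ) (c : Conn I N M) (B : M →ₗ[A] M ⊗[A] PoleOne k I N)
    (s : M) : (h.conn c B).toFun (ι s) = LinearMap.rTensor _ ι (c.toFun s) := by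
  simp [conn_apply, h.proj_incl, h.retr_incl]

lemma conn_proj (h : IsSplit ι π σ ρ) (c : Conn I N M) (B : M →ₗ[A] M ⊗[A] PoleOne k I N)
    (t : T) : c.toFun (π t) = LinearMap.rTensor _ π ((h.conn c B).toFun t) := by
  rw [conn_apply, map_add, h.rTensor_proj_sect, h.rTensor_proj_incl, add_zero]

lemma conn_self_sect (h : IsSplit ι π σ ρ) (c : Conn I N M) (B : M →ₗ[A] M ⊗[A] PoleOne k I N)
    (s : M) : (h.conn c B).toFun (σ s) =
      LinearMap.rTensor _ σ (c.toFun s) + LinearMap.rTensor _ ι (B s) := by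
  simp [conn_apply, h.proj_sect, h.retr_sect]

/-- The connection constructed from `σ` and `B` is also the one constructed from another section
`σ' = σ + ι ∘ a` and `B' = B + ∇_End a`. -/
lemma conn_sect_add (h : IsSplit ι π σ ρ) (c : Conn I N M) {a : M →ₗ[A] M}
    {B B' : M →ₗ[A] M ⊗[A] PoleOne k I N} (ha : ∀ s, σ' s = σ s + ι (a s))
    (hB : B' - B = c.dEnd a) (s : M) : (h.conn c B).toFun (σ' s) =
      LinearMap.rTensor _ σ' (c.toFun s) + LinearMap.rTensor _ ι (B' s) := by
  have e : σ' = σ + ι ∘ₗ a := by ext s; simp [ha]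
  have e' : B' = B + c.dEnd a := by rw [← hB]; abel
  rw [ha, map_add, h.conn_incl, h.conn_apply, h.proj_sect, h.retr_sect, e, e']
  simp only [map_zero, add_zero, LinearMap.add_apply, LinearMap.rTensor_add,
    LinearMap.rTensor_comp, LinearMap.comp_apply, map_add, Conn.dEnd, LinearMap.coe_mk,
    AddHom.coe_mk, map_sub]
  abel

/-- The connection on a split extension does not depend on the section, if the second fundamental
forms change as in `secondForm_sub`. -/
lemma conn_eq (h : IsSplit ι π σ ρ) (h' : IsSplit ι π σ' ρ') (c : Conn I N M) {a : M →ₗ[A] M}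
    {B B' : M →ₗ[A] M ⊗[A] PoleOne k I N} (ha : ∀ s, σ' s = σ s + ι (a s))
    (hB : B' - B = c.dEnd a) (t : T) : (h.conn c B).toFun t = (h'.conn c B').toFun t := by
  rw [← h'.sum t, map_add, map_add, h.conn_incl, h'.conn_incl, h.conn_sect_add c ha hB,
    h'.conn_self_sect]

lemma conn_isIntegrable (h : IsSplit ι π σ ρ) {c : Conn I N M} (hc : c.IsIntegrable)
    {B : M →ₗ[A] M ⊗[A] PoleOne k I N} (hB : c.dHom (toPole ∘ₗ B) = 0) :
    (h.conn c B).IsIntegrable := by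
  intro t
  have h1 := c.ext_toPole_eq (h.conn c B) hc (f := σ) (g := ι) (B := B)
    (h.conn_self_sect c B) (h.conn_incl c B)
  rw [← h.sum t, map_add, map_add, map_add, h1, hB, h.conn_incl, toPole_rTensor,
    c.ext_rTensor_of_horizontal _ (h.conn_incl c B), hc]
  simp

/-- The second fundamental form of a section is closed if the connections are integrable. -/
lemma dHom_eq_zero (h : IsSplit ι π σ ρ) {c : Conn I N M} {c' : Conn I N T}
    (hc : c.IsIntegrable) (hc' : c'.IsIntegrable) {B : M →ₗ[A] M ⊗[A] PoleOne k I N}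
    (hB : ∀ s, c'.toFun (σ s) = LinearMap.rTensor _ σ (c.toFun s) + LinearMap.rTensor _ ι (B s))
    (hι : ∀ s, c'.toFun (ι s) = LinearMap.rTensor _ ι (c.toFun s)) :
    c.dHom (toPole ∘ₗ B) = 0 := by
  ext s
  apply h.rTensor_incl_injective
  rw [← c.ext_toPole_eq c' hc hB hι, hc']
  simp

variable {T' : Type*} [AddCommGroup T'] [Module A T']

/-- The homomorphism with given restrictions `σ'` and `ι'` to the two summands. -/
def desc (_ : IsSplit ι π σ ρ) (ι' σ' : M →ₗ[A] T') : T →ₗ[A] T' := σ' ∘ₗ π + ι' ∘ₗ ρ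

section desc
variable (h : IsSplit ι π σ ρ) (ι' σ' : M →ₗ[A] T')

@[simp] lemma desc_sect (s : M) : h.desc ι' σ' (σ s) = σ' s := by
  simp [desc, h.proj_sect, h.retr_sect]

@[simp] lemma desc_incl (s : M) : h.desc ι' σ' (ι s) = ι' s := by
  simp [desc, h.proj_incl, h.retr_incl]

include h in
lemma hom_ext {f g : T →ₗ[A] T'} (h1 : ∀ s, f (σ s) = g (σ s)) (h2 : ∀ s, f (ι s) = g (ι s)) :
    f = g := by
  ext t
  rw [← h.sum t, map_add, map_add, h1, h2]

/-- The homomorphism of split extensions which maps one section to another is horizontal if the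
sections have the same second fundamental form. -/
lemma conn_desc {c : Conn I N M} {d : Conn I N T} {d' : Conn I N T'}
    {B : M →ₗ[A] M ⊗[A] PoleOne k I N} {ι' σ' : M →ₗ[A] T'}
    (hι : ∀ s, d.toFun (ι s) = LinearMap.rTensor _ ι (c.toFun s))
    (hι' : ∀ s, d'.toFun (ι' s) = LinearMap.rTensor _ ι' (c.toFun s))
    (hσ : ∀ s, d.toFun (σ s) = LinearMap.rTensor _ σ (c.toFun s) + LinearMap.rTensor _ ι (B s))
    (hσ' : ∀ s, d'.toFun (σ' s) =
      LinearMap.rTensor _ σ' (c.toFun s) + LinearMap.rTensor _ ι' (B s)) (t : T) :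
    d'.toFun (h.desc ι' σ' t) = LinearMap.rTensor _ (h.desc ι' σ') (d.toFun t) := by
  have e1 : h.desc ι' σ' ∘ₗ σ = σ' := LinearMap.ext (h.desc_sect ι' σ')
  have e2 : h.desc ι' σ' ∘ₗ ι = ι' := LinearMap.ext (h.desc_incl ι' σ')
  rw [← h.sum t]
  simp only [map_add, desc_sect, desc_incl, hσ, hσ', hι, hι']
  simp only [← LinearMap.rTensor_comp_apply, e1, e2]

end desc

end IsSplit

end LocalForms

/-! ### Sections and homomorphisms of sheaves of modules -/

namespace KSpace

variable {k : Type v} [Field k] {S : KSpace.{u} k}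

namespace OMod
variable {M N : S.OMod}

lemma sec_ext {U : S.Op} {s t : M.sec U}
    (h : ∀ (y : S.Pt) (hy : y ∈ U), germ y hy s = germ y hy t) : s = t :=
  TopCat.Presheaf.section_ext (⟨M.ab, M.isSheaf⟩ : TopCat.Sheaf Ab.{u} S.space.toTopCat) U s t h

/-- Sections with equal germs at a point agree in a neighbourhood. -/
lemma exists_res_eq {U : S.Op} {x : S.Pt} (hx : x ∈ U) {s t : M.sec U}
    (h : germ x hx s = germ x hx t) : ∃ (V : S.Op) (hV : V ≤ U), x ∈ V ∧ res hV s = res hV t := by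
  obtain ⟨V, hV, i, j, e⟩ := TopCat.Presheaf.germ_eq M.ab x hx hx s t h
  exact ⟨V, i.le, hV, e⟩

/-- As `M` is a sheaf, the sections of `M.sheaf` come from sections of `M`. -/
lemma exists_sec_of_mem {U : S.Op} {f : ∀ y : U, M.st y} (hf : f ∈ M.sheaf.sec U) :
    ∃ s : M.sec U, ∀ y : U, f y = germ (y : S.Pt) y.2 s := by
  have loc : ∀ x : U, ∃ (V : S.Op) (h : V ≤ U) (s : M.sec V), (x : S.Pt) ∈ V ∧
      ∀ y : V, f ⟨y, h y.2⟩ = germ (y : S.Pt) y.2 s := by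
    intro x
    obtain ⟨V, hV, hx, h1⟩ := hf x
    -- The generators of `M.sheaf` already form a subgroup.
    have key : ∀ g : (∀ y : V, M.st y), g ∈ AddSubgroup.closure
        {f : ∀ y : V, M.st y | ∃ s : M.sec V, ∀ y : V, f y = germ (y : S.Pt) y.2 s} →
        ∃ s : M.sec V, ∀ y : V, g y = germ (y : S.Pt) y.2 s := by
      intro g hg
      induction hg using AddSubgroup.closure_induction with
      | zero => exact ⟨0, fun y => by simp⟩
      | add a b _ _ ha hb =>
        obtain ⟨s, hs⟩ := ha
        obtain ⟨t, ht⟩ := hb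
        exact ⟨s + t, fun y => by simp [hs, ht]⟩
      | neg a _ ha =>
        obtain ⟨s, hs⟩ := ha
        exact ⟨-s, fun y => by simp [hs]⟩
      | mem a ha => exact ha
    obtain ⟨s, hs⟩ := key _ h1
    exact ⟨V, hV, s, hx, hs⟩
  choose V hV s hx hs using loc
  obtain ⟨t, ht⟩ : ∃ t : M.sec U, ∀ x, res (hV x) t = s x := by
    obtain ⟨t, ht, -⟩ := TopCat.Sheaf.existsUnique_gluing'
      (⟨M.ab, M.isSheaf⟩ : TopCat.Sheaf Ab.{u} S.space.toTopCat) V U (fun x => homOfLE (hV x))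
      (fun y hy => Opens.mem_iSup.2 ⟨⟨y, hy⟩, hx ⟨y, hy⟩⟩) s (by
        intro i j
        refine sec_ext (M := M) fun y hy => ?_
        have h1 := germ_res (inf_le_left : V i ⊓ V j ≤ V i) y hy (s i)
        have h2 := germ_res (inf_le_right : V i ⊓ V j ≤ V j) y hy (s j)
        exact h1.trans (((hs i ⟨y, hy.1⟩).symm.trans (hs j ⟨y, hy.2⟩)).trans h2.symm))
    exact ⟨t, fun x => ht x⟩
  refine ⟨t, fun y => ?_⟩
  rw [← germ_res (hV y) _ (hx y), ht y, ← hs y ⟨y, hx y⟩]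

/-- A section of a sheaf of modules which vanishes at a point vanishes in a neighbourhood. -/
lemma exists_eq_zero {U : S.Op} {f : ∀ y : U, M.st y} (hf : f ∈ M.sheaf.sec U) (x : U)
    (h : f x = 0) : ∃ (V : S.Op) (hV : V ≤ U), (x : S.Pt) ∈ V ∧ ∀ y : V, f ⟨y, hV y.2⟩ = 0 := by
  obtain ⟨s, hs⟩ := exists_sec_of_mem hf
  obtain ⟨V, hV, hx, e⟩ := exists_res_eq (s := s) (t := 0) x.2 (by rw [← hs, h, map_zero])
  refine ⟨V, hV, hx, fun y => ?_⟩
  rw [hs, ← germ_res hV _ y.2, e, map_zero, map_zero]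

section hom
variable {F : S.Pt → Type*} [∀ x, AddCommGroup (F x)] [∀ x, Module (S.st x) (F x)]
  {T : S.FnSheaf F} {U : S.Op}

lemma comp_mem {Φ : ∀ y : U, M.st y →ₗ[S.st y] N.st y} {Ψ : ∀ y : U, N.st y →ₗ[S.st y] F y}
    (hΨ : Ψ ∈ (N.homSheaf T).sec U) (hΦ : Φ ∈ (M.homSheaf N.sheaf).sec U) :
    (fun y => Ψ y ∘ₗ Φ y) ∈ (M.homSheaf T).sec U := fun V hV s =>
  N.homSheaf_apply T _ ((N.homSheaf T).res hV Ψ hΨ) _ (hΦ V hV s)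

lemma stMap_mem (f : M ⟶ N) (U : S.Op) :
    (fun y : U => stMap f (y : S.Pt)) ∈ (M.homSheaf N.sheaf).sec U := by
  intro V _ s
  simp only [stMap_germ]
  exact N.germ_mem V _

lemma rTensor_mem {D : S.Divisor} {Φ : ∀ y : U, M.st y →ₗ[S.st y] N.st y}
    (hΦ : Φ ∈ (M.homSheaf N.sheaf).sec U) {z : ∀ y : U, M.st y ⊗[S.st y] FormsOne D y}
    (hz : z ∈ (tensorOne D M).sec U) :
    (fun y : U => LinearMap.rTensor (FormsOne D y) (Φ y) (z y)) ∈ (tensorOne D N).sec U := by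
  refine tensorOne_map (tensorOne D N) (fun y : U =>
    (LinearMap.rTensor (FormsOne D y) (Φ y)).toAddMonoidHom) ?_ hz
  intro W hW t h f b e hb
  have h2 := hΦ W hW t
  refine FnSheaf.gen_map (F := N.st) (tensorOne D N) (fun y : W =>
    ((TensorProduct.mk (S.st y) (N.st y) (FormsOne D y)).flip ((b y) ⊗ₜ[S.st y]
      (LocalForms.dOne (S.nullForms y) (S.germ (y : S.Pt) y.2 f)))).toAddMonoidHom) ?_ _ h2
  rintro W' hW' g' ⟨t', ht'⟩
  have := tensorOne_mem t' (S.res hW' h) (S.res hW' f) (fun y => b ⟨y, hW' y.2⟩)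
    (fun y => by rw [S.germ_res]; exact e ⟨y, hW' y.2⟩)
    (fun y => by rw [S.germ_res]; exact hb ⟨y, hW' y.2⟩)
  simp only [S.germ_res] at this
  simp only [ht']
  exact this

end hom

lemma hom_ext_st {f g : M ⟶ N} (h : ∀ x, stMap f x = stMap g x) : f = g := by
  apply SheafOfModules.hom_ext
  ext U s
  refine sec_ext (M := N) (U := U.unop) (s := app f U.unop s) (t := app g U.unop s)
    fun y hy => ?_
  have h1 : stMap f y (germ y hy s) = stMap g y (germ y hy s) := by rw [h]
  exact (stMap_germ f y hy s).symm.trans (h1.trans (stMap_germ g y hy s))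

section homOfStalks
variable (Φ : ∀ y : S.Pt, M.st y →ₗ[S.st y] N.st y)
  (hΦ : (fun y : (⊤ : S.Op) => Φ y) ∈ (M.homSheaf N.sheaf).sec ⊤)
include hΦ in
lemma exists_section (U : S.Op) (s : M.sec U) :
    ∃ t : N.sec U, ∀ y : U, Φ y (germ (y : S.Pt) y.2 s) = germ (y : S.Pt) y.2 t :=
  exists_sec_of_mem (hΦ U le_top s)

/-- The action on sections of homomorphisms of stalks which map sections to sections. -/
def secOfStalks (U : S.Op) : M.sec U →ₗ[S.O U] N.sec U where
  toFun s := (exists_section Φ hΦ U s).choose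
  map_add' s t := sec_ext fun y hy => by
    have h := fun s => (exists_section Φ hΦ U s).choose_spec ⟨y, hy⟩
    rw [map_add, ← h, ← h, ← h, map_add, map_add]
  map_smul' r s := sec_ext fun y hy => by
    have h := fun s => (exists_section Φ hΦ U s).choose_spec ⟨y, hy⟩
    rw [RingHom.id_apply, germ_smul, ← h, ← h, germ_smul, map_smul]

lemma germ_secOfStalks {U : S.Op} (s : M.sec U) (y : S.Pt) (hy : y ∈ U) :
    germ y hy (secOfStalks Φ hΦ U s) = Φ y (germ y hy s) :=
  ((exists_section Φ hΦ U s).choose_spec ⟨y, hy⟩).symm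

lemma secOfStalks_res {U V : S.Op} (h : V ≤ U) (s : M.sec U) :
    secOfStalks Φ hΦ V (res h s) = res h (secOfStalks Φ hΦ U s) :=
  sec_ext fun y hy => by
    rw [germ_secOfStalks, germ_res, germ_res, germ_secOfStalks]

/-- The homomorphism of sheaves of modules given by homomorphisms of stalks which map sections to
sections. -/
def homOfStalks : M ⟶ N :=
  ⟨PresheafOfModules.homMk
    { app := fun U => AddCommGrpCat.ofHom (secOfStalks Φ hΦ U.unop).toAddMonoidHom
      naturality := by
        intro U V f
        ext s
        exact secOfStalks_res Φ hΦ f.unop.le s }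
    (fun U r s => (secOfStalks Φ hΦ U.unop).map_smul r s)⟩

lemma stMap_homOfStalks (y : S.Pt) : stMap (homOfStalks Φ hΦ) y = Φ y := by
  ext t
  obtain ⟨U, hy, s, rfl⟩ := exists_germ y t
  rw [stMap_germ]
  exact germ_secOfStalks Φ hΦ s y hy

end homOfStalks

end OMod

/-! ### The sheaf of modules of a sheaf of functions -/

namespace FnSheaf
variable {F : S.Pt → Type u} [∀ x, AddCommGroup (F x)] [∀ x, Module (S.st x) (F x)]
  (G : S.FnSheaf F)

instance (U : S.Op) : Module (S.O U) (G.sec U) where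
  smul r f := ⟨fun y : U => S.germ (y : S.Pt) y.2 r • f.1 y, G.smul U r f.1 f.2⟩
  one_smul f := Subtype.ext (funext fun y => by
    change S.germ (y : S.Pt) y.2 1 • f.1 y = _; rw [map_one, one_smul])
  mul_smul r r' f := Subtype.ext (funext fun y => by
    change S.germ (y : S.Pt) y.2 (r * r') • f.1 y = _; rw [map_mul, mul_smul]; rfl)
  smul_zero r := Subtype.ext (funext fun y => smul_zero _)
  smul_add r f g := Subtype.ext (funext fun y => smul_add _ _ _)
  add_smul r r' f := Subtype.ext (funext fun y => by
    change S.germ (y : S.Pt) y.2 (r + r') • f.1 y = _; rw [map_add, add_smul]; rfl)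
  zero_smul f := Subtype.ext (funext fun y => by
    change S.germ (y : S.Pt) y.2 0 • f.1 y = _; rw [map_zero, zero_smul]; rfl)

/-- The underlying presheaf of abelian groups. -/
def presheafAb : TopCat.Presheaf Ab.{u} S.space.toTopCat where
  obj U := AddCommGrpCat.of (G.sec U.unop)
  map f := AddCommGrpCat.ofHom
    { toFun := fun s => ⟨restr f.unop.le s.1, G.res f.unop.le s.1 s.2⟩
      map_zero' := rfl
      map_add' := fun _ _ => rfl }
  map_id _ := rfl
  map_comp _ _ := rfl

lemma presheafAb_isSheaf : G.presheafAb.IsSheaf := by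
  rw [TopCat.Presheaf.isSheaf_iff_isSheafUniqueGluing]
  intro ι U sf hsf
  have hcompat : ∀ (i j : ι) (y : S.Pt) (hi : y ∈ U i) (hj : y ∈ U j),
      (sf i).1 ⟨y, hi⟩ = (sf j).1 ⟨y, hj⟩ := fun i j y hi hj =>
    congrFun (congrArg Subtype.val (hsf i j)) ⟨y, hi, hj⟩
  choose i hi using fun y : (iSup U : S.Op) => Opens.mem_iSup.1 y.2
  refine ⟨⟨fun y => (sf (i y)).1 ⟨y, hi y⟩, ?_⟩, ?_, ?_⟩
  · refine G.glue _ _ fun x => ⟨U (i x), le_iSup U (i x), hi x, ?_⟩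
    convert (sf (i x)).2 using 1
    ext y
    exact hcompat _ _ _ _ _
  · intro j
    apply Subtype.ext
    ext y
    exact hcompat _ _ _ _ _
  · intro t ht
    apply Subtype.ext
    ext y
    exact congrFun (congrArg Subtype.val (ht (i y))) ⟨y, hi y⟩

instance (U : (Opens S.space.toTopCat)ᵒᵖ) :
    Module (((sheafCompose (Opens.grothendieckTopology S.space.toTopCat)
      (forget₂ CommRingCat.{u} RingCat.{u})).obj S.space.sheaf).obj.obj U) (G.presheafAb.obj U) :=
  inferInstanceAs (Module (S.O U.unop) (G.sec U.unop))

/-- The sheaf of modules with the sections of `G`. -/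
def toOMod : S.OMod :=
  ⟨PresheafOfModules.ofPresheaf G.presheafAb (by
    intro U V f r s
    apply Subtype.ext
    ext y
    exact congrArg (· • _) (S.germ_res f.unop.le y y.2 r).symm), G.presheafAb_isSheaf⟩

/-- A section of `G` as a section of the associated sheaf of modules. -/
def toSec {U : S.Op} (f : ∀ y : U, F y) (hf : f ∈ G.sec U) : G.toOMod.sec U := ⟨f, hf⟩

/-- The value of a section at a point. -/
def val {U : S.Op} (s : G.toOMod.sec U) : ∀ y : U, F y :=
  Subtype.val (show G.sec U from s)

lemma val_mem {U : S.Op} (s : G.toOMod.sec U) : G.val s ∈ G.sec U :=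
  Subtype.property (show G.sec U from s)

lemma val_congr {U : S.Op} {x : S.Pt} (hx : x ∈ U) {V : S.Op} (hx' : x ∈ V)
    {s : G.toOMod.sec U} {t : G.toOMod.sec V} (h : OMod.germ x hx s = OMod.germ x hx' t) :
    G.val s ⟨x, hx⟩ = G.val t ⟨x, hx'⟩ := by
  obtain ⟨W, hW, i, j, e⟩ := TopCat.Presheaf.germ_eq G.toOMod.ab x hx hx' s t h
  exact congrFun (congrArg Subtype.val e) ⟨x, hW⟩

/-- The value at a point of a germ of sections, computed on a representative. -/
def evFun (x : S.Pt) (t : G.toOMod.st x) : F x :=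
  G.val (OMod.exists_germ x t).choose_spec.choose_spec.choose
    ⟨x, (OMod.exists_germ x t).choose_spec.choose⟩

lemma evFun_germ {U : S.Op} (x : S.Pt) (hx : x ∈ U) (s : G.toOMod.sec U) :
    G.evFun x (OMod.germ x hx s) = G.val s ⟨x, hx⟩ :=
  G.val_congr _ _ (OMod.exists_germ x (OMod.germ x hx s)).choose_spec.choose_spec.choose_spec

/-- The map from the stalk of the sheaf of modules to the fibre. -/
def ev (x : S.Pt) : G.toOMod.st x →ₗ[S.st x] F x where
  toFun := G.evFun x
  map_add' := by
    intro a b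
    obtain ⟨U, hU, a, rfl⟩ := OMod.exists_germ x a
    obtain ⟨V, hV, b, rfl⟩ := OMod.exists_germ x b
    have hx : x ∈ U ⊓ V := ⟨hU, hV⟩
    rw [← OMod.germ_res (inf_le_left : U ⊓ V ≤ U) x hx,
      ← OMod.germ_res (inf_le_right : U ⊓ V ≤ V) x hx, ← map_add, evFun_germ, evFun_germ,
      evFun_germ]
    rfl
  map_smul' := by
    intro r a
    obtain ⟨U, hU, r, a, rfl, rfl⟩ := OMod.exists_germ₂ x r a
    rw [← OMod.germ_smul, evFun_germ, evFun_germ]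
    rfl

lemma ev_germ {U : S.Op} (x : S.Pt) (hx : x ∈ U) (s : G.toOMod.sec U) :
    G.ev x (OMod.germ x hx s) = G.val s ⟨x, hx⟩ := G.evFun_germ x hx s

lemma val_toSec {U : S.Op} (f : ∀ y : U, F y) (hf : f ∈ G.sec U) : G.val (G.toSec f hf) = f := rfl

end FnSheaf
end KSpace

/-! ### Local splittings of a deformation -/

namespace KSpace
open LocalForms

variable {k : Type v} [Field k] {S : KSpace.{u} k}

lemma exists_germ_fin (x : S.Pt) {n : ℕ} (r : Fin n → S.st x) :
    ∃ (U : S.Op) (hx : x ∈ U) (f : Fin n → S.O U), ∀ i, S.germ x hx (f i) = r i := by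
  induction n with
  | zero => exact ⟨⊤, trivial, Fin.elim0, fun i => i.elim0⟩
  | succ n ih =>
    obtain ⟨U, hU, f, hf⟩ := ih (fun i => r i.succ)
    obtain ⟨V, hV, g, hg⟩ := S.exists_germ x (r 0)
    have hx : x ∈ U ⊓ V := ⟨hU, hV⟩
    refine ⟨U ⊓ V, hx, Fin.cons (S.res inf_le_right g) fun i => S.res inf_le_left (f i), ?_⟩
    intro i
    refine Fin.cases ?_ (fun i => ?_) i
    · rw [Fin.cons_zero, S.germ_res, hg]
    · rw [Fin.cons_succ, S.germ_res, hf]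

lemma OMod.exists_germ_fin {M : S.OMod} (x : S.Pt) {n : ℕ} (r : Fin n → M.st x) :
    ∃ (U : S.Op) (hx : x ∈ U) (f : Fin n → M.sec U), ∀ i, OMod.germ x hx (f i) = r i := by
  induction n with
  | zero => exact ⟨⊤, trivial, Fin.elim0, fun i => i.elim0⟩
  | succ n ih =>
    obtain ⟨U, hU, f, hf⟩ := ih (fun i => r i.succ)
    obtain ⟨V, hV, g, hg⟩ := OMod.exists_germ x (r 0)
    have hx : x ∈ U ⊓ V := ⟨hU, hV⟩
    refine ⟨U ⊓ V, hx, Fin.cons (OMod.res inf_le_right g)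
      fun i => OMod.res inf_le_left (f i), ?_⟩
    intro i
    refine Fin.cases ?_ (fun i => ?_) i
    · rw [Fin.cons_zero, OMod.germ_res, hg]
    · rw [Fin.cons_succ, OMod.germ_res, hf]

lemma OMod.germ_sum_smul {M : S.OMod} {U V : S.Op} (h : V ≤ U) (y : S.Pt) (hy : y ∈ V) {n : ℕ}
    (a : Fin n → S.O V) (e : Fin n → M.sec U) :
    OMod.germ y hy (∑ i, a i • OMod.res h (e i)) =
      ∑ i, S.germ y hy (a i) • OMod.germ y (h hy) (e i) := by
  rw [map_sum]
  exact Finset.sum_congr rfl fun i _ => by rw [OMod.germ_smul, OMod.germ_res]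

section frame
variable {E : S.OMod} {U : S.Op} {n : ℕ} {e : Fin n → E.sec U}

/-- The germs of a local frame form a basis of the stalk. -/
def frameBasis
    (he : ∀ (V : S.Op) (h : V ≤ U) (s : E.sec V), ∃! a : Fin n → S.O V,
      s = ∑ i, a i • OMod.res h (e i)) (y : S.Pt) (hy : y ∈ U) :
    Module.Basis (Fin n) (S.st y) (E.st y) :=
  Module.Basis.mk (v := fun i => OMod.germ y hy (e i))
    (by
      rw [Fintype.linearIndependent_iff]
      intro r hr
      obtain ⟨V, hV, a, ha⟩ := exists_germ_fin y r
      have hVU : y ∈ V ⊓ U := ⟨hV, hy⟩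
      have h0 : OMod.germ y hVU (∑ i, S.res (inf_le_left : V ⊓ U ≤ V) (a i) •
          OMod.res (inf_le_right : V ⊓ U ≤ U) (e i)) = OMod.germ y hVU 0 := by
        rw [OMod.germ_sum_smul, map_zero, ← hr]
        exact Finset.sum_congr rfl fun i _ => by rw [S.germ_res, ha]
      obtain ⟨W, hW, hyW, h1⟩ := OMod.exists_res_eq hVU h0
      have h2 : (0 : E.sec W) = ∑ i, S.res (hW.trans inf_le_left) (a i) •
          OMod.res (hW.trans inf_le_right) (e i) := by
        rw [map_zero] at h1
        rw [← h1]
        refine OMod.sec_ext fun y hy => ?_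
        rw [OMod.germ_res, OMod.germ_sum_smul, OMod.germ_sum_smul]
        exact Finset.sum_congr rfl fun i _ => by rw [S.germ_res, S.germ_res]
      have h3 := (he W (hW.trans inf_le_right) 0).unique h2 (y₂ := 0) (by simp)
      intro i
      rw [← ha, ← S.germ_res (hW.trans inf_le_left) y hyW, congrFun h3 i, Pi.zero_apply, map_zero])
    (by
      rintro t -
      obtain ⟨V, hV, s, rfl⟩ := OMod.exists_germ y t
      have hVU : y ∈ V ⊓ U := ⟨hV, hy⟩
      obtain ⟨a, ha, -⟩ := he (V ⊓ U) inf_le_right (OMod.res inf_le_left s)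
      rw [← OMod.germ_res (inf_le_left : V ⊓ U ≤ V) y hVU, ha, OMod.germ_sum_smul]
      exact Submodule.sum_mem _ fun i _ => Submodule.smul_mem _ _
        (Submodule.subset_span ⟨i, rfl⟩))

lemma frameBasis_apply (he) (y : S.Pt) (hy : y ∈ U) (i : Fin n) :
    frameBasis (e := e) he y hy i = OMod.germ y hy (e i) := by
  simp [frameBasis]

end frame

/-- A homomorphism of sheaves of modules which is surjective on stalks has local sections if its
target is a vector bundle. -/
lemma exists_local_section {E T : S.OMod} (hE : IsVectorBundle E) (p : T ⟶ E)
    (hp : ∀ x, Function.Surjective (OMod.stMap p x)) (x : S.Pt) :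
    ∃ (U : S.Op) (_ : x ∈ U) (σ : ∀ y : U, E.st y →ₗ[S.st y] T.st y),
      σ ∈ (E.homSheaf T.sheaf).sec U ∧ ∀ (y : U) (s : E.st y), OMod.stMap p y (σ y s) = s := by
  obtain ⟨U, hx, n, e, he⟩ := hE x
  -- Lifts `f i` of the germs at `x` of a frame are lifts of the frame on a smaller neighbourhood.
  choose t ht using fun i => hp x (OMod.germ x hx (e i))
  obtain ⟨V, hxV, f, hf⟩ := OMod.exists_germ_fin x t
  have loc : ∀ i, ∃ (W : S.Op) (_ : W ≤ V ⊓ U), x ∈ W ∧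
      ∀ (y : S.Pt) (hy : y ∈ V ⊓ U), y ∈ W →
        OMod.stMap p y (OMod.germ y hy.1 (f i)) = OMod.germ y hy.2 (e i) := by
    intro i
    have hVU : x ∈ V ⊓ U := ⟨hxV, hx⟩
    obtain ⟨W, hW, hxW, h⟩ := OMod.exists_res_eq hVU
      (s := OMod.app p (V ⊓ U) (OMod.res inf_le_left (f i))) (t := OMod.res inf_le_right (e i))
      (by rw [← OMod.stMap_germ, OMod.germ_res, OMod.germ_res, hf, ht])
    refine ⟨W, hW, hxW, fun y hy hyW => ?_⟩
    have := congrArg (OMod.germ y hyW) h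
    rwa [OMod.germ_res, OMod.germ_res, ← OMod.stMap_germ, OMod.germ_res, OMod.germ_res] at this
  choose W hW hxW hWe using loc
  have hWx : x ∈ (V ⊓ U) ⊓ Finset.univ.inf W := by
    refine ⟨⟨hxV, hx⟩, ?_⟩
    rw [Opens.coe_finset_inf]
    simpa using hxW
  have hmem : ∀ (y : S.Pt), y ∈ (V ⊓ U) ⊓ Finset.univ.inf W → ∀ i, y ∈ W i := fun y hy i =>
    (Finset.inf_le (Finset.mem_univ i) : Finset.univ.inf W ≤ W i) hy.2
  refine ⟨(V ⊓ U) ⊓ Finset.univ.inf W, hWx, fun y => (frameBasis he y y.2.1.2).constr (S.st y)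
    fun i => OMod.germ (y : S.Pt) y.2.1.1 (f i), ?_, fun y s => ?_⟩
  · intro Y hY s
    obtain ⟨a, rfl, -⟩ := he Y (fun y hy => (hY hy).1.2) s
    convert T.germ_mem Y (∑ i, a i • OMod.res (fun y hy => (hY hy).1.1) (f i)) using 2 with y
    rw [OMod.germ_sum_smul, OMod.germ_sum_smul, map_sum]
    refine Finset.sum_congr rfl fun i _ => ?_
    rw [map_smul, ← frameBasis_apply he, Module.Basis.constr_basis]
  · have : OMod.stMap p y ∘ₗ (frameBasis he y y.2.1.2).constr (S.st y)
        (fun i => OMod.germ (y : S.Pt) y.2.1.1 (f i)) = LinearMap.id := by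
      refine (frameBasis he y y.2.1.2).ext fun i => ?_
      rw [LinearMap.comp_apply, Module.Basis.constr_basis, frameBasis_apply]
      exact hWe i y y.2.1 (hmem y y.2 i)
    exact LinearMap.congr_fun this s

namespace Deformation
variable {D : S.Divisor} {E : S.OMod} {c : Connection D E} (P : Deformation c)

lemma eps_eps_st (y : S.Pt) (t : P.tot.st y) :
    OMod.stMap P.eps y (OMod.stMap P.eps y t) = 0 := by
  rw [← LinearMap.comp_apply, ← OMod.stMap_comp, P.eps_eps]
  obtain ⟨U, hy, s, rfl⟩ := OMod.exists_germ y t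
  rw [OMod.stMap_germ]
  exact map_zero (OMod.germ (M := P.tot) y hy)

lemma proj_eq_zero_iff (y : S.Pt) (t : P.tot.st y) :
    OMod.stMap P.proj y t = 0 ↔ ∃ t', OMod.stMap P.eps y t' = t := by
  rw [← LinearMap.mem_ker, P.proj_ker]; rfl

lemma proj_eps (y : S.Pt) (t : P.tot.st y) :
    OMod.stMap P.proj y (OMod.stMap P.eps y t) = 0 := (P.proj_eq_zero_iff y _).2 ⟨t, rfl⟩

/-- As `tot` is locally free over `𝒪[ε]`, the kernel of `ε` is the image of `ε`. -/
lemma exists_eps_eq (y : S.Pt) (t : P.tot.st y) (h : OMod.stMap P.eps y t = 0) :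
    ∃ t', OMod.stMap P.eps y t' = t := by
  obtain ⟨U, hy, n, e, he⟩ := P.locallyFree y
  obtain ⟨V, hV, s, rfl⟩ := OMod.exists_germ y t
  have hVU : y ∈ V ⊓ U := ⟨hV, hy⟩
  rw [OMod.stMap_germ] at h
  obtain ⟨W, hW, hyW, h1⟩ := OMod.exists_res_eq hVU
    (s := OMod.res inf_le_left (OMod.app P.eps V s)) (t := 0) (by rw [OMod.germ_res, h, map_zero])
  have hε : ∀ (y : S.Pt) (hy : y ∈ W) (t : P.tot.sec W),
      OMod.germ y hy (OMod.app P.eps W t) = OMod.stMap P.eps y (OMod.germ y hy t) :=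
    fun y hy t => (OMod.stMap_germ _ _ _ _).symm
  obtain ⟨p, hp, -⟩ := he W (hW.trans inf_le_right) (OMod.res (hW.trans inf_le_left) s)
  -- As `ε s = 0`, also `∑ p.1 i • ε e i = 0`, and `p.1 = 0` as coordinates over `𝒪[ε]` are unique.
  have h2 : (0 : P.tot.sec W) = ∑ i, (((0 : Fin n → S.O W) i) •
      OMod.res (hW.trans inf_le_right) (e i) +
        p.1 i • OMod.app P.eps W (OMod.res (hW.trans inf_le_right) (e i))) := by
    refine OMod.sec_ext fun x hx => ?_
    have h3 := congrArg (OMod.germ x hx) h1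
    rw [OMod.germ_res, OMod.germ_res, ← OMod.stMap_germ, map_zero, map_zero,
      ← OMod.germ_res (hW.trans inf_le_left) x hx s, hp, map_sum, map_sum] at h3
    rw [map_zero, map_sum, ← h3]
    refine Finset.sum_congr rfl fun i _ => ?_
    simp only [map_add, OMod.germ_smul, map_smul, hε, P.eps_eps_st, Pi.zero_apply,
      zero_smul, smul_zero, add_zero, zero_add]
  have h4 := (he W (hW.trans inf_le_right) 0).unique (y₁ := (0, p.1)) (y₂ := 0) h2 (by simp)
  have h5 : p.1 = 0 := congrArg Prod.snd h4
  refine ⟨OMod.germ y hyW (∑ i, p.2 i • OMod.res (hW.trans inf_le_right) (e i)), ?_⟩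
  rw [← OMod.germ_res (hW.trans inf_le_left) y hyW s, hp, ← hε]
  congr 1
  simp [h5]

/-- The inclusion `E ≅ ε tot ⊆ tot`, on stalks: the map `ι` with `ι ∘ π = ε`. -/
def incl (y : S.Pt) : E.st y →ₗ[S.st y] P.tot.st y :=
  (LinearMap.ker (OMod.stMap P.proj y)).liftQ (OMod.stMap P.eps y) (by
    intro t ht
    obtain ⟨t', rfl⟩ := (P.proj_eq_zero_iff y t).1 ht
    exact P.eps_eps_st y t') ∘ₗ
  ((OMod.stMap P.proj y).quotKerEquivOfSurjective (P.proj_surjective y)).symm.toLinearMap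

lemma incl_proj (y : S.Pt) (t : P.tot.st y) :
    P.incl y (OMod.stMap P.proj y t) = OMod.stMap P.eps y t := by
  have : ((OMod.stMap P.proj y).quotKerEquivOfSurjective (P.proj_surjective y)).symm
      (OMod.stMap P.proj y t) = Submodule.Quotient.mk t := by
    rw [LinearEquiv.symm_apply_eq]; rfl
  simp [incl, this]

lemma proj_incl (y : S.Pt) (s : E.st y) : OMod.stMap P.proj y (P.incl y s) = 0 := by
  obtain ⟨t, rfl⟩ := P.proj_surjective y s
  rw [incl_proj, proj_eps]

lemma incl_injective (y : S.Pt) : Function.Injective (P.incl y) := by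
  rw [injective_iff_map_eq_zero]
  intro s hs
  obtain ⟨t, rfl⟩ := P.proj_surjective y s
  rw [incl_proj] at hs
  obtain ⟨t', rfl⟩ := P.exists_eps_eq y t hs
  exact P.proj_eps y t'

lemma exists_incl_eq (y : S.Pt) (t : P.tot.st y) (h : OMod.stMap P.proj y t = 0) :
    ∃ s, P.incl y s = t := by
  obtain ⟨t', rfl⟩ := (P.proj_eq_zero_iff y t).1 h
  exact ⟨OMod.stMap P.proj y t', P.incl_proj y t'⟩

lemma incl_mem (U : S.Op) :
    (fun y : U => P.incl y) ∈ (E.homSheaf P.tot.sheaf).sec U := by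
  intro V _ s
  refine P.tot.sheaf.glue V _ fun x => ?_
  -- If `t` is a lift of `s` near `x`, then `ι s = ε t` there.
  obtain ⟨t, ht⟩ := P.proj_surjective x (OMod.germ (x : S.Pt) x.2 s)
  obtain ⟨W, hW, t, rfl⟩ := OMod.exists_germ (x : S.Pt) t
  have hWV : (x : S.Pt) ∈ W ⊓ V := ⟨hW, x.2⟩
  obtain ⟨Y, hY, hxY, h⟩ := OMod.exists_res_eq hWV
    (s := OMod.res inf_le_left (OMod.app P.proj W t)) (t := OMod.res inf_le_right s)
    (by rw [OMod.germ_res, OMod.germ_res, ← OMod.stMap_germ, ht])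
  refine ⟨Y, hY.trans inf_le_right, hxY, ?_⟩
  convert P.tot.germ_mem Y (OMod.app P.eps Y (OMod.res (hY.trans inf_le_left) t)) using 2 with y
  have h1 := congrArg (OMod.germ (y : S.Pt) y.2) h
  rw [OMod.germ_res, OMod.germ_res, OMod.germ_res, OMod.germ_res, ← OMod.stMap_germ] at h1
  rw [← OMod.stMap_germ, OMod.germ_res, ← P.incl_proj, h1]
  rfl

section retr
variable {y : S.Pt} (σ : E.st y →ₗ[S.st y] P.tot.st y)
  (hσ : ∀ s, OMod.stMap P.proj y (σ s) = s)

/-- The retraction onto `E ≅ ε tot` with kernel the image of the splitting `σ`. -/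
def retr : P.tot.st y →ₗ[S.st y] E.st y :=
  (LinearEquiv.ofInjective (P.incl y) (P.incl_injective y)).symm.toLinearMap ∘ₗ
    (LinearMap.id - σ ∘ₗ OMod.stMap P.proj y).codRestrict (LinearMap.range (P.incl y))
      fun t => P.exists_incl_eq y _ (by simp [hσ])

lemma incl_retr (t : P.tot.st y) :
    P.incl y (P.retr σ hσ t) = t - σ (OMod.stMap P.proj y t) := by
  have := LinearEquiv.apply_symm_apply (LinearEquiv.ofInjective (P.incl y) (P.incl_injective y))
    ((LinearMap.id - σ ∘ₗ OMod.stMap P.proj y).codRestrict (LinearMap.range (P.incl y))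
      (fun t => P.exists_incl_eq y _ (by simp [hσ])) t)
  exact congrArg Subtype.val this

lemma isSplit : IsSplit (P.incl y) (OMod.stMap P.proj y) σ (P.retr σ hσ) where
  proj_incl := P.proj_incl y
  proj_sect := hσ
  retr_incl s := P.incl_injective y (by rw [incl_retr, proj_incl, map_zero, sub_zero])
  retr_sect s := P.incl_injective y (by rw [incl_retr, hσ, sub_self, map_zero])
  sum t := by rw [incl_retr]; abel

end retr

lemma retr_mem {U : S.Op} (σ : ∀ y : U, E.st y →ₗ[S.st y] P.tot.st y)
    (hσ : ∀ (y : U) s, OMod.stMap P.proj y (σ y s) = s) (hm : σ ∈ (E.homSheaf P.tot.sheaf).sec U) :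
    (fun y : U => P.retr (σ y) (hσ y)) ∈ (P.tot.homSheaf E.sheaf).sec U := by
  intro V hV s
  have h1 : (fun y : V => OMod.germ (y : S.Pt) y.2 s -
      σ ⟨y, hV y.2⟩ (OMod.stMap P.proj y (OMod.germ (y : S.Pt) y.2 s))) ∈ P.tot.sheaf.sec V :=
    sub_mem (P.tot.germ_mem V s) ((OMod.comp_mem hm (OMod.stMap_mem P.proj U)) V hV s)
  obtain ⟨r, hr⟩ := OMod.exists_sec_of_mem h1
  refine E.sheaf.glue V _ fun x => ?_
  -- If `s - σ (π s) = ε t` near `x`, then `ρ s = π t` there.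
  obtain ⟨t, ht⟩ := (P.proj_eq_zero_iff x (OMod.germ (x : S.Pt) x.2 r)).1 (by
    rw [← hr, map_sub, hσ ⟨x, hV x.2⟩, sub_self])
  obtain ⟨W, hW, t, rfl⟩ := OMod.exists_germ (x : S.Pt) t
  have hWV : (x : S.Pt) ∈ W ⊓ V := ⟨hW, x.2⟩
  obtain ⟨Y, hY, hxY, h⟩ := OMod.exists_res_eq hWV
    (s := OMod.res inf_le_left (OMod.app P.eps W t)) (t := OMod.res inf_le_right r)
    (by rw [OMod.germ_res, OMod.germ_res, ← OMod.stMap_germ, ht])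
  refine ⟨Y, hY.trans inf_le_right, hxY, ?_⟩
  convert E.germ_mem Y (OMod.app P.proj Y (OMod.res (hY.trans inf_le_left) t)) using 2 with y
  have h1 := congrArg (OMod.germ (y : S.Pt) y.2) h
  rw [OMod.germ_res, OMod.germ_res, OMod.germ_res, OMod.germ_res, ← OMod.stMap_germ] at h1
  apply P.incl_injective y
  rw [← OMod.stMap_germ, OMod.germ_res, P.incl_proj, h1]
  exact (P.incl_retr _ _ _).trans (hr ⟨y, (hY y.2).2⟩)

/-- As `ε` and `π` are horizontal, so is the map `ι` with `ι ∘ π = ε`. -/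
lemma conn_incl (y : S.Pt) (s : E.st y) : (P.conn.conn y).toFun (P.incl y s) =
    LinearMap.rTensor (FormsOne D y) (P.incl y) ((c.conn y).toFun s) := by
  obtain ⟨t, rfl⟩ := P.proj_surjective y s
  have : P.incl y ∘ₗ OMod.stMap P.proj y = OMod.stMap P.eps y := by
    ext t; exact P.incl_proj y t
  rw [incl_proj, P.eps_horizontal, P.proj_horizontal, ← this, LinearMap.rTensor_comp]
  rfl

end Deformation
end KSpace

/-! ### Hypercohomology classes of cocycles -/

namespace KSpace

variable {k : Type v} [Field k] {S : KSpace.{u} k}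

instance : Nonempty (PointCover S) := ⟨⟨fun _ => ⊤, fun _ => trivial⟩⟩

instance : IsDirectedOrder (PointCover S) where
  directed 𝔘 𝔙 := ⟨⟨fun x => 𝔘.U x ⊓ 𝔙.U x, fun x => ⟨𝔘.mem x, 𝔙.mem x⟩⟩,
    fun _ => inf_le_left, fun _ => inf_le_right⟩

namespace SheafComplex
variable (K : S.SheafComplex) {𝔘 𝔙 : PointCover S}

instance : DirectedSystem K.H1At (K.refineH1 · · ·) where
  map_self 𝔘 z := by
    obtain ⟨z, rfl⟩ := Submodule.mkQ_surjective _ z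
    rfl
  map_map 𝔘 𝔙 𝔚 h h' z := by
    obtain ⟨z, rfl⟩ := Submodule.mkQ_surjective _ z
    rfl

/-- Restriction of cocycles to a refinement. -/
def refineZ1 (h : 𝔘 ≤ 𝔙) : K.Z1 𝔘 →ₗ[k] K.Z1 𝔙 := (K.refinePairs h).restrict (K.refine_Z1 h)

lemma cls_refineZ1 (h : 𝔘 ≤ 𝔙) (z : K.Z1 𝔘) : K.cls 𝔙 (K.refineZ1 h z) = K.cls 𝔘 z := by
  classical
  exact Module.DirectLimit.of_f (f := K.refineH1) (hij := h) (x := K.mkH1 𝔘 z)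

lemma exists_cls_eq (ξ : K.H1) : ∃ (𝔘 : PointCover S) (z : K.Z1 𝔘), K.cls 𝔘 z = ξ := by
  classical
  obtain ⟨𝔘, z, rfl⟩ := Module.DirectLimit.exists_of (f := K.refineH1) ξ
  obtain ⟨z, rfl⟩ := Submodule.mkQ_surjective _ z
  exact ⟨𝔘, z, rfl⟩

lemma mkH1_eq_zero_iff (z : K.Z1 𝔘) : K.mkH1 𝔘 z = 0 ↔ z.1 ∈ K.B1 𝔘 :=
  Submodule.Quotient.mk_eq_zero _

lemma cls_eq_zero_iff (z : K.Z1 𝔘) :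
    K.cls 𝔘 z = 0 ↔ ∃ (𝔙 : PointCover S) (h : 𝔘 ≤ 𝔙), (K.refineZ1 h z).1 ∈ K.B1 𝔙 := by
  classical
  constructor
  · intro h
    obtain ⟨𝔙, h1, h2⟩ := Module.DirectLimit.of.zero_exact (f := K.refineH1)
      (x := K.mkH1 𝔘 z) h
    exact ⟨𝔙, h1, (K.mkH1_eq_zero_iff (K.refineZ1 h1 z)).1 h2⟩
  · rintro ⟨𝔙, h, h1⟩
    rw [← K.cls_refineZ1 h]
    change K.ofCover 𝔙 (K.mkH1 𝔙 _) = 0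
    rw [(K.mkH1_eq_zero_iff _).2 h1, map_zero]

lemma cls_eq_of_sub_mem {z w : K.Z1 𝔘} (h : w.1 - z.1 ∈ K.B1 𝔘) : K.cls 𝔘 z = K.cls 𝔘 w := by
  rw [eq_comm, ← sub_eq_zero, ← map_sub, cls_eq_zero_iff]
  exact ⟨𝔘, le_rfl, h⟩

lemma exists_refine_of_cls_eq {z : K.Z1 𝔘} {w : K.Z1 𝔙} (h : K.cls 𝔘 z = K.cls 𝔙 w) :
    ∃ (𝔚 : PointCover S) (h1 : 𝔘 ≤ 𝔚) (h2 : 𝔙 ≤ 𝔚),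
      (K.refineZ1 h2 w).1 - (K.refineZ1 h1 z).1 ∈ K.B1 𝔚 := by
  obtain ⟨𝔚, h1, h2⟩ := exists_ge_ge 𝔘 𝔙
  rw [← K.cls_refineZ1 h1, ← K.cls_refineZ1 h2, eq_comm, ← sub_eq_zero, ← map_sub,
    cls_eq_zero_iff] at h
  obtain ⟨𝔛, h3, h4⟩ := h
  exact ⟨𝔛, h1.trans h3, h2.trans h3, h4⟩

lemma twoTerm_mem_Z1_iff (z : K.Pairs 𝔘) : z ∈ K.twoTerm.Z1 𝔘 ↔ z ∈ K.Z1 𝔘 :=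
  ⟨fun h => ⟨h.1, fun i => (h.2.1 i).1, h.2.2⟩,
    fun h => ⟨h.1, fun i => ⟨h.2.1 i, fun y => h.2.2.2.2 i y y.2⟩, h.2.2⟩⟩

/-- A complex and its two-term truncation have the same `1`-cocycles and the same
`1`-coboundaries, as `1`-cocycles of the total complex are closed in degree `1`. -/
lemma bijective_H1_twoTermIncl : Function.Bijective (Hom.H1 K.twoTermIncl) := by
  classical
  have key : ∀ (𝔘 : PointCover S) (z : K.twoTerm.Z1 𝔘), Hom.H1 K.twoTermIncl (K.twoTerm.cls 𝔘 z) =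
      K.cls 𝔘 ⟨z.1, (K.twoTerm_mem_Z1_iff z.1).1 z.2⟩ := fun 𝔘 z =>
    Module.DirectLimit.lift_of (f := K.twoTerm.refineH1) _ _ (K.twoTerm.mkH1 𝔘 z)
  constructor
  · rw [injective_iff_map_eq_zero]
    intro ξ hξ
    obtain ⟨𝔘, z, rfl⟩ := K.twoTerm.exists_cls_eq ξ
    rw [key, cls_eq_zero_iff] at hξ
    exact (K.twoTerm.cls_eq_zero_iff z).2 hξ
  · intro ξ
    obtain ⟨𝔘, z, rfl⟩ := K.exists_cls_eq ξ
    exact ⟨K.twoTerm.cls 𝔘 ⟨z.1, (K.twoTerm_mem_Z1_iff z.1).2 z.2⟩, key 𝔘 _⟩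

end SheafComplex
end KSpace

/-! ### Deformations and cocycles -/

namespace KSpace
open LocalForms SheafComplex

variable {k : Type v} [Field k] {S : KSpace.{u} k} {D : S.Divisor} {E : S.OMod}
  {c : Connection D E}

namespace Connection
variable {hc : c.IsIntegrable} {𝔘 : PointCover S}

/-- The component `a_ij` of a cocycle `(a, A)`. -/
def cochainEnd (z : (c.closedForms hc).Z1 𝔘) (i j : S.Pt) (y : 𝔘.inter i j) :
    E.st y →ₗ[S.st y] E.st y := z.1.1 i j y

/-- The component `A_i` of a cocycle `(a, A)`. -/
def cochainForm (z : (c.closedForms hc).Z1 𝔘) (i : S.Pt) (y : 𝔘.U i) :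
    E.st y →ₗ[S.st y] E.st y ⊗[S.st y] FormsOne D y := z.1.2 i y

lemma cochainEnd_mem (z : (c.closedForms hc).Z1 𝔘) (i j : S.Pt) :
    cochainEnd z i j ∈ (E.homSheaf E.sheaf).sec (𝔘.inter i j) := z.2.1 i j

lemma cochainForm_mem (z : (c.closedForms hc).Z1 𝔘) (i : S.Pt) :
    cochainForm z i ∈ (E.homSheaf (tensorOne D E)).sec (𝔘.U i) := (z.2.2.1 i).1

lemma cochainEnd_add (z : (c.closedForms hc).Z1 𝔘) {i j l y : S.Pt} (hi : y ∈ 𝔘.U i)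
    (hj : y ∈ 𝔘.U j) (hl : y ∈ 𝔘.U l) : cochainEnd z i l ⟨y, hi, hl⟩ =
      cochainEnd z i j ⟨y, hi, hj⟩ + cochainEnd z j l ⟨y, hj, hl⟩ := by
  have h : cochainEnd z j l ⟨y, hj, hl⟩ - cochainEnd z i l ⟨y, hi, hl⟩ +
    cochainEnd z i j ⟨y, hi, hj⟩ = 0 := z.2.2.2.1 i j l y hi hj hl
  rw [← sub_eq_zero, ← neg_eq_zero, ← h]
  abel

lemma cochainEnd_self (z : (c.closedForms hc).Z1 𝔘) {i y : S.Pt} (hi : y ∈ 𝔘.U i) :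
    cochainEnd z i i ⟨y, hi, hi⟩ = 0 := by
  have h := cochainEnd_add z hi hi hi
  rwa [left_eq_add] at h

lemma cochainForm_sub (z : (c.closedForms hc).Z1 𝔘) {i j y : S.Pt} (hi : y ∈ 𝔘.U i)
    (hj : y ∈ 𝔘.U j) : cochainForm z j ⟨y, hj⟩ - cochainForm z i ⟨y, hi⟩ =
      (c.conn y).dEnd (cochainEnd z i j ⟨y, hi, hj⟩) := z.2.2.2.2.1 i j y hi hj

lemma cochainForm_closed (z : (c.closedForms hc).Z1 𝔘) (i : S.Pt) (y : 𝔘.U i) :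
    (c.conn y).dHom (toPole ∘ₗ cochainForm z i y) = 0 := z.2.2.2.2.2 i y y.2

/-- Two cocycles are cohomologous on the cover if they differ by the coboundary of some `h`. -/
lemma mem_B1_iff (z w : (c.closedForms hc).Z1 𝔘) : w.1 - z.1 ∈ (c.closedForms hc).B1 𝔘 ↔
    ∃ h : ∀ i : S.Pt, ∀ y : 𝔘.U i, E.st y →ₗ[S.st y] E.st y,
      (∀ i, h i ∈ (E.homSheaf E.sheaf).sec (𝔘.U i)) ∧
      (∀ (i j y : S.Pt) (hi : y ∈ 𝔘.U i) (hj : y ∈ 𝔘.U j),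
        cochainEnd w i j ⟨y, hi, hj⟩ - cochainEnd z i j ⟨y, hi, hj⟩ = h j ⟨y, hj⟩ - h i ⟨y, hi⟩) ∧
      (∀ (i : S.Pt) (y : 𝔘.U i),
        cochainForm w i y - cochainForm z i y = (c.conn y).dEnd (h i y)) :=
  ⟨fun ⟨h, h1, h2, h3⟩ => ⟨h, h1, h2, fun i y => h3 i y y.2⟩,
    fun ⟨h, h1, h2, h3⟩ => ⟨h, h1, h2, fun i y hy => h3 i ⟨y, hy⟩⟩⟩

end Connection

namespace Deformation
open Connection
variable {hc : c.IsIntegrable} {𝔘 𝔙 : PointCover S} (P Q : Deformation c)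

/-- `ε ∘ σ` is the inclusion of `E`, for every splitting `σ`. -/
lemma eps_comp_sect {y : S.Pt} {σ : E.st y →ₗ[S.st y] P.tot.st y}
    (hσ : ∀ s, OMod.stMap P.proj y (σ s) = s) : OMod.stMap P.eps y ∘ₗ σ = P.incl y := by
  ext s
  rw [LinearMap.comp_apply, ← P.incl_proj, hσ]

/-- The splittings `σ_i` over the members of a cover describe the deformation by the cocycle
`z = (a, A)`: they have the transition functions `σ_j = σ_i + ι ∘ a_ij` and the second fundamental
forms `A_i`. -/
structure IsDescribedBy (z : (c.closedForms hc).Z1 𝔘)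
    (σ : ∀ i : S.Pt, ∀ y : 𝔘.U i, E.st y →ₗ[S.st y] P.tot.st y) : Prop where
  mem : ∀ i, σ i ∈ (E.homSheaf P.tot.sheaf).sec (𝔘.U i)
  proj : ∀ (i : S.Pt) (y : 𝔘.U i) (s : E.st y), OMod.stMap P.proj y (σ i y s) = s
  trans : ∀ {i j y : S.Pt} (hi : y ∈ 𝔘.U i) (hj : y ∈ 𝔘.U j) (s : E.st y),
    σ j ⟨y, hj⟩ s = σ i ⟨y, hi⟩ s + P.incl y (cochainEnd z i j ⟨y, hi, hj⟩ s)
  conn : ∀ (i : S.Pt) (y : 𝔘.U i) (s : E.st y), (P.conn.conn y).toFun (σ i y s) =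
    LinearMap.rTensor (FormsOne D y) (σ i y) ((c.conn y).toFun s) +
      LinearMap.rTensor (FormsOne D y) (P.incl y) (cochainForm z i y s)

variable {P Q}

/-- As `ε ∘ σ_i = ι`, a cocycle represents a deformation if and only if it describes it in terms
of `ι`. -/
lemma represents_iff {z : (c.closedForms hc).Z1 𝔘} :
    P.Represents 𝔘 z ↔ ∃ σ, P.IsDescribedBy z σ := by
  refine exists_congr fun σ => ⟨fun ⟨h1, h2, h3, h4⟩ => ⟨h1, h2, ?_, ?_⟩,
    fun ⟨h1, h2, h3, h4⟩ => ⟨h1, h2, ?_, ?_⟩⟩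
  · intro i j y hi hj s
    rw [← P.eps_comp_sect (h2 i ⟨y, hi⟩)]
    exact h3 i j y hi hj s
  · intro i y s
    rw [← P.eps_comp_sect (h2 i y)]
    exact h4 i y s
  · intro i j y hi hj s a
    have := h3 hi hj s
    rwa [← P.eps_comp_sect (h2 i ⟨y, hi⟩)] at this
  · intro i y s A
    rw [P.eps_comp_sect (h2 i y)]
    exact h4 i y s

section
variable {z w : (c.closedForms hc).Z1 𝔘}
  {σ τ : ∀ i : S.Pt, ∀ y : 𝔘.U i, E.st y →ₗ[S.st y] P.tot.st y}

lemma IsDescribedBy.refine (h : P.IsDescribedBy z σ) (hle : 𝔘 ≤ 𝔙) :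
    P.IsDescribedBy ((c.closedForms hc).refineZ1 hle z) (fun i y => σ i ⟨y, hle i y.2⟩) where
  mem i := (E.homSheaf P.tot.sheaf).res (hle i) _ (h.mem i)
  proj i y s := h.proj i ⟨y, hle i y.2⟩ s
  trans hi hj s := h.trans (hle _ hi) (hle _ hj) s
  conn i y s := h.conn i ⟨y, hle i y.2⟩ s

/-- Cocycles on the same cover which describe the same deformation are cohomologous. -/
lemma IsDescribedBy.sub_mem (h : P.IsDescribedBy z σ) (h' : P.IsDescribedBy w τ) :
    w.1 - z.1 ∈ (c.closedForms hc).B1 𝔘 := by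
  rw [mem_B1_iff]
  -- The coboundary is that of `h_i = ρ_i ∘ τ_i`, for which `τ_i = σ_i + ι ∘ h_i`.
  refine ⟨fun i y => P.retr (σ i y) (h.proj i y) ∘ₗ τ i y,
    fun i => OMod.comp_mem (P.retr_mem (σ i) (h.proj i) (h.mem i)) (h'.mem i), ?_, ?_⟩
  · intro i j y hi hj
    ext s
    apply P.incl_injective y
    have e1 := (P.isSplit _ (h.proj i ⟨y, hi⟩)).sect_eq_add (h'.proj i ⟨y, hi⟩) s
    have e2 := (P.isSplit _ (h.proj j ⟨y, hj⟩)).sect_eq_add (h'.proj j ⟨y, hj⟩) s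
    have e3 := h'.trans hi hj s
    rw [e1, e2, h.trans hi hj s] at e3
    simp only [LinearMap.sub_apply, map_sub, LinearMap.comp_apply]
    rw [sub_eq_sub_iff_add_eq_add]
    rw [← sub_eq_zero] at e3 ⊢
    rw [← neg_eq_zero, ← e3]
    abel
  · intro i y
    exact (P.isSplit _ (h.proj i y)).secondForm_sub (P.conn_incl y)
      ((P.isSplit _ (h.proj i y)).sect_eq_add (h'.proj i y)) (h.conn i y) (h'.conn i y)

/-- Cohomologous cocycles on the same cover describe the same deformations. -/
lemma IsDescribedBy.exists_of_sub_mem (h : P.IsDescribedBy z σ)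
    (hzw : w.1 - z.1 ∈ (c.closedForms hc).B1 𝔘) : ∃ τ, P.IsDescribedBy w τ := by
  obtain ⟨b, h1, h2, h3⟩ := (mem_B1_iff z w).1 hzw
  -- The new splittings are `τ_i = σ_i + ι ∘ b_i`.
  refine ⟨fun i y => σ i y + P.incl y ∘ₗ b i y, fun i => add_mem (h.mem i)
    (OMod.comp_mem (P.incl_mem _) (h1 i)), fun i y s => ?_, ?_, fun i y s => ?_⟩
  · simp [h.proj, P.proj_incl]
  · intro i j y hi hj s
    have e : cochainEnd w i j ⟨y, hi, hj⟩ =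
        cochainEnd z i j ⟨y, hi, hj⟩ + (b j ⟨y, hj⟩ - b i ⟨y, hi⟩) := by
      rw [← h2 i j y hi hj]; abel
    simp only [LinearMap.add_apply, LinearMap.comp_apply, h.trans hi hj s, e, map_add,
      LinearMap.sub_apply, map_sub]
    abel
  · have e : cochainForm w i y = cochainForm z i y + (c.conn y).dEnd (b i y) := by
      rw [← h3 i y]; abel
    simp only [LinearMap.add_apply, LinearMap.comp_apply, map_add, h.conn, e, P.conn_incl,
      LinearMap.rTensor_add, LinearMap.rTensor_comp, Conn.dEnd, LinearMap.coe_mk, AddHom.coe_mk,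
      map_sub]
    abel

/-- Isomorphic deformations are described by the same cocycles. -/
lemma IsDescribedBy.of_isom (h : P.IsDescribedBy z σ) (hPQ : Isom P Q) :
    ∃ τ, Q.IsDescribedBy z τ := by
  obtain ⟨φ, h1, h2, h3⟩ := hPQ
  have e1 : ∀ (y : S.Pt) (t : P.tot.st y),
      OMod.stMap Q.proj y (OMod.stMap φ.hom y t) = OMod.stMap P.proj y t := fun y t => by
    rw [← LinearMap.comp_apply, ← OMod.stMap_comp, h2]
  have e2 : ∀ (y : S.Pt), OMod.stMap φ.hom y ∘ₗ P.incl y = Q.incl y := fun y => by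
    ext s
    obtain ⟨t, rfl⟩ := P.proj_surjective y s
    rw [LinearMap.comp_apply, P.incl_proj, ← e1, Q.incl_proj, ← LinearMap.comp_apply,
      ← LinearMap.comp_apply, ← OMod.stMap_comp, ← OMod.stMap_comp, h1]
  refine ⟨fun i y => OMod.stMap φ.hom y ∘ₗ σ i y, fun i => OMod.comp_mem (OMod.stMap_mem _ _)
    (h.mem i), fun i y s => ?_, ?_, fun i y s => ?_⟩
  · rw [LinearMap.comp_apply, e1, h.proj]
  · intro i j y hi hj s
    rw [LinearMap.comp_apply, h.trans hi hj s, map_add, ← e2]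
    rfl
  · rw [LinearMap.comp_apply, h3, h.conn, map_add, ← e2]
    exact congrArg₂ (· + ·)
      (LinearMap.rTensor_comp_apply (FormsOne D y) (OMod.stMap φ.hom y) (σ i y) _).symm
      (LinearMap.rTensor_comp_apply (FormsOne D y) (OMod.stMap φ.hom y) (P.incl y) _).symm

end

section isom
variable {z : (c.closedForms hc).Z1 𝔘}
  {σ : ∀ i : S.Pt, ∀ y : 𝔘.U i, E.st y →ₗ[S.st y] P.tot.st y}
  {τ : ∀ i : S.Pt, ∀ y : 𝔘.U i, E.st y →ₗ[S.st y] Q.tot.st y}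

/-- A stalk of the isomorphism between two deformations which are described by the same cocycle:
it maps `σ_i` to `τ_i` and is the identity of `E` on the inclusions of `E`. -/
def isoSt (hσ : P.IsDescribedBy z σ) (τ : ∀ i : S.Pt, ∀ y : 𝔘.U i, E.st y →ₗ[S.st y] Q.tot.st y)
    (i y : S.Pt) (hi : y ∈ 𝔘.U i) : P.tot.st y →ₗ[S.st y] Q.tot.st y :=
  (P.isSplit _ (hσ.proj i ⟨y, hi⟩)).desc (Q.incl y) (τ i ⟨y, hi⟩)

variable (hσ : P.IsDescribedBy z σ) (hτ : Q.IsDescribedBy z τ)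
include hσ hτ

/-- The maps do not depend on the member of the cover, as `σ` and `τ` have the same transition
functions. -/
lemma isoSt_eq {i j y : S.Pt} (hi : y ∈ 𝔘.U i) (hj : y ∈ 𝔘.U j) :
    isoSt hσ τ i y hi = isoSt hσ τ j y hj := by
  refine (P.isSplit _ (hσ.proj j ⟨y, hj⟩)).hom_ext (fun s => ?_) (fun s => ?_)
  · rw [isoSt, isoSt, IsSplit.desc_sect, hσ.trans hi hj s, map_add, IsSplit.desc_sect,
      IsSplit.desc_incl, hτ.trans hi hj s]
  · rw [isoSt, isoSt, IsSplit.desc_incl, IsSplit.desc_incl]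

lemma isoSt_mem : (fun y : (⊤ : S.Op) => isoSt hσ τ y y (𝔘.mem y)) ∈
    (P.tot.homSheaf Q.tot.sheaf).sec ⊤ := by
  refine (P.tot.homSheaf Q.tot.sheaf).glue _ _ fun x => ⟨𝔘.U x, le_top, 𝔘.mem x, ?_⟩
  convert add_mem (OMod.comp_mem (hτ.mem x) (OMod.stMap_mem P.proj (𝔘.U x)))
    (OMod.comp_mem (Q.incl_mem (𝔘.U x)) (P.retr_mem (σ x) (hσ.proj x) (hσ.mem x))) using 1
  ext y : 1
  exact isoSt_eq hσ hτ (𝔘.mem y) y.2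

lemma isoSt_isoSt (y : S.Pt) :
    isoSt hτ σ y y (𝔘.mem y) ∘ₗ isoSt hσ τ y y (𝔘.mem y) = LinearMap.id := by
  refine (P.isSplit _ (hσ.proj y ⟨y, 𝔘.mem y⟩)).hom_ext (fun s => ?_) (fun s => ?_)
  · rw [LinearMap.comp_apply, isoSt, isoSt, IsSplit.desc_sect, IsSplit.desc_sect]; rfl
  · rw [LinearMap.comp_apply, isoSt, isoSt, IsSplit.desc_incl, IsSplit.desc_incl]; rfl

/-- Deformations which are described by the same cocycle are isomorphic. -/
lemma isom_of_isDescribedBy : Isom P Q := by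
  let f := OMod.homOfStalks (fun y => isoSt hσ τ y y (𝔘.mem y)) (isoSt_mem hσ hτ)
  let g := OMod.homOfStalks (fun y => isoSt hτ σ y y (𝔘.mem y)) (isoSt_mem hτ hσ)
  have hf : ∀ y, OMod.stMap f y = isoSt hσ τ y y (𝔘.mem y) := OMod.stMap_homOfStalks _ _
  have hg : ∀ y, OMod.stMap g y = isoSt hτ σ y y (𝔘.mem y) := OMod.stMap_homOfStalks _ _
  have split := fun y => P.isSplit _ (hσ.proj y ⟨y, 𝔘.mem y⟩)
  have pσ : ∀ (y : S.Pt) (s : E.st y), OMod.stMap P.proj y (σ y ⟨y, 𝔘.mem y⟩ s) = s :=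
    fun y => hσ.proj y ⟨y, 𝔘.mem y⟩
  have pτ : ∀ (y : S.Pt) (s : E.st y), OMod.stMap Q.proj y (τ y ⟨y, 𝔘.mem y⟩ s) = s :=
    fun y => hτ.proj y ⟨y, 𝔘.mem y⟩
  refine ⟨⟨f, g, OMod.hom_ext_st fun y => ?_, OMod.hom_ext_st fun y => ?_⟩,
    OMod.hom_ext_st fun y => ?_, OMod.hom_ext_st fun y => ?_, fun y t => ?_⟩
  · rw [OMod.stMap_comp, hf, hg, isoSt_isoSt hσ hτ, OMod.stMap_id]
  · rw [OMod.stMap_comp, hf, hg, isoSt_isoSt hτ hσ, OMod.stMap_id]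
  · rw [OMod.stMap_comp, OMod.stMap_comp, hf]
    refine (split y).hom_ext (fun s => ?_) (fun s => ?_)
    · simp only [LinearMap.comp_apply]
      rw [isoSt, IsSplit.desc_sect, ← P.incl_proj, ← Q.incl_proj, pσ, pτ,
        IsSplit.desc_incl]
    · simp only [LinearMap.comp_apply]
      rw [isoSt, IsSplit.desc_incl, ← P.incl_proj, ← Q.incl_proj, P.proj_incl, Q.proj_incl,
        map_zero, map_zero, map_zero]
  · rw [OMod.stMap_comp, hf]
    refine (split y).hom_ext (fun s => ?_) (fun s => ?_)
    · rw [LinearMap.comp_apply, isoSt, IsSplit.desc_sect, pτ, pσ]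
    · rw [LinearMap.comp_apply, isoSt, IsSplit.desc_incl, P.proj_incl, Q.proj_incl]
  · rw [hf]
    exact (split y).conn_desc (P.conn_incl y) (Q.conn_incl y) (hσ.conn y ⟨y, 𝔘.mem y⟩)
      (hτ.conn y ⟨y, 𝔘.mem y⟩) t

end isom

section exist
variable (P)

/-- Every deformation is described by a cocycle, the components of which are `a_ij = ρ_i ∘ σ_j`
and the second fundamental forms of the `σ_i`. -/
lemma exists_isDescribedBy (hE : IsVectorBundle E) (hc : c.IsIntegrable) :
    ∃ (𝔘 : PointCover S) (z : (c.closedForms hc).Z1 𝔘), ∃ σ, P.IsDescribedBy z σ := by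
  choose U hU σ hm hσ using exists_local_section hE P.proj P.proj_surjective
  have split := fun i y => P.isSplit (σ i y) (hσ i y)
  have hB := fun i (y : U i) => (split i y).apply_sect (c := c.conn y) (c' := P.conn.conn y)
    (P.proj_horizontal y)
  have ht : ∀ (i j y : S.Pt) (hi : y ∈ U i) (hj : y ∈ U j) (s : E.st y),
      σ j ⟨y, hj⟩ s = σ i ⟨y, hi⟩ s +
        P.incl y ((P.retr (σ i ⟨y, hi⟩) (hσ i ⟨y, hi⟩) ∘ₗ σ j ⟨y, hj⟩) s) :=
    fun i j y hi hj s => (split i ⟨y, hi⟩).sect_eq_add (hσ j ⟨y, hj⟩) s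
  have hcl : ∀ i (y : U i), (c.conn y).dHom
      (toPole ∘ₗ (split i y).secondForm (P.conn.conn y)) = 0 := fun i y =>
    (split i y).dHom_eq_zero (hc y) (P.integrable y) (hB i y) (P.conn_incl y)
  refine ⟨⟨U, hU⟩, ⟨(fun i j y => P.retr (σ i ⟨y, y.2.1⟩) (hσ i ⟨y, y.2.1⟩) ∘ₗ σ j ⟨y, y.2.2⟩,
    fun i y => (split i y).secondForm (P.conn.conn y)), ?_, ?_, ?_, ?_, ?_⟩, σ, hm, hσ, ?_, ?_⟩
  · intro i j
    exact OMod.comp_mem ((P.tot.homSheaf E.sheaf).res inf_le_left _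
      (P.retr_mem (σ i) (hσ i) (hm i))) ((E.homSheaf P.tot.sheaf).res inf_le_right _ (hm j))
  · intro i
    refine ⟨fun V hV s => ?_, hcl i⟩
    obtain ⟨t, ht⟩ := OMod.exists_sec_of_mem (hm i V hV s)
    have h1 := OMod.rTensor_mem ((P.tot.homSheaf E.sheaf).res hV _
      (P.retr_mem (σ i) (hσ i) (hm i))) (P.conn.sec V t)
    simp only [← ht] at h1
    exact h1
  · intro i j l y hi hj hl
    refine LinearMap.ext fun s => P.incl_injective y ?_
    have h1 := ht i j y hi hj s
    have h2 := ht j l y hj hl s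
    have h3 := ht i l y hi hl s
    rw [h2, h1, ← sub_eq_zero] at h3
    refine Eq.trans ?_ (h3.trans (map_zero _).symm)
    refine (map_add (P.incl y) _ _).trans ?_
    refine (congrArg (· + _) (map_sub (P.incl y) _ _)).trans ?_
    abel
  · intro i j y hi hj
    exact (split i ⟨y, hi⟩).secondForm_sub (P.conn_incl y) (ht i j y hi hj) (hB i ⟨y, hi⟩)
      (hB j ⟨y, hj⟩)
  · exact fun i y hi => hcl i ⟨y, hi⟩
  · exact fun {i j y} hi hj s => ht i j y hi hj s
  · exact fun i y s => hB i y s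

end exist

end Deformation
end KSpace

/-! ### The deformation described by a cocycle -/

namespace KSpace
open LocalForms SheafComplex

variable {k : Type v} [Field k] {S : KSpace.{u} k}

lemma OMod.stMap_zero {M N : S.OMod} (x : S.Pt) : OMod.stMap (0 : M ⟶ N) x = 0 := by
  ext t
  obtain ⟨U, hx, s, rfl⟩ := OMod.exists_germ x t
  rw [OMod.stMap_germ]
  exact map_zero (OMod.germ (M := N) x hx)

lemma OMod.germ_app {M N : S.OMod} (f : M ⟶ N) {U : S.Op} (x : S.Pt) (hx : x ∈ U)
    (s : M.sec U) : OMod.germ x hx (OMod.app f U s) = OMod.stMap f x (OMod.germ x hx s) :=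
  (OMod.stMap_germ f x hx s).symm

variable {D : S.Divisor} {E : S.OMod} {c : Connection D E} {hc : c.IsIntegrable}
  {𝔘 : PointCover S}

open Connection

/-- A sheaf of modules which is an extension of `E` by itself, with inclusion `ι` and projection
`π`, together with splittings `σ_i` over the members of a cover, and the corresponding retractions
`ρ_i`, which have the transition functions `a_ij` of the cocycle `z = (a, A)`. -/
structure SplitExtension (z : (c.closedForms hc).Z1 𝔘) where
  tot : S.OMod
  ι : ∀ y : S.Pt, E.st y →ₗ[S.st y] tot.st y
  π : ∀ y : S.Pt, tot.st y →ₗ[S.st y] E.st y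
  σ : ∀ i : S.Pt, ∀ y : 𝔘.U i, E.st y →ₗ[S.st y] tot.st y
  ρ : ∀ i : S.Pt, ∀ y : 𝔘.U i, tot.st y →ₗ[S.st y] E.st y
  ι_mem : (fun y : (⊤ : S.Op) => ι y) ∈ (E.homSheaf tot.sheaf).sec ⊤
  π_mem : (fun y : (⊤ : S.Op) => π y) ∈ (tot.homSheaf E.sheaf).sec ⊤
  σ_mem : ∀ i, σ i ∈ (E.homSheaf tot.sheaf).sec (𝔘.U i)
  ρ_mem : ∀ i, ρ i ∈ (tot.homSheaf E.sheaf).sec (𝔘.U i)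
  split : ∀ i (y : 𝔘.U i), IsSplit (ι y) (π y) (σ i y) (ρ i y)
  trans : ∀ {i j y : S.Pt} (hi : y ∈ 𝔘.U i) (hj : y ∈ 𝔘.U j) (s : E.st y),
    σ j ⟨y, hj⟩ s = σ i ⟨y, hi⟩ s + ι y (cochainEnd z i j ⟨y, hi, hj⟩ s)

namespace SplitExtension
variable {z : (c.closedForms hc).Z1 𝔘} (X : SplitExtension z)

lemma split_self (y : S.Pt) :
    IsSplit (X.ι y) (X.π y) (X.σ y ⟨y, 𝔘.mem y⟩) (X.ρ y ⟨y, 𝔘.mem y⟩) := X.split y ⟨y, 𝔘.mem y⟩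

/-- The stalk at `y` of the connection with second fundamental forms `A_i`, defined by the splitting
with index `y`. -/
def connSt (y : S.Pt) : Conn (D.ideal y) (S.nullForms y) (X.tot.st y) :=
  (X.split_self y).conn (c.conn y) (cochainForm z y ⟨y, 𝔘.mem y⟩)

/-- By the cocycle condition, the splittings with other indices define the same connection. -/
lemma connSt_eq (i : S.Pt) (y : 𝔘.U i) (t : X.tot.st y) : (X.connSt y).toFun t =
    ((X.split i y).conn (c.conn y) (cochainForm z i y)).toFun t :=
  (X.split_self y).conn_eq (X.split i y) (c.conn y) (X.trans (𝔘.mem y) y.2)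
    (cochainForm_sub z (𝔘.mem y) y.2) t

/-- The connection with second fundamental forms `A_i`. -/
def conn : Connection D X.tot where
  conn := X.connSt
  sec U s := by
    refine (tensorOne D X.tot).glue U _ fun x => ⟨U ⊓ 𝔘.U x, inf_le_left, ⟨x.2, 𝔘.mem x⟩, ?_⟩
    -- On the member of the cover with index `x`, use the formula for the splitting `σ_x`.
    have hU : U ⊓ 𝔘.U x ≤ 𝔘.U x := inf_le_right
    let s' := OMod.res (inf_le_left : U ⊓ 𝔘.U x ≤ U) s
    have h1 := X.π_mem (U ⊓ 𝔘.U x) le_top s'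
    have h2 := X.ρ_mem x (U ⊓ 𝔘.U x) hU s'
    have h3 := E.homSheaf_apply (tensorOne D E) _
      ((E.homSheaf (tensorOne D E)).res hU _ (cochainForm_mem z x)) _ h1
    have h4 := add_mem (OMod.rTensor_mem ((E.homSheaf X.tot.sheaf).res hU _ (X.σ_mem x))
      (c.mem h1)) (OMod.rTensor_mem ((E.homSheaf X.tot.sheaf).res le_top _ X.ι_mem)
        (add_mem h3 (c.mem h2)))
    convert h4 using 1
    ext y
    refine (X.connSt_eq x ⟨y, hU y.2⟩ _).trans ?_
    rw [← OMod.germ_res (inf_le_left : U ⊓ 𝔘.U x ≤ U) (y : S.Pt) y.2 s]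
    rfl

/-- The inclusion as a homomorphism of sheaves. -/
def incl : E ⟶ X.tot := OMod.homOfStalks X.ι X.ι_mem

/-- The projection as a homomorphism of sheaves. -/
def proj : X.tot ⟶ E := OMod.homOfStalks X.π X.π_mem

lemma stMap_proj (y : S.Pt) : OMod.stMap X.proj y = X.π y := OMod.stMap_homOfStalks _ _ y

lemma stMap_eps (y : S.Pt) : OMod.stMap (X.proj ≫ X.incl) y = X.ι y ∘ₗ X.π y := by
  rw [OMod.stMap_comp, stMap_proj, incl, OMod.stMap_homOfStalks]

/-- If `e` is a local frame of `E`, then `σ_i e` is a local frame of the extension over `𝒪[ε]`. -/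
lemma exists_frame (hE : IsVectorBundle E) (x : S.Pt) :
    ∃ (U : S.Op) (_ : x ∈ U) (n : ℕ) (e : Fin n → X.tot.sec U),
    ∀ (V : S.Op) (h : V ≤ U) (s : X.tot.sec V),
      ∃! p : (Fin n → S.O V) × (Fin n → S.O V),
        s = ∑ i, (p.1 i • OMod.res h (e i) +
          p.2 i • OMod.app (X.proj ≫ X.incl) V (OMod.res h (e i))) := by
  obtain ⟨U, hx, n, e, he⟩ := hE x
  have hm := fun i => X.σ_mem x (U ⊓ 𝔘.U x) inf_le_right (OMod.res inf_le_left (e i))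
  choose f hf using fun i => OMod.exists_sec_of_mem (hm i)
  refine ⟨U ⊓ 𝔘.U x, ⟨hx, 𝔘.mem x⟩, n, f, fun V hV s => ?_⟩
  have hV1 : V ≤ U := hV.trans inf_le_left
  have hV2 : V ≤ 𝔘.U x := hV.trans inf_le_right
  have germ_f : ∀ (y : S.Pt) (hy : y ∈ V) i, OMod.germ y hy (OMod.res hV (f i)) =
      X.σ x ⟨y, hV2 hy⟩ (OMod.germ y (hV1 hy) (e i)) := fun y hy i => by
    have := hf i ⟨y, hV hy⟩
    rw [OMod.germ_res] at this
    rw [OMod.germ_res, ← this]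
  have germ_sum : ∀ (p : (Fin n → S.O V) × (Fin n → S.O V)) (y : S.Pt) (hy : y ∈ V),
      OMod.germ y hy (∑ i, (p.1 i • OMod.res hV (f i) +
        p.2 i • OMod.app (X.proj ≫ X.incl) V (OMod.res hV (f i)))) =
      X.σ x ⟨y, hV2 hy⟩ (OMod.germ y hy (∑ i, p.1 i • OMod.res hV1 (e i))) +
        X.ι y (OMod.germ y hy (∑ i, p.2 i • OMod.res hV1 (e i))) := fun p y hy => by
    rw [OMod.germ_sum_smul, OMod.germ_sum_smul, map_sum, map_sum, map_sum,
      ← Finset.sum_add_distrib]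
    refine Finset.sum_congr rfl fun i _ => ?_
    rw [map_add, OMod.germ_smul, OMod.germ_smul, OMod.germ_app, stMap_eps, germ_f, map_smul,
      map_smul, LinearMap.comp_apply]
    congr 3
    exact (X.split x ⟨y, hV2 hy⟩).proj_sect _
  -- The coordinates of `s` over `𝒪[ε]` are the coordinates of `π s` and `ρ_x s` over `𝒪`.
  obtain ⟨s1, h1⟩ := OMod.exists_sec_of_mem (X.π_mem V le_top s)
  obtain ⟨s2, h2⟩ := OMod.exists_sec_of_mem (X.ρ_mem x V hV2 s)
  obtain ⟨a, ha, ha'⟩ := he V hV1 s1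
  obtain ⟨b, hb, hb'⟩ := he V hV1 s2
  refine ⟨(a, b), OMod.sec_ext fun y hy => ?_, fun p hp => Prod.ext (ha' _ ?_) (hb' _ ?_)⟩
  · rw [germ_sum, ← ha, ← hb, ← h1 ⟨y, hy⟩, ← h2 ⟨y, hy⟩]
    exact ((X.split x ⟨y, hV2 hy⟩).sum _).symm
  · refine OMod.sec_ext fun y hy => ?_
    refine (h1 ⟨y, hy⟩).symm.trans ?_
    change X.π y (OMod.germ y hy s) = _
    rw [hp, germ_sum, map_add]
    refine (congrArg₂ (· + ·) ((X.split x ⟨y, hV2 hy⟩).proj_sect _)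
      ((X.split x ⟨y, hV2 hy⟩).proj_incl _)).trans (add_zero _)
  · refine OMod.sec_ext fun y hy => ?_
    refine (h2 ⟨y, hy⟩).symm.trans ?_
    change X.ρ x ⟨y, hV2 hy⟩ (OMod.germ y hy s) = _
    rw [hp, germ_sum, map_add]
    refine (congrArg₂ (· + ·) ((X.split x ⟨y, hV2 hy⟩).retr_sect _)
      ((X.split x ⟨y, hV2 hy⟩).retr_incl _)).trans (zero_add _)

/-- The deformation on a split extension, with `ε = ι ∘ π`. -/
def deformation (hE : IsVectorBundle E) : Deformation c where
  tot := X.tot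
  eps := X.proj ≫ X.incl
  eps_eps := OMod.hom_ext_st fun y => by
    rw [OMod.stMap_comp, stMap_eps, OMod.stMap_zero]
    ext t
    simp [(X.split_self y).proj_incl]
  locallyFree := X.exists_frame hE
  conn := X.conn
  integrable y := (X.split_self y).conn_isIntegrable (hc y) (cochainForm_closed z y ⟨y, 𝔘.mem y⟩)
  eps_horizontal y t := by
    rw [stMap_eps, LinearMap.comp_apply]
    refine ((X.split_self y).conn_incl _ _ _).trans ?_
    rw [(X.split_self y).conn_proj (c.conn y) (cochainForm z y ⟨y, 𝔘.mem y⟩)]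
    exact (LinearMap.rTensor_comp_apply _ _ _ _).symm
  proj := X.proj
  proj_surjective y s := ⟨X.σ y ⟨y, 𝔘.mem y⟩ s, by
    rw [stMap_proj]; exact (X.split_self y).proj_sect s⟩
  proj_ker y := by
    ext t
    rw [stMap_proj, stMap_eps, LinearMap.mem_ker, LinearMap.mem_range]
    constructor
    · intro h
      refine ⟨X.σ y ⟨y, 𝔘.mem y⟩ (X.ρ y ⟨y, 𝔘.mem y⟩ t), ?_⟩
      have h1 := (X.split_self y).sum t
      rw [h, map_zero, zero_add] at h1
      rw [LinearMap.comp_apply, (X.split_self y).proj_sect, h1]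
    · rintro ⟨t, rfl⟩
      exact (X.split_self y).proj_incl _
  proj_horizontal y t := by
    rw [stMap_proj]
    exact (X.split_self y).conn_proj (c.conn y) (cochainForm z y ⟨y, 𝔘.mem y⟩) t

lemma deformation_incl (hE : IsVectorBundle E) (y : S.Pt) :
    (X.deformation hE).incl y = X.ι y := by
  ext s
  obtain ⟨t, rfl⟩ := (X.deformation hE).proj_surjective y s
  rw [Deformation.incl_proj]
  change OMod.stMap (X.proj ≫ X.incl) y t = X.ι y (OMod.stMap X.proj y t)
  rw [stMap_eps, stMap_proj]
  rfl

lemma isDescribedBy (hE : IsVectorBundle E) : (X.deformation hE).IsDescribedBy z X.σ where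
  mem := X.σ_mem
  proj i y s := by
    change OMod.stMap X.proj y _ = s
    rw [stMap_proj]
    exact (X.split i y).proj_sect s
  trans hi hj s := by
    rw [deformation_incl]
    exact X.trans hi hj s
  conn i y s := by
    rw [deformation_incl]
    exact (X.connSt_eq i y _).trans ((X.split i y).conn_self_sect _ _ s)

end SplitExtension

section twist
variable (z : (c.closedForms hc).Z1 𝔘)

/-- The value at `y` of `a_iy`, the transition function from the trivialization with index `y` to
the trivialization with index `i`. -/
def transSelf (i : S.Pt) (y : 𝔘.U i) : E.st y →ₗ[S.st y] E.st y :=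
  cochainEnd z i y ⟨y, y.2, 𝔘.mem y⟩

lemma transSelf_eq_add {i j y : S.Pt} (hi : y ∈ 𝔘.U i) (hj : y ∈ 𝔘.U j) :
    transSelf z j ⟨y, hj⟩ = cochainEnd z j i ⟨y, hj, hi⟩ + transSelf z i ⟨y, hi⟩ :=
  cochainEnd_add z hj hi (𝔘.mem y)

lemma transSelf_self (y : S.Pt) : transSelf z y ⟨y, 𝔘.mem y⟩ = 0 :=
  cochainEnd_self z (𝔘.mem y)

/-- The sheaf obtained by gluing the `E ⊕ E` on the members of the cover by `1 + ε a_ij`. Since the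
cover is indexed by the points, the stalk at `y` can be described in the trivialization with index
`y`, so that the sheaf is a sheaf of functions with values in `E ⊕ E`. A function is a section
if it is one in the trivializations with indices `i`. -/
def twistSheaf : S.FnSheaf (fun y => E.st y × E.st y) where
  sec U :=
    { carrier := {f | (fun y : U => (f y).1) ∈ E.sheaf.sec U ∧
        ∀ i, (fun y : (U ⊓ 𝔘.U i : S.Op) => (f ⟨y, y.2.1⟩).2 +
          transSelf z i ⟨y, y.2.2⟩ (f ⟨y, y.2.1⟩).1) ∈ E.sheaf.sec (U ⊓ 𝔘.U i)}
      zero_mem' := ⟨zero_mem _, fun i => by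
        convert zero_mem (E.sheaf.sec (U ⊓ 𝔘.U i)) using 1; ext y; simp⟩
      add_mem' := fun hf hg => ⟨add_mem hf.1 hg.1, fun i => by
        convert add_mem (hf.2 i) (hg.2 i) using 1; ext y; simp; abel⟩
      neg_mem' := fun hf => ⟨neg_mem hf.1, fun i => by
        convert neg_mem (hf.2 i) using 1; ext y; simp; abel⟩ }
  res h f hf := ⟨E.sheaf.res h _ hf.1, fun i => E.sheaf.res (inf_le_inf_right _ h) _ (hf.2 i)⟩
  glue U f hf := by
    refine ⟨E.sheaf.glue U _ fun x => ?_, fun i => E.sheaf.glue _ _ fun x => ?_⟩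
    · obtain ⟨V, hV, hx, h⟩ := hf x
      exact ⟨V, hV, hx, h.1⟩
    · obtain ⟨V, hV, hx, h⟩ := hf ⟨x, x.2.1⟩
      exact ⟨V ⊓ 𝔘.U i, inf_le_inf_right _ hV, ⟨hx, x.2.2⟩, h.2 i⟩
  smul U r f hf := ⟨E.sheaf.smul U r _ hf.1, fun i => by
    convert E.sheaf.smul _ (S.res inf_le_left r) _ (hf.2 i) using 1
    ext y
    rw [S.germ_res]
    simp⟩

/-- A section `s` of `E` defines the section `σ_i s`, which is `(s, 0)` in the trivialization with
index `i`. -/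
lemma inl_mem_twistSheaf (i : S.Pt) {U : S.Op} (hU : U ≤ 𝔘.U i) {s : ∀ y : U, E.st y}
    (hs : s ∈ E.sheaf.sec U) :
    (fun y : U => (s y, -transSelf z i ⟨y, hU y.2⟩ (s y))) ∈ (twistSheaf z).sec U := by
  refine ⟨hs, fun j => ?_⟩
  have h1 := E.homSheaf_apply E.sheaf _ ((E.homSheaf E.sheaf).res
    (le_inf inf_le_right (inf_le_left.trans hU) : U ⊓ 𝔘.U j ≤ 𝔘.inter j i) _
    (cochainEnd_mem z j i)) _ (E.sheaf.res (inf_le_left : U ⊓ 𝔘.U j ≤ U) _ hs)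
  convert h1 using 1
  ext y
  simp only [transSelf_eq_add z (hU y.2.1) y.2.2, LinearMap.add_apply]
  change _ = cochainEnd z j i ⟨y, _⟩ (s ⟨y, _⟩)
  abel

/-- A section `s` of `E` defines the section `ι s`, which is `(0, s)` in all trivializations. -/
lemma inr_mem_twistSheaf {U : S.Op} {s : ∀ y : U, E.st y} (hs : s ∈ E.sheaf.sec U) :
    (fun y : U => ((0 : E.st y), s y)) ∈ (twistSheaf z).sec U := by
  refine ⟨zero_mem _, fun j => ?_⟩
  convert E.sheaf.res (inf_le_left : U ⊓ 𝔘.U j ≤ U) _ hs using 1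
  ext y
  simp [restr]

/-- A section with value zero at `x` is zero near `x`, as is seen in the trivialization with
index `x`. -/
lemma twistSheaf_ev_injective (x : S.Pt) : Function.Injective ((twistSheaf z).ev x) := by
  rw [injective_iff_map_eq_zero]
  intro t ht
  obtain ⟨U, hx, s, rfl⟩ := OMod.exists_germ x t
  rw [FnSheaf.ev_germ] at ht
  obtain ⟨h1, h2⟩ := (twistSheaf z).val_mem s
  obtain ⟨V, hV, hxV, e1⟩ := OMod.exists_eq_zero h1 ⟨x, hx⟩ (by rw [ht]; rfl)
  obtain ⟨W, hW, hxW, e2⟩ := OMod.exists_eq_zero (h2 x) ⟨x, hx, 𝔘.mem x⟩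
    (by simp only [ht]; simp)
  have hVW : V ⊓ W ≤ U := inf_le_left.trans hV
  have hxVW : x ∈ V ⊓ W := ⟨hxV, hxW⟩
  have h0 : OMod.res hVW s = 0 := by
    apply Subtype.ext
    ext y : 1
    change (twistSheaf z).val s ⟨y, _⟩ = 0
    have e3 := e1 ⟨y, y.2.1⟩
    have e4 := e2 ⟨y, y.2.2⟩
    simp only at e3 e4
    rw [e3, map_zero, add_zero] at e4
    exact Prod.ext e3 e4
  rw [← OMod.germ_res hVW x hxVW, h0, map_zero]

lemma twistSheaf_ev_surjective (x : S.Pt) : Function.Surjective ((twistSheaf z).ev x) := by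
  have h1 : ∀ v : E.st x, ∃ t, (twistSheaf z).ev x t = (v, 0) := fun v => by
    obtain ⟨U, hx, s, rfl⟩ := OMod.exists_germ x v
    have hx' : x ∈ U ⊓ 𝔘.U x := ⟨hx, 𝔘.mem x⟩
    have := inl_mem_twistSheaf z x (inf_le_right : U ⊓ 𝔘.U x ≤ 𝔘.U x)
      (E.germ_mem _ (OMod.res inf_le_left s))
    refine ⟨OMod.germ x hx' ((twistSheaf z).toSec _ this), ?_⟩
    rw [FnSheaf.ev_germ, FnSheaf.val_toSec, OMod.germ_res, transSelf_self]
    simp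
  have h2 : ∀ v : E.st x, ∃ t, (twistSheaf z).ev x t = (0, v) := fun v => by
    obtain ⟨U, hx, s, rfl⟩ := OMod.exists_germ x v
    refine ⟨OMod.germ x hx ((twistSheaf z).toSec _ (inr_mem_twistSheaf z (E.germ_mem _ s))), ?_⟩
    rw [FnSheaf.ev_germ, FnSheaf.val_toSec]
  intro v
  obtain ⟨t1, e1⟩ := h1 v.1
  obtain ⟨t2, e2⟩ := h2 v.2
  exact ⟨t1 + t2, by rw [map_add, e1, e2]; simp⟩

/-- The stalks of the glued sheaf. -/
def twistEquiv (y : S.Pt) : (twistSheaf z).toOMod.st y ≃ₗ[S.st y] E.st y × E.st y :=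
  LinearEquiv.ofBijective ((twistSheaf z).ev y)
    ⟨twistSheaf_ev_injective z y, twistSheaf_ev_surjective z y⟩

lemma twistEquiv_germ {U : S.Op} (y : S.Pt) (hy : y ∈ U) (s : (twistSheaf z).toOMod.sec U) :
    twistEquiv z y (OMod.germ y hy s) = (twistSheaf z).val s ⟨y, hy⟩ := FnSheaf.ev_germ _ y hy s

lemma symm_mem_twistSheaf {U : S.Op} {f : ∀ y : U, E.st y × E.st y}
    (hf : f ∈ (twistSheaf z).sec U) :
    (fun y : U => (twistEquiv z y).symm (f y)) ∈ (twistSheaf z).toOMod.sheaf.sec U := by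
  convert (twistSheaf z).toOMod.germ_mem U ((twistSheaf z).toSec f hf) using 2 with y
  rw [LinearEquiv.symm_apply_eq, twistEquiv_germ]
  rfl

/-- The extension of `E` by `E` with the transition functions `1 + ε a_ij`. -/
def twist : SplitExtension z where
  tot := (twistSheaf z).toOMod
  ι y := (twistEquiv z y).symm.toLinearMap ∘ₗ LinearMap.inr (S.st y) (E.st y) (E.st y)
  π y := LinearMap.fst (S.st y) (E.st y) (E.st y) ∘ₗ (twistEquiv z y).toLinearMap
  σ i y := (twistEquiv z y).symm.toLinearMap ∘ₗ
    (LinearMap.prod LinearMap.id (-transSelf z i y))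
  ρ i y := (LinearMap.snd (S.st y) (E.st y) (E.st y) +
    transSelf z i y ∘ₗ LinearMap.fst (S.st y) (E.st y) (E.st y)) ∘ₗ (twistEquiv z y).toLinearMap
  ι_mem V _ s := symm_mem_twistSheaf z (inr_mem_twistSheaf z (E.germ_mem V s))
  π_mem V _ s := by
    convert ((twistSheaf z).val_mem s).1 using 2 with y
    exact congrArg Prod.fst (twistEquiv_germ z y y.2 s)
  σ_mem i V hV s := symm_mem_twistSheaf z (inl_mem_twistSheaf z i hV (E.germ_mem V s))
  ρ_mem i V hV s := by
    convert E.sheaf.res (le_inf le_rfl hV) _ (((twistSheaf z).val_mem s).2 i) using 2 with y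
    exact congrArg (fun w => w.2 + transSelf z i ⟨y, hV y.2⟩ w.1) (twistEquiv_germ z y y.2 s)
  split i y :=
    { proj_incl := fun s => by simp
      proj_sect := fun s => by simp
      retr_incl := fun s => by simp
      retr_sect := fun s => by simp
      sum := fun t => by
        apply (twistEquiv z y).injective
        rw [map_add]
        simp only [LinearMap.comp_apply, LinearEquiv.coe_coe, LinearEquiv.apply_symm_apply]
        ext <;> simp }
  trans {i j y} hi hj s := by
    apply (twistEquiv z y).injective
    rw [map_add]
    simp only [LinearMap.comp_apply, LinearEquiv.coe_coe, LinearEquiv.apply_symm_apply]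
    rw [transSelf_eq_add z hj hi]
    ext <;> simp

end twist

end KSpace

/-! ### The classification -/

namespace KSpace.Deformation
open SheafComplex

variable {k : Type v} [Field k] {S : KSpace.{u} k} {D : S.Divisor} {E : S.OMod}
  {c : Connection D E} {hc : c.IsIntegrable} {𝔘 𝔙 : PointCover S} {P Q : Deformation c}

/-- Isomorphic deformations have the same class in `ℍ¹`. -/
lemma Represents.cls_eq_of_isom {z : (c.closedForms hc).Z1 𝔘} {w : (c.closedForms hc).Z1 𝔙}
    (hP : P.Represents 𝔘 z) (hQ : Q.Represents 𝔙 w) (h : Isom P Q) :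
    (c.closedForms hc).cls 𝔘 z = (c.closedForms hc).cls 𝔙 w := by
  obtain ⟨σ, hσ⟩ := represents_iff.1 hP
  obtain ⟨τ, hτ⟩ := represents_iff.1 hQ
  obtain ⟨σ', hσ'⟩ := hσ.of_isom h
  obtain ⟨𝔚, h1, h2⟩ := exists_ge_ge 𝔘 𝔙
  rw [← cls_refineZ1 _ h1, ← cls_refineZ1 _ h2]
  exact cls_eq_of_sub_mem _ ((hσ'.refine h1).sub_mem (hτ.refine h2))

/-- Deformations with the same class in `ℍ¹` are isomorphic. -/
lemma Represents.isom_of_cls_eq {z : (c.closedForms hc).Z1 𝔘} {w : (c.closedForms hc).Z1 𝔙}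
    (hP : P.Represents 𝔘 z) (hQ : Q.Represents 𝔙 w)
    (h : (c.closedForms hc).cls 𝔘 z = (c.closedForms hc).cls 𝔙 w) : Isom P Q := by
  obtain ⟨σ, hσ⟩ := represents_iff.1 hP
  obtain ⟨τ, hτ⟩ := represents_iff.1 hQ
  obtain ⟨𝔚, h1, h2, h3⟩ := exists_refine_of_cls_eq _ h
  obtain ⟨σ', hσ'⟩ := (hσ.refine h1).exists_of_sub_mem h3
  exact isom_of_isDescribedBy hσ' (hτ.refine h2)

lemma exists_represents (hE : IsVectorBundle E) (hc : c.IsIntegrable) (P : Deformation c) :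
    ∃ (𝔘 : S.PointCover) (z : (c.closedForms hc).Z1 𝔘), P.Represents 𝔘 z := by
  obtain ⟨𝔘, z, h⟩ := P.exists_isDescribedBy hE hc
  exact ⟨𝔘, z, represents_iff.2 h⟩

/-- The class in `ℍ¹` of a deformation. -/
def h1Class (hE : IsVectorBundle E) (hc : c.IsIntegrable) (P : Deformation c) :
    (c.closedForms hc).H1 :=
  (c.closedForms hc).cls _ (exists_represents hE hc P).choose_spec.choose

lemma h1Class_eq (hE : IsVectorBundle E) {z : (c.closedForms hc).Z1 𝔘}
    (h : P.Represents 𝔘 z) : h1Class hE hc P = (c.closedForms hc).cls 𝔘 z :=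
  (exists_represents hE hc P).choose_spec.choose_spec.cls_eq_of_isom h (Setoid.refl P)

/-- The map from isomorphism classes of deformations to `ℍ¹`. -/
def Classes.toH1 (hE : IsVectorBundle E) (hc : c.IsIntegrable) :
    Classes c → (c.closedForms hc).H1 :=
  Quotient.lift (h1Class hE hc) fun P Q h => by
    obtain ⟨𝔘, z, hP⟩ := exists_represents hE hc P
    obtain ⟨𝔙, w, hQ⟩ := exists_represents hE hc Q
    rw [h1Class_eq hE hP, h1Class_eq hE hQ, hP.cls_eq_of_isom hQ h]

lemma Classes.bijective_toH1 (hE : IsVectorBundle E) (hc : c.IsIntegrable) :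
    Function.Bijective (Classes.toH1 hE hc) := by
  constructor
  · rintro ⟨P⟩ ⟨Q⟩ h
    obtain ⟨𝔘, z, hP⟩ := exists_represents hE hc P
    obtain ⟨𝔙, w, hQ⟩ := exists_represents hE hc Q
    exact Quotient.sound (hP.isom_of_cls_eq hQ
      ((h1Class_eq hE hP).symm.trans (h.trans (h1Class_eq hE hQ))))
  · intro ξ
    obtain ⟨𝔘, z, rfl⟩ := exists_cls_eq _ ξ
    exact ⟨Quotient.mk _ ((twist z).deformation hE),
      h1Class_eq hE (represents_iff.2 ⟨_, (twist z).isDescribedBy hE⟩)⟩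

end KSpace.Deformation

end

theorem mainTheorem8 {k : Type u} [Field k] [IsAlgClosed k] (S : KSpace.{u} k)
    (hS : S.IsSchemeOfFiniteType ∨ S.IsComplexSpace) (D : S.Divisor) (E : S.OMod)
    (hE : KSpace.IsVectorBundle E) (nabla : KSpace.Connection D E)
    (hint : nabla.IsIntegrable) :
    (∀ P : KSpace.Deformation nabla, ∃ (𝔘 : S.PointCover) (z : (nabla.closedForms hint).Z1 𝔘),
      P.Represents 𝔘 z) ∧
    (∃! Φ : KSpace.Deformation.Classes nabla ≃ (nabla.closedForms hint).H1,
      ∀ (P : KSpace.Deformation nabla) (𝔘 : S.PointCover) (z : (nabla.closedForms hint).Z1 𝔘),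
        P.Represents 𝔘 z → Φ (Quotient.mk _ P) = (nabla.closedForms hint).cls 𝔘 z) ∧
    Function.Bijective (KSpace.SheafComplex.Hom.H1 (nabla.deRham hint).twoTermIncl) := by
  refine ⟨KSpace.Deformation.exists_represents hE hint, ⟨Equiv.ofBijective _
    (KSpace.Deformation.Classes.bijective_toH1 hE hint),
    fun P 𝔘 z h => KSpace.Deformation.h1Class_eq hE h, fun Φ hΦ => ?_⟩,
    (nabla.deRham hint).bijective_H1_twoTermIncl⟩
  -- Every deformation is described by some cocycle, which determines its image.
  ext ⟨P⟩
  obtain ⟨𝔘, z, h⟩ := KSpace.Deformation.exists_represents hE hint P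
  exact (hΦ P 𝔘 z h).trans (KSpace.Deformation.h1Class_eq hE h).symm
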